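/- **Setting.** Let $T=\sum_{i=1}^r\sigma_i\,(x_i\otimes y_i\otimes z_i)$ be an $n\times n\times n$ tensor with $r\ge 1$, unit vectors $x_i,y_i,z_i\in\mathbb R^n$ and $\sigma_1\ge\dots\ge\sigma_r>0$. Let $V_x,V_y,V_z$ be the spans of the $x_i$, of the $y_i$ and of the $z_i$. Assume that for some $c>0$ the smallest singular value of each of the $n\times r$ matrices with columns $(x_i)$, $(y_i)$, $(z_i)$ is at least $c$, and that $V_x,V_y,V_z$ are $\mu$-incoherent. Here a subspace $V\subset\mathbb R^n$ of dimension $d$ is $\mu$-incoherent if the orthogonal projection of every standard basis vector onto $V$ has length at most $\sqrt{\mu d/n}$. For $r$-dimensional subspaces $U,V\subset\mathbb R^n$ let $\alpha(U,V)=\|V_\perp^{T}U\|_{\mathrm{op}}$ be the sine of the principal angle, where the columns of $U$ and $V_\perp$ are orthonormal bases of $U$ and of the orthogonal complement of $V$. **Algorithm (Kronecker Alternating Minimization).** The input is a sample $\widehat T$ in which each entry of $T$ is observed independently with probability $p_2$, together with $r$-dimensional subspaces $V_x^0,V_y^0,V_z^0$ of $\mathbb R^n$. Let $k=10^2\log\frac{n\sigma_1}{c\sigma_r}$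 (natural logarithm, rounded up or down to an integer), and let $p'$ be a parameter with $kp'\le p_2$. Split $\widehat T$ into samples $\widehat T_1,\dots,\widehat T_k$, each revealing only entries of $\widehat T$, such that the events "entry $e$ is revealed in $\widehat T_t$", over all $e$ and $t$, are mutually independent and each has probability $p'$. For $t=0,\dots,k-1$, let $B_t$ be an $r^2\times n^2$ matrix whose rows are an orthonormal basis of $V_y^t\otimes V_z^t$; let $S_{t+1}$ be the set of entries revealed in $\widehat T_{t+1}$; let $H_{t+1}$ be a minimizer over $H\in\mathbb R^{n\times r^2}$ of $\|(U_x(T)-HB_t)|_{S_{t+1}}\|_2^2$, where $U_x(T)$ is the $n\times n^2$ unfolding of $T$ along the $x$-mode; and let $V_x^{t+1}$ be the span of the top $r$ left singular vectors of $H_{t+1}$. Compute $V_y^{t+1}$ from $V_x^t,V_z^t$ and $V_z^{t+1}$ from $V_x^t,V_y^t$ in the same way, with the same sample. The output is $V_x^k,V_y^k,V_z^k$. **Statement.** There are absolute constants $\delta>0$ and $n_0$ such that the following holds whenever $n\ge n_0$ and $\max\left(r,\frac{\sigma_1}{\sigma_r},\frac1c,\mu\right)\le n^{\delta}$. Let $\mu'=\left(\frac{2\mu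 r}{c^2}\cdot\frac{\sigma_1^2}{\sigma_r^2}\right)^{10}$, and let $V_x^0,V_y^0,V_z^0$ be (fixed) $\mu'$-incoherent subspaces of dimension $r$ with $$\max\left(\alpha(V_x,V_x^0),\alpha(V_y,V_y^0),\alpha(V_z,V_z^0)\right)\le 0.1 .$$ Set $$p_2=\left(\frac{\mu r\log n}{c}\cdot\frac{\sigma_1}{\sigma_r}\right)^{300}\frac1{n^{3/2}},\qquad p'=\frac{\log^2\left(\frac{n\sigma_1}{c\sigma_r}\right)}{n^2}\left(\frac{10r\mu'}{c}\cdot\frac{\sigma_1}{\sigma_r}\right)^{10}.$$ Then $kp'\le p_2\le 1$, and when Kronecker Alternating Minimization is run with these parameters, with probability at least $0.99$ a run exists and every run (whatever choices of orthonormal bases, minimizers and singular vectors are made) satisfies $$\max\left(\alpha(V_x,V_x^k),\alpha(V_y,V_y^k),\alpha(V_z,V_z^k)\right)\le\left(\frac{\sigma_r c}{10\,\sigma_1 n}\right)^{10^2}.$$ -/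

import Mathlib

open MeasureTheory ProbabilityTheory

noncomputable section

namespace TensorCompletion

/-- Positions of the entries of an `n × n × n` tensor. -/
abbrev Entry (n : ℕ) : Type := Fin n × Fin n × Fin n

/-- A real `n × n × n` tensor. -/
abbrev Tensor (n : ℕ) : Type := Entry n → ℝ

/-- Subspaces of `ℝⁿ`. -/
abbrev Subsp (n : ℕ) : Type := Submodule ℝ (EuclideanSpace ℝ (Fin n))

/-- The tensor `∑ i, σ i • (x i ⊗ y i ⊗ z i)`. -/
def cpTensor {n r : ℕ} (σ : Fin r → ℝ) (x y z : Fin r → EuclideanSpace ℝ (Fin n)) : Tensor n :=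
  fun e => ∑ i, σ i * (x i e.1 * y i e.2.1 * z i e.2.2)

/-- The subspace spanned by a family of vectors. -/
def factorSpan {n r : ℕ} (x : Fin r → EuclideanSpace ℝ (Fin n)) : Subsp n :=
  Submodule.span ℝ (Set.range x)

/-- The `n × r` matrix whose columns are the vectors of the family. -/
def factorMatrix {n r : ℕ} (x : Fin r → EuclideanSpace ℝ (Fin n)) : Matrix (Fin n) (Fin r) ℝ :=
  Matrix.of fun a i => x i a

/-- The smallest of the `r` singular values (Mathlib numbers them from `0`, in decreasing order)
of a matrix with `r` columns. -/
def smallestSingularValue {n r : ℕ} (M : Matrix (Fin n) (Fin r) ℝ) : ℝ :=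
  (Matrix.toEuclideanLin M).singularValues (r - 1)

/-- `V` is `μ`-incoherent: the projection of every standard basis vector onto `V` has length at
most `√(μ r / n)`, where `r = dim V`. -/
def IsIncoherent {n : ℕ} (μ : ℝ) (V : Subsp n) : Prop :=
  ∀ i : Fin n, ‖V.starProjection (EuclideanSpace.single i (1 : ℝ))‖
    ≤ √(μ * (Module.finrank ℝ V : ℝ) / (n : ℝ))

/-- The sine of the principal angle between `U` and `V`: the operator norm of the orthogonal
projection onto `Vᗮ` restricted to `U`. In orthonormal bases of `U` and of `Vᗮ` this operator has
the matrix `V_⊥ᵀ U`. -/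
def sinAngle {n : ℕ} (U V : Subsp n) : ℝ :=
  ‖Vᗮ.orthogonalProjectionOnto ∘L U.subtypeL‖

/-- The standing assumptions on the factors of the tensor: unit vectors, positive decreasing
weights, robust linear independence with parameter `c > 0`, incoherence with parameter `μ`. -/
structure FactorAssumptions {n r : ℕ} (σ : Fin r → ℝ) (x y z : Fin r → EuclideanSpace ℝ (Fin n))
    (c μ : ℝ) : Prop where
  unit_x : ∀ i, ‖x i‖ = 1
  unit_y : ∀ i, ‖y i‖ = 1
  unit_z : ∀ i, ‖z i‖ = 1
  antitone : Antitone σ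
  pos : ∀ i, 0 < σ i
  c_pos : 0 < c
  independent_x : c ≤ smallestSingularValue (factorMatrix x)
  independent_y : c ≤ smallestSingularValue (factorMatrix y)
  independent_z : c ≤ smallestSingularValue (factorMatrix z)
  incoherent_x : IsIncoherent μ (factorSpan x)
  incoherent_y : IsIncoherent μ (factorSpan y)
  incoherent_z : IsIncoherent μ (factorSpan z)

/-! ### Random samples -/

/-- `S` is a random set that contains every element independently with probability `p`. -/
structure IsBernoulliSample {Ω : Type*} [MeasurableSpace Ω] (P : Measure Ω) {α : Type*}
    (p : ℝ) (S : Ω → Finset α) : Prop where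
  measurable : ∀ e, MeasurableSet {ω | e ∈ S ω}
  indep : iIndepSet (fun e => {ω | e ∈ S ω}) P
  prob : ∀ e, P.real {ω | e ∈ S ω} = p

/-- `S₁, …, S_k` is a splitting of the random set `S` into independent samples of rate `p'`: each
of them reveals only elements of `S`, and the events `e ∈ S_t`, over all `t` and `e` together, are
independent and have probability `p'`. -/
structure IsSampleSplitting {Ω : Type*} [MeasurableSpace Ω] (P : Measure Ω) {α : Type*} {k : ℕ}
    (p' : ℝ) (S : Ω → Finset α) (S' : Fin k → Ω → Finset α) : Prop where
  subset : ∀ᵐ ω ∂P, ∀ t, S' t ω ⊆ S ω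
  measurable : ∀ t e, MeasurableSet {ω | e ∈ S' t ω}
  indep : iIndepSet (fun q : Fin k × α => {ω | q.2 ∈ S' q.1 ω}) P
  prob : ∀ t e, P.real {ω | e ∈ S' t ω} = p'

/-! ### Kronecker alternating minimization -/

/-- The first of the three ways to read a position as (row, column) of an `n × n²` unfolding. -/
def modeX (n : ℕ) : Entry n ≃ Fin n × (Fin n × Fin n) where
  toFun e := (e.1, (e.2.1, e.2.2))
  invFun q := (q.1, q.2.1, q.2.2)
  left_inv _ := rfl
  right_inv _ := rfl

/-- The second way to read a position as (row, column) of an unfolding. -/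
def modeY (n : ℕ) : Entry n ≃ Fin n × (Fin n × Fin n) where
  toFun e := (e.2.1, (e.1, e.2.2))
  invFun q := (q.2.1, q.1, q.2.2)
  left_inv _ := rfl
  right_inv _ := rfl

/-- The third way to read a position as (row, column) of an unfolding. -/
def modeZ (n : ℕ) : Entry n ≃ Fin n × (Fin n × Fin n) where
  toFun e := (e.2.2, (e.1, e.2.1))
  invFun q := (q.2.1, q.2.2, q.1)
  left_inv _ := rfl
  right_inv _ := rfl

/-- The unfolding of a tensor along a mode. -/
def unfolding {n : ℕ} (m : Entry n ≃ Fin n × (Fin n × Fin n)) (T : Tensor n) :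
    Matrix (Fin n) (Fin n × Fin n) ℝ :=
  Matrix.of fun i p => T (m.symm (i, p))

/-- The vector `v ⊗ w` in `ℝ^(n²)`. -/
def tensorVec {n : ℕ} (v w : EuclideanSpace ℝ (Fin n)) : EuclideanSpace ℝ (Fin n × Fin n) :=
  WithLp.toLp 2 fun p => v p.1 * w p.2

/-- The subspace `V ⊗ W` of `ℝ^(n²)`. -/
def tensorSpace {n : ℕ} (V W : Subsp n) : Submodule ℝ (EuclideanSpace ℝ (Fin n × Fin n)) :=
  Submodule.span ℝ {u | ∃ v ∈ V, ∃ w ∈ W, u = tensorVec v w}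

/-- The rows of `B` (indexed by `r²` indices) form an orthonormal basis of `Z`. -/
def RowsOrthonormalBasis {n r : ℕ} (B : Matrix (Fin r × Fin r) (Fin n × Fin n) ℝ)
    (Z : Submodule ℝ (EuclideanSpace ℝ (Fin n × Fin n))) : Prop :=
  Orthonormal ℝ (fun a => (WithLp.toLp 2 (B a) : EuclideanSpace ℝ (Fin n × Fin n))) ∧
    Submodule.span ℝ
      (Set.range fun a => (WithLp.toLp 2 (B a) : EuclideanSpace ℝ (Fin n × Fin n))) = Z

/-- The squared Euclidean norm of `U - H B` restricted to the observed positions `O`. -/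
def residual {n r : ℕ} (U : Matrix (Fin n) (Fin n × Fin n) ℝ) (O : Finset (Fin n × (Fin n × Fin n)))
    (B : Matrix (Fin r × Fin r) (Fin n × Fin n) ℝ) (H : Matrix (Fin n) (Fin r × Fin r) ℝ) : ℝ :=
  ∑ q ∈ O, (U q.1 q.2 - (H * B) q.1 q.2) ^ 2

/-- `V` is the span of `r` top left singular vectors of `H`: it is spanned by the first `r`
vectors of an orthonormal basis of eigenvectors of `H Hᵀ` with decreasing eigenvalues. If singular
values coincide, `V` need not be unique. -/
def IsTopLeftSingularSpace {n : ℕ} {β : Type*} [Fintype β] (r : ℕ) (H : Matrix (Fin n) β ℝ)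
    (V : Subsp n) : Prop :=
  r ≤ n ∧ ∃ (b : OrthonormalBasis (Fin n) ℝ (EuclideanSpace ℝ (Fin n))) (ev : Fin n → ℝ),
    Antitone ev ∧ (∀ i, Matrix.toEuclideanLin (H * H.transpose) (b i) = ev i • b i) ∧
    V = Submodule.span ℝ (b '' {i | (i : ℕ) < r})

/-- `V'` is a possible new estimate for the subspace of one mode, computed from the observed entries
`S` of `T` and the current estimates `V`, `W` for the other two modes: take a matrix `B` whose rows
are an orthonormal basis of `V ⊗ W`, a solution `H` of the least squares problem on the observed
entries of the unfolding, and the span of the top `r` left singular vectors of `H`. Only the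
entries of `T` in `S` are used. -/
def IsModeUpdate {n : ℕ} (r : ℕ) (m : Entry n ≃ Fin n × (Fin n × Fin n)) (T : Tensor n)
    (S : Finset (Entry n)) (V W V' : Subsp n) : Prop :=
  ∃ (B : Matrix (Fin r × Fin r) (Fin n × Fin n) ℝ) (H : Matrix (Fin n) (Fin r × Fin r) ℝ),
    RowsOrthonormalBasis B (tensorSpace V W) ∧
    (∀ H' : Matrix (Fin n) (Fin r × Fin r) ℝ,
      residual (unfolding m T) (S.map m.toEmbedding) B H
        ≤ residual (unfolding m T) (S.map m.toEmbedding) B H') ∧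
    IsTopLeftSingularSpace r H V'

/-- Estimates for the three factor subspaces. -/
structure Estimates (n : ℕ) where
  x : Subsp n
  y : Subsp n
  z : Subsp n

/-- One iteration: all three subspaces are recomputed from the previous estimates of the other two,
with the same sample `S`. -/
structure IsIteration {n : ℕ} (r : ℕ) (T : Tensor n) (S : Finset (Entry n))
    (V V' : Estimates n) : Prop where
  update_x : IsModeUpdate r (modeX n) T S V.y V.z V'.x
  update_y : IsModeUpdate r (modeY n) T S V.x V.z V'.y
  update_z : IsModeUpdate r (modeZ n) T S V.x V.y V'.z

/-- `V 0, …, V k` is a run of Kronecker alternating minimization from the initial estimates `V₀`,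
in which iteration `t` uses the sample `S t`; its output is `V k`. -/
structure IsRun {n k : ℕ} (r : ℕ) (T : Tensor n) (S : Fin k → Finset (Entry n))
    (V₀ : Estimates n) (V : Fin (k + 1) → Estimates n) : Prop where
  init : V 0 = V₀
  step : ∀ t : Fin k, IsIteration r T (S t) (V t.castSucc) (V t.succ)

end TensorCompletion

end

noncomputable section

namespace TensorCompletion

open scoped InnerProductSpace

/-! Fix one mode with factors `a`, `b`, `d`, and let `Z = V ⊗ W` be built from the current
estimates, whose angle to the true spans is at most `s`. The least squares problem splits into one
regression per row of the unfolding, and its solution has the form "projection to `Z` of the true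
rows, plus a sampling error". As an operator on row coefficients, the projected signal vanishes on
the orthogonal complement of `factorSpan a` and is at least `0.8 c² σᵣ` on `factorSpan a`, since `Z`
captures all but a fraction `2s` of every combination of the products `b l ⊗ d l`.

The sampling error is caused only by the `defect`, the part of a row orthogonal to `Z`. Its norm is
at most `2s` times that of the row, and its correlations with `Z` have mean zero, so what survives
sampling is a fluctuation. A second moment bound shows that the whole error is at most `s c² σᵣ /
25` with high probability. Comparing the top singular space of signal plus error with `factorSpan a`
gives the angle `s / 10` (`ModeFactors.update`). Both the fluctuation and the tolerance are
proportional to `s`, so the failure probability does not depend on how far the iteration has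
progressed.

The argument needs incoherent estimates, because incoherence bounds the entries of the basis of `Z`
and hence the concentration of the sampled Gram matrices. It is regained in each round, not
propagated: every row of the fit is at most three times the a priori bound on true rows, and the
spectral gap turns this into entrywise bounds on the singular space. This is why `μ'` is the same in
every round.

On a favourable sample the update is also unique, whatever bases, minimizers and singular vectors
are chosen. The estimates before a round are therefore determined by the earlier samples, and the
new sample is independent of them; `roundsProb_exists_bad_path_le` turns this into a union bound.
Probabilities are computed as finite weighted sums over sets of entries, and
`IsSampleSplitting.prob_setOf` transfers the result to the given probability space. With `L = log (n
σ₁ / (c σᵣ))` there are at most `101 L` rounds, each with three modes of failure probability at most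
`2 / (10⁶ L)` (`modeFailure_le`), and the error `0.1 / 10 ^ k` is small enough because `10 > e²`
(`one_div_ten_pow_le`). -/

/-- Vectors of `ℝⁿ`. -/
abbrev Vec (n : ℕ) : Type := EuclideanSpace ℝ (Fin n)

/-- Vectors of `ℝ^(n²)`. -/
abbrev Vec₂ (n : ℕ) : Type := EuclideanSpace ℝ (Fin n × Fin n)

/-! ### Singular values and families of vectors -/

/-- Expand `v` in eigenvectors of `T* T`: singular values are numbered from `0`, so the one of index
`d - 1` is the square root of the least eigenvalue. -/
theorem mul_norm_le_of_le_singularValues {E F : Type*} [NormedAddCommGroup E]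
    [InnerProductSpace ℝ E] [FiniteDimensional ℝ E] [NormedAddCommGroup F]
    [InnerProductSpace ℝ F] [FiniteDimensional ℝ F] (T : E →ₗ[ℝ] F) {d : ℕ}
    (hd : Module.finrank ℝ E = d) (hpos : 0 < d) {c : ℝ} (hc0 : 0 ≤ c)
    (hc : c ≤ T.singularValues (d - 1)) (v : E) : c * ‖v‖ ≤ ‖T v‖ := by
  have hS := T.isSymmetric_adjoint_comp_self
  set b := hS.eigenvectorBasis hd with hb
  have hlast : ∀ i : Fin d, c ^ 2 ≤ hS.eigenvalues hd i := by
    intro i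
    have h1 := T.sq_singularValues_of_lt hd (i := d - 1) (by omega)
    have h2 : hS.eigenvalues hd ⟨d - 1, by omega⟩ ≤ hS.eigenvalues hd i :=
      hS.eigenvalues_antitone hd (by rw [Fin.le_def]; have := i.2; simp only; omega)
    calc c ^ 2 ≤ (T.singularValues (d - 1)) ^ 2 := by gcongr
      _ ≤ _ := by rw [h1]; exact h2
  have hnorm : ‖T v‖ ^ 2 = ∑ i, hS.eigenvalues hd i * ⟪b i, v⟫_ℝ ^ 2 := by
    have h1 : ‖T v‖ ^ 2 = ⟪v, (T.adjoint ∘ₗ T) v⟫_ℝ := by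
      rw [LinearMap.comp_apply, LinearMap.adjoint_inner_right, real_inner_self_eq_norm_sq]
    rw [h1, ← b.sum_inner_mul_inner]
    refine Finset.sum_congr rfl fun i _ => ?_
    have h2 : ⟪b i, (T.adjoint ∘ₗ T) v⟫_ℝ = hS.eigenvalues hd i * ⟪b i, v⟫_ℝ := by
      rw [← hS (b i) v, hb, hS.apply_eigenvectorBasis hd i, real_inner_smul_left]
      simp
    rw [h2, real_inner_comm v (b i)]; ring
  have h3 : ‖v‖ ^ 2 = ∑ i, ⟪b i, v⟫_ℝ ^ 2 := by
    rw [← b.sum_sq_norm_inner_right v]; simp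
  refine le_of_sq_le_sq ?_ (norm_nonneg _)
  rw [mul_pow, hnorm, h3, Finset.mul_sum]
  exact Finset.sum_le_sum fun i _ => mul_le_mul_of_nonneg_right (hlast i) (sq_nonneg _)

/-- The vectors `x i` are robustly independent with parameter `c`. -/
def RobustlyIndependent {n r : ℕ} (c : ℝ) (x : Fin r → Vec n) : Prop :=
  ∀ a : Vec r, c * ‖a‖ ≤ ‖∑ i, a i • x i‖

theorem robustlyIndependent_of_le_smallestSingularValue {n r : ℕ} (hr : 0 < r) {c : ℝ}
    (hc : 0 ≤ c) {x : Fin r → Vec n} (h : c ≤ smallestSingularValue (factorMatrix x)) :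
    RobustlyIndependent c x := by
  intro a
  have h1 := mul_norm_le_of_le_singularValues (Matrix.toEuclideanLin (factorMatrix x))
    (d := r) (by simp) hr hc h a
  have h2 : Matrix.toEuclideanLin (factorMatrix x) a = ∑ i, a i • x i := by
    ext j
    simp [Matrix.toLpLin_apply, Matrix.mulVec, dotProduct, factorMatrix, mul_comm]
  rwa [h2] at h1

theorem RobustlyIndependent.linearIndependent {n r : ℕ} {c : ℝ} (hc : 0 < c)
    {x : Fin r → Vec n} (h : RobustlyIndependent c x) : LinearIndependent ℝ x := by
  rw [Fintype.linearIndependent_iff]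
  intro g hg i
  have h1 := h (WithLp.toLp 2 g)
  simp only [hg, norm_zero] at h1
  have h2 : ‖(WithLp.toLp 2 g : Vec r)‖ = 0 := by
    have := norm_nonneg (WithLp.toLp 2 g : Vec r)
    nlinarith
  have h3 := norm_eq_zero.mp h2
  simpa using congrArg (fun v : Vec r => v i) h3

theorem RobustlyIndependent.finrank_factorSpan {n r : ℕ} {c : ℝ} (hc : 0 < c)
    {x : Fin r → Vec n} (h : RobustlyIndependent c x) :
    Module.finrank ℝ (factorSpan x) = r := by
  rw [factorSpan, finrank_span_eq_card (h.linearIndependent hc), Fintype.card_fin]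

theorem RobustlyIndependent.le_one {n r : ℕ} (hr : 0 < r) {c : ℝ}
    {x : Fin r → Vec n} (h : RobustlyIndependent c x) (hx : ∀ i, ‖x i‖ = 1) : c ≤ 1 := by
  have := h (EuclideanSpace.single ⟨0, hr⟩ 1)
  simpa [Pi.single_apply, ite_smul, hx] using this

theorem mem_factorSpan {n r : ℕ} (x : Fin r → Vec n) (i : Fin r) : x i ∈ factorSpan x :=
  Submodule.subset_span ⟨i, rfl⟩

theorem exists_sum_of_mem_factorSpan {n r : ℕ} {x : Fin r → Vec n} {v : Vec n}
    (hv : v ∈ factorSpan x) : ∃ a : Vec r, v = ∑ i, a i • x i := by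
  obtain ⟨g, hg⟩ := (Submodule.mem_span_range_iff_exists_fun ℝ).mp hv
  exact ⟨WithLp.toLp 2 g, hg.symm⟩

theorem sq_norm_eq_sum {ι : Type*} [Fintype ι] (v : EuclideanSpace ℝ ι) :
    ‖v‖ ^ 2 = ∑ i, v i ^ 2 := by
  rw [EuclideanSpace.norm_sq_eq]; simp

theorem inner_eq_sum {ι : Type*} [Fintype ι] (v w : EuclideanSpace ℝ ι) :
    ⟪v, w⟫_ℝ = ∑ i, v i * w i := by
  simp [PiLp.inner_apply, mul_comm]

theorem inner_single_one {ι : Type*} [Fintype ι] [DecidableEq ι] (j : ι)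
    (v : EuclideanSpace ℝ ι) : ⟪EuclideanSpace.single j (1 : ℝ), v⟫_ℝ = v j := by
  rw [EuclideanSpace.inner_single_left]; simp

/-- Testing a vector of the span against the family loses at most a factor `c`. -/
theorem RobustlyIndependent.mul_norm_le_norm_inner {n r : ℕ} {c : ℝ} (hc : 0 < c)
    {x : Fin r → Vec n} (h : RobustlyIndependent c x) {v : Vec n} (hv : v ∈ factorSpan x) :
    c * ‖v‖ ≤ ‖(WithLp.toLp 2 fun i => ⟪x i, v⟫_ℝ : Vec r)‖ := by
  obtain ⟨a, ha⟩ := exists_sum_of_mem_factorSpan hv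
  have h1 := h a
  rw [← ha] at h1
  set w : Vec r := WithLp.toLp 2 fun i => ⟪x i, v⟫_ℝ with hw
  -- With `a` the coefficients of `v`, Cauchy-Schwarz and `c ‖a‖ ≤ ‖v‖` give the claim after
  -- cancelling one factor `‖v‖`.
  have h2 : ‖v‖ ^ 2 = ⟪a, w⟫_ℝ := by
    rw [← real_inner_self_eq_norm_sq, inner_eq_sum a]
    nth_rewrite 1 [ha]
    rw [sum_inner]
    simp [real_inner_smul_left, hw]
  have h3 : ⟪a, w⟫_ℝ ≤ ‖a‖ * ‖w‖ := real_inner_le_norm a w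
  rcases (norm_nonneg v).eq_or_lt with h0 | h0
  · rw [← h0]; simp
  · have h4 : c * ‖v‖ ^ 2 ≤ ‖v‖ * ‖w‖ := by
      calc c * ‖v‖ ^ 2 ≤ c * (‖a‖ * ‖w‖) := by rw [h2]; gcongr
        _ = (c * ‖a‖) * ‖w‖ := by ring
        _ ≤ ‖v‖ * ‖w‖ := by gcongr
    nlinarith

/-! ### Incoherence -/

theorem abs_apply_le_of_mem {n : ℕ} {V : Subsp n} {v : Vec n} (hv : v ∈ V) (j : Fin n) :
    |v j| ≤ ‖V.starProjection (EuclideanSpace.single j (1 : ℝ))‖ * ‖v‖ := by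
  have h1 : v j = ⟪V.starProjection (EuclideanSpace.single j (1 : ℝ)), v⟫_ℝ := by
    rw [Submodule.inner_starProjection_left_eq_right, Submodule.starProjection_eq_self_iff.mpr hv,
      inner_single_one]
  rw [h1]; exact abs_real_inner_le_norm _ _

theorem IsIncoherent.abs_apply_le {n : ℕ} {μ : ℝ} {V : Subsp n} (h : IsIncoherent μ V)
    {v : Vec n} (hv : v ∈ V) (j : Fin n) :
    |v j| ≤ √(μ * (Module.finrank ℝ V : ℝ) / (n : ℝ)) * ‖v‖ :=
  (abs_apply_le_of_mem hv j).trans (mul_le_mul_of_nonneg_right (h j) (norm_nonneg _))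

/-- Incoherence follows from pointwise bounds on the vectors of the subspace. -/
theorem norm_starProjection_single_le {n : ℕ} {V : Subsp n} {j : Fin n} {B : ℝ}
    (h : ∀ v ∈ V, |v j| ≤ B * ‖v‖) (hB : 0 ≤ B) :
    ‖V.starProjection (EuclideanSpace.single j (1 : ℝ))‖ ≤ B := by
  set w := V.starProjection (EuclideanSpace.single j (1 : ℝ)) with hw
  have hwV : w ∈ V := Submodule.starProjection_apply_mem _ _
  -- The projection of the basis vector is its own test vector: its `j`-th entry equals its squared
  -- norm.
  have h1 : ‖w‖ ^ 2 = w j := by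
    have : ⟪w, w⟫_ℝ = ⟪(EuclideanSpace.single j (1 : ℝ) : Vec n), w⟫_ℝ := by
      nth_rewrite 1 [hw]
      rw [Submodule.inner_starProjection_left_eq_right,
        Submodule.starProjection_eq_self_iff.mpr hwV]
    rw [← real_inner_self_eq_norm_sq, this, inner_single_one]
  have h2 := (le_abs_self _).trans (h w hwV)
  rw [← h1] at h2
  rcases (norm_nonneg w).eq_or_lt with h0 | h0
  · rw [← h0]; exact hB
  · nlinarith

theorem sq_norm_starProjection_single {n r : ℕ} {V : Subsp n}
    (b : OrthonormalBasis (Fin r) ℝ V) (j : Fin n) :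
    ‖V.starProjection (EuclideanSpace.single j (1 : ℝ))‖ ^ 2 = ∑ i, ((b i : Vec n) j) ^ 2 := by
  have h1 : ‖V.starProjection (EuclideanSpace.single j (1 : ℝ))‖
      = ‖V.orthogonalProjectionOnto (EuclideanSpace.single j (1 : ℝ))‖ := rfl
  rw [h1, ← b.sum_sq_norm_inner_right]
  refine Finset.sum_congr rfl fun i _ => ?_
  have : ⟪b i, V.orthogonalProjectionOnto (EuclideanSpace.single j (1 : ℝ))⟫_ℝ
      = (b i : Vec n) j := by
    rw [Submodule.inner_orthogonalProjectionOnto_eq_of_mem_left]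
    simp [EuclideanSpace.inner_single_right]
  rw [this]; simp

/-- The squared lengths of the projected standard basis vectors sum to the trace `r` of the
projection, so their average is `r / n` and they cannot all lie below it. -/
theorem IsIncoherent.one_le {n r : ℕ} (hr : 0 < r) {μ : ℝ} {V : Subsp n}
    (hV : Module.finrank ℝ V = r) (h : IsIncoherent μ V) : 1 ≤ μ := by
  have b : OrthonormalBasis (Fin r) ℝ V :=
    (stdOrthonormalBasis ℝ V).reindex (finCongr hV)
  have h1 : ∑ j, ‖V.starProjection (EuclideanSpace.single j (1 : ℝ))‖ ^ 2 = r := by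
    simp_rw [sq_norm_starProjection_single b]
    rw [Finset.sum_comm]
    have : ∀ i, ∑ j, ((b i : Vec n) j) ^ 2 = 1 := by
      intro i
      rw [← sq_norm_eq_sum]
      have := b.norm_eq_one i
      rw [← Submodule.coe_norm, this]; norm_num
    simp [this]
  have hr' : (0 : ℝ) < r := by exact_mod_cast hr
  by_contra hμ
  push Not at hμ
  have hn : 0 < n := by
    rcases Nat.eq_zero_or_pos n with h0 | h0
    · subst h0; simp at h1; linarith
    · exact h0
  have hn' : (0 : ℝ) < n := by exact_mod_cast hn
  -- The maximum with `0` is needed because `μ` may still be negative here, in which case the real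
  -- square root is `0`.
  have h2 : ∀ j, ‖V.starProjection (EuclideanSpace.single j (1 : ℝ))‖ ^ 2
      ≤ max (μ * r / n) 0 := by
    intro j
    have h3 := h j
    rw [hV] at h3
    calc _ ≤ √(μ * r / n) ^ 2 := by gcongr
      _ ≤ _ := by
        rcases le_total 0 (μ * r / n) with h4 | h4
        · rw [Real.sq_sqrt h4]; exact le_max_left _ _
        · rw [Real.sqrt_eq_zero_of_nonpos h4]; simp
  have h3 : (r : ℝ) ≤ n * max (μ * r / n) 0 := by
    refine h1.symm.le.trans ?_
    calc _ ≤ ∑ j : Fin n, max (μ * r / n) 0 := Finset.sum_le_sum fun j _ => h2 j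
      _ = _ := by rw [Finset.sum_const, Finset.card_univ, Fintype.card_fin, nsmul_eq_mul]
  rw [mul_max_of_nonneg _ _ hn'.le, mul_div_cancel₀ _ hn'.ne', mul_zero] at h3
  rcases le_max_iff.mp h3 with h4 | h4
  · nlinarith
  · linarith

/-! ### Angles -/

theorem norm_sub_starProjection_le {n : ℕ} {U V : Subsp n} {s : ℝ} (h : sinAngle U V ≤ s)
    {v : Vec n} (hv : v ∈ U) : ‖v - V.starProjection v‖ ≤ s * ‖v‖ := by
  have h1 := (Vᗮ.orthogonalProjectionOnto ∘L U.subtypeL).le_opNorm ⟨v, hv⟩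
  have h2 : ‖(Vᗮ.orthogonalProjectionOnto ∘L U.subtypeL) ⟨v, hv⟩‖
      = ‖v - V.starProjection v‖ := by
    rw [← Submodule.starProjection_orthogonal_val]; rfl
  rw [h2] at h1
  exact h1.trans (mul_le_mul_of_nonneg_right h (norm_nonneg v))

/-- A bound for the angle in terms of projections onto `U` of vectors orthogonal to `V`. -/
theorem sinAngle_le_of_orthogonal {n : ℕ} {U V : Subsp n} {s : ℝ} (hs : 0 ≤ s)
    (h : ∀ v ∈ Vᗮ, ‖U.starProjection v‖ ≤ s * ‖v‖) : sinAngle U V ≤ s := by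
  refine ContinuousLinearMap.opNorm_le_bound _ hs fun u => ?_
  set w : Vec n := Vᗮ.starProjection (u : Vec n) with hw
  have hwV : w ∈ Vᗮ := Submodule.starProjection_apply_mem _ _
  have h0 : ‖(Vᗮ.orthogonalProjectionOnto ∘L U.subtypeL) u‖ = ‖w‖ := rfl
  rw [h0]
  -- Duality: projecting `U` to `Vᗮ` and projecting `Vᗮ` to `U` are adjoint operations, so they have
  -- the same norm.
  have h1 : ‖w‖ ^ 2 = ⟪U.starProjection w, (u : Vec n)⟫_ℝ := by
    rw [Submodule.inner_starProjection_left_eq_right,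
      Submodule.starProjection_eq_self_iff.mpr u.2, ← real_inner_self_eq_norm_sq]
    nth_rewrite 2 [hw]
    rw [← Submodule.inner_starProjection_left_eq_right,
        Submodule.starProjection_eq_self_iff.mpr hwV]
  have h2 : ‖w‖ ^ 2 ≤ s * ‖w‖ * ‖u‖ := by
    rw [h1]
    exact (real_inner_le_norm _ _).trans
      (mul_le_mul_of_nonneg_right (h w hwV) (norm_nonneg _))
  rcases (norm_nonneg w).eq_or_lt with h3 | h3
  · rw [← h3]; positivity
  · nlinarith

/-! ### Tensor products of vectors and subspaces -/

@[simp] theorem tensorVec_apply {n : ℕ} (v w : Vec n) (p : Fin n × Fin n) :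
    tensorVec v w p = v p.1 * w p.2 := rfl

theorem tensorVec_smul_left {n : ℕ} (a : ℝ) (v w : Vec n) :
    tensorVec (a • v) w = a • tensorVec v w := by
  ext p; simp [mul_assoc]

theorem tensorVec_smul_right {n : ℕ} (a : ℝ) (v w : Vec n) :
    tensorVec v (a • w) = a • tensorVec v w := by
  ext p; simp [mul_left_comm]

theorem tensorVec_sum_left {n : ℕ} {ι : Type*} (s : Finset ι) (v : ι → Vec n) (w : Vec n) :
    tensorVec (∑ i ∈ s, v i) w = ∑ i ∈ s, tensorVec (v i) w := by
  ext p; simp [Finset.sum_mul]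

theorem tensorVec_sum_right {n : ℕ} {ι : Type*} (s : Finset ι) (v : Vec n) (w : ι → Vec n) :
    tensorVec v (∑ i ∈ s, w i) = ∑ i ∈ s, tensorVec v (w i) := by
  ext p; simp [Finset.mul_sum]

theorem inner_tensorVec {n : ℕ} (v w v' w' : Vec n) :
    ⟪tensorVec v w, tensorVec v' w'⟫_ℝ = ⟪v, v'⟫_ℝ * ⟪w, w'⟫_ℝ := by
  rw [inner_eq_sum, inner_eq_sum, inner_eq_sum, Finset.sum_mul_sum, Fintype.sum_prod_type]
  refine Finset.sum_congr rfl fun i _ => Finset.sum_congr rfl fun j _ => ?_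
  simp only [tensorVec_apply]; ring

theorem norm_tensorVec {n : ℕ} (v w : Vec n) : ‖tensorVec v w‖ = ‖v‖ * ‖w‖ := by
  have h : ‖tensorVec v w‖ ^ 2 = (‖v‖ * ‖w‖) ^ 2 := by
    rw [← real_inner_self_eq_norm_sq, inner_tensorVec, real_inner_self_eq_norm_sq,
      real_inner_self_eq_norm_sq]; ring
  exact (sq_eq_sq₀ (norm_nonneg _) (by positivity)).mp h

theorem tensorVec_mem {n : ℕ} {V W : Subsp n} {v w : Vec n} (hv : v ∈ V) (hw : w ∈ W) :
    tensorVec v w ∈ tensorSpace V W :=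
  Submodule.subset_span ⟨v, hv, w, hw, rfl⟩

/-- Products of orthonormal bases form an orthonormal basis of the tensor product; the mass of
its vectors at a position is the product of the masses of the factors. -/
theorem exists_orthonormalBasis_tensorSpace {n r : ℕ} {V W : Subsp n}
    (hV : Module.finrank ℝ V = r) (hW : Module.finrank ℝ W = r) :
    ∃ b : OrthonormalBasis (Fin r × Fin r) ℝ (tensorSpace V W),
      ∀ p : Fin n × Fin n, ∑ a, ((b a : Vec₂ n) p) ^ 2
        = ‖V.starProjection (EuclideanSpace.single p.1 (1 : ℝ))‖ ^ 2
          * ‖W.starProjection (EuclideanSpace.single p.2 (1 : ℝ))‖ ^ 2 := by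
  let bv : OrthonormalBasis (Fin r) ℝ V := (stdOrthonormalBasis ℝ V).reindex (finCongr hV)
  let bw : OrthonormalBasis (Fin r) ℝ W := (stdOrthonormalBasis ℝ W).reindex (finCongr hW)
  let f : Fin r × Fin r → tensorSpace V W := fun a =>
    ⟨tensorVec (bv a.1 : Vec n) (bw a.2 : Vec n), tensorVec_mem (bv a.1).2 (bw a.2).2⟩
  have hf : Orthonormal ℝ f := by
    rw [orthonormal_iff_ite]
    intro a a'
    have h1 : ⟪f a, f a'⟫_ℝ = ⟪bv a.1, bv a'.1⟫_ℝ * ⟪bw a.2, bw a'.2⟫_ℝ :=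
      inner_tensorVec _ _ _ _
    rw [h1, orthonormal_iff_ite.mp bv.orthonormal, orthonormal_iff_ite.mp bw.orthonormal]
    rcases a with ⟨a, b⟩
    rcases a' with ⟨a', b'⟩
    by_cases h2 : a = a' <;> by_cases h3 : b = b' <;> simp [h2, h3]
  have hspan : ⊤ ≤ Submodule.span ℝ (Set.range f) := by
    have h1 : tensorSpace V W ≤ (Submodule.span ℝ (Set.range f)).map (tensorSpace V W).subtype := by
      refine Submodule.span_le.mpr ?_
      rintro _ ⟨v, hv, w, hw, rfl⟩
      have hv' := congrArg (fun t : V => (t : Vec n)) (bv.sum_repr ⟨v, hv⟩)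
      have hw' := congrArg (fun t : W => (t : Vec n)) (bw.sum_repr ⟨w, hw⟩)
      simp only [Submodule.coe_sum, Submodule.coe_smul] at hv' hw'
      have hvw := congrArg₂ tensorVec hv' hw'
      refine ⟨∑ i, ∑ j, (bv.repr ⟨v, hv⟩ i * bw.repr ⟨w, hw⟩ j) • f (i, j), ?_, ?_⟩
      · exact Submodule.sum_mem _ fun i _ => Submodule.sum_mem _ fun j _ =>
          Submodule.smul_mem _ _ (Submodule.subset_span ⟨_, rfl⟩)
      · refine Eq.trans ?_ hvw
        rw [tensorVec_sum_left]
        simp only [map_sum, map_smul]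
        refine Finset.sum_congr rfl fun i _ => ?_
        rw [tensorVec_sum_right]
        refine Finset.sum_congr rfl fun j _ => ?_
        rw [tensorVec_smul_left, tensorVec_smul_right, smul_smul]
        rfl
    rintro ⟨u, hu⟩ -
    obtain ⟨u', hu', h2⟩ := h1 hu
    have h3 : u' = ⟨u, hu⟩ := Subtype.ext h2
    rwa [← h3]
  refine ⟨OrthonormalBasis.mk hf hspan, fun p => ?_⟩
  rw [sq_norm_starProjection_single bv, sq_norm_starProjection_single bw, Finset.sum_mul_sum,
    Fintype.sum_prod_type]
  refine Finset.sum_congr rfl fun i _ => Finset.sum_congr rfl fun j _ => ?_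
  rw [OrthonormalBasis.coe_mk]
  simp only [f, tensorVec_apply]
  ring

/-- A subspace of `ℝ^(n²)` with an orthonormal basis of small mass at every position has small
entries. -/
theorem abs_apply_le_of_basis {n : ℕ} {ι : Type*} [Fintype ι]
    {Z : Submodule ℝ (Vec₂ n)} (b : OrthonormalBasis ι ℝ Z) {p : Fin n × Fin n} {B : ℝ}
    (hB : 0 ≤ B) (hb : ∑ a, ((b a : Vec₂ n) p) ^ 2 ≤ B ^ 2) {w : Vec₂ n} (hw : w ∈ Z) :
    |w p| ≤ B * ‖w‖ := by
  have h1 := congrArg (fun t : Z => (t : Vec₂ n) p) (b.sum_repr ⟨w, hw⟩)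
  simp only [Submodule.coe_sum, Submodule.coe_smul, WithLp.ofLp_sum, WithLp.ofLp_smul,
    Finset.sum_apply, Pi.smul_apply, smul_eq_mul] at h1
  have h2 : ∑ a, (b.repr ⟨w, hw⟩ a) ^ 2 = ‖w‖ ^ 2 := by
    rw [← sq_norm_eq_sum, LinearIsometryEquiv.norm_map]; rfl
  refine abs_le_of_sq_le_sq ?_ (by positivity)
  rw [← h1, mul_pow, ← h2, mul_comm (B ^ 2)]
  exact (Finset.sum_mul_sq_le_sq_mul_sq _ _ _).trans
    (mul_le_mul_of_nonneg_left hb (Finset.sum_nonneg fun _ _ => sq_nonneg _))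

/-- The basis of the tensor product of two incoherent subspaces has small mass everywhere. -/
theorem exists_basis_tensorSpace_of_isIncoherent {n r : ℕ} {V W : Subsp n} {μ : ℝ} (hμ : 0 ≤ μ)
    (hV : Module.finrank ℝ V = r) (hW : Module.finrank ℝ W = r)
    (hiV : IsIncoherent μ V) (hiW : IsIncoherent μ W) :
    ∃ b : OrthonormalBasis (Fin r × Fin r) ℝ (tensorSpace V W),
      ∀ p : Fin n × Fin n, ∑ a, ((b a : Vec₂ n) p) ^ 2 ≤ (μ * r / n) ^ 2 := by
  obtain ⟨b, hb⟩ := exists_orthonormalBasis_tensorSpace hV hW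
  refine ⟨b, fun p => ?_⟩
  have h1 := hiV p.1
  have h2 := hiW p.2
  rw [hV] at h1
  rw [hW] at h2
  have h0 : 0 ≤ μ * r / n := by positivity
  have h3 : ‖V.starProjection (EuclideanSpace.single p.1 (1 : ℝ))‖ ^ 2 ≤ μ * r / n := by
    rw [← Real.sq_sqrt h0]; gcongr
  have h4 : ‖W.starProjection (EuclideanSpace.single p.2 (1 : ℝ))‖ ^ 2 ≤ μ * r / n := by
    rw [← Real.sq_sqrt h0]; gcongr
  rw [hb, pow_two (μ * r / n)]
  gcongr

/-! ### Slices -/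

/-- The slice of a vector of `ℝ^(n²)` with fixed second index. -/
def slice {n : ℕ} (w : Vec₂ n) (q : Fin n) : Vec n := WithLp.toLp 2 fun p => w (p, q)

theorem sq_norm_eq_sum_slice {n : ℕ} (w : Vec₂ n) : ‖w‖ ^ 2 = ∑ q, ‖slice w q‖ ^ 2 := by
  simp_rw [sq_norm_eq_sum]
  rw [Fintype.sum_prod_type_right]
  rfl

theorem slice_sum_smul_tensorVec {n r : ℕ} (a : Fin r → ℝ) (y z : Fin r → Vec n) (q : Fin n) :
    slice (∑ i, a i • tensorVec (y i) (z i)) q = ∑ i, (a i * z i q) • y i := by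
  ext p
  simp only [slice, WithLp.ofLp_sum, WithLp.ofLp_smul, Finset.sum_apply, Pi.smul_apply,
    smul_eq_mul, tensorVec_apply]
  exact Finset.sum_congr rfl fun i _ => by ring

/-- The products `y i ⊗ z i` inherit robust independence from the `y i`. -/
theorem RobustlyIndependent.mul_norm_le_sum_tensorVec {n r : ℕ} {c : ℝ} (hc : 0 ≤ c)
    {y z : Fin r → Vec n} (h : RobustlyIndependent c y) (hz : ∀ i, ‖z i‖ = 1) (a : Vec r) :
    c * ‖a‖ ≤ ‖∑ i, a i • tensorVec (y i) (z i)‖ := by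
  refine le_of_sq_le_sq ?_ (norm_nonneg _)
  rw [sq_norm_eq_sum_slice]
  -- Each slice is a combination of the `y i` with coefficients `a i * z i q`; summing the squares
  -- over `q` removes the `z i`, which are unit vectors.
  have h1 : ∀ q, c ^ 2 * ∑ i, (a i * z i q) ^ 2
      ≤ ‖slice (∑ i, a i • tensorVec (y i) (z i)) q‖ ^ 2 := by
    intro q
    rw [slice_sum_smul_tensorVec]
    have h2 := h (WithLp.toLp 2 fun i => a i * z i q)
    have h3 : (c * ‖(WithLp.toLp 2 fun i => a i * z i q : Vec r)‖) ^ 2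
        = c ^ 2 * ∑ i, (a i * z i q) ^ 2 := by
      rw [mul_pow, sq_norm_eq_sum]
    rw [← h3]
    exact pow_le_pow_left₀ (by positivity) h2 2
  refine le_trans (le_of_eq ?_) (Finset.sum_le_sum fun q _ => h1 q)
  rw [← Finset.mul_sum, Finset.sum_comm, mul_pow, sq_norm_eq_sum]
  congr 1
  refine Finset.sum_congr rfl fun i _ => ?_
  simp_rw [mul_pow]
  rw [← Finset.mul_sum, ← sq_norm_eq_sum, hz]
  ring

/-- Swapping the two indices. -/
def swapVec {n : ℕ} (w : Vec₂ n) : Vec₂ n := WithLp.toLp 2 fun p => w (p.2, p.1)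

theorem norm_swapVec {n : ℕ} (w : Vec₂ n) : ‖swapVec w‖ = ‖w‖ := by
  refine (sq_eq_sq₀ (norm_nonneg _) (norm_nonneg _)).mp ?_
  rw [sq_norm_eq_sum, sq_norm_eq_sum, Fintype.sum_prod_type, Fintype.sum_prod_type_right]
  rfl

theorem swapVec_sum_smul_tensorVec {n r : ℕ} (a : Fin r → ℝ) (y z : Fin r → Vec n) :
    swapVec (∑ i, a i • tensorVec (y i) (z i)) = ∑ i, a i • tensorVec (z i) (y i) := by
  ext p
  simp only [swapVec, WithLp.ofLp_sum, WithLp.ofLp_smul, Finset.sum_apply, Pi.smul_apply,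
    smul_eq_mul, tensorVec_apply]
  exact Finset.sum_congr rfl fun i _ => by ring

theorem norm_sum_tensorVec_comm {n r : ℕ} (a : Fin r → ℝ) (y z : Fin r → Vec n) :
    ‖∑ i, a i • tensorVec (y i) (z i)‖ = ‖∑ i, a i • tensorVec (z i) (y i)‖ := by
  rw [← swapVec_sum_smul_tensorVec, norm_swapVec]

/-- A linear map on the first factor that contracts the span of the `y i` by `s` contracts sums
of products by `s`. -/
theorem norm_sum_tensorVec_map_le {n r : ℕ} {y : Fin r → Vec n} (A : Vec n →ₗ[ℝ] Vec n) {s : ℝ}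
    (hs : 0 ≤ s) (hA : ∀ v ∈ factorSpan y, ‖A v‖ ≤ s * ‖v‖) (a : Fin r → ℝ) (z : Fin r → Vec n) :
    ‖∑ i, a i • tensorVec (A (y i)) (z i)‖ ≤ s * ‖∑ i, a i • tensorVec (y i) (z i)‖ := by
  refine le_of_sq_le_sq ?_ (by positivity)
  rw [mul_pow, sq_norm_eq_sum_slice, sq_norm_eq_sum_slice, Finset.mul_sum]
  refine Finset.sum_le_sum fun q _ => ?_
  rw [slice_sum_smul_tensorVec, slice_sum_smul_tensorVec, ← mul_pow]
  have h1 : ∑ i, (a i * z i q) • A (y i) = A (∑ i, (a i * z i q) • y i) := by simp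
  rw [h1]
  exact pow_le_pow_left₀ (norm_nonneg _) (hA _ (Submodule.sum_mem _ fun i _ =>
    Submodule.smul_mem _ _ (mem_factorSpan y i))) 2

/-- Telescoping `y ⊗ z - Ay ⊗ Bz = (y - Ay) ⊗ z + Ay ⊗ (z - Bz)`. Each difference costs a factor
`s`, and `A` does not increase norms, whence `2 s`. -/
theorem norm_sum_tensorVec_sub_map_le {n r : ℕ} {y z : Fin r → Vec n} (A B : Vec n →ₗ[ℝ] Vec n)
    {s : ℝ} (hs : 0 ≤ s) (hA : ∀ v ∈ factorSpan y, ‖v - A v‖ ≤ s * ‖v‖)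
    (hA1 : ∀ v, ‖A v‖ ≤ ‖v‖) (hB : ∀ v ∈ factorSpan z, ‖v - B v‖ ≤ s * ‖v‖) (a : Fin r → ℝ) :
    ‖(∑ i, a i • tensorVec (y i) (z i)) - ∑ i, a i • tensorVec (A (y i)) (B (z i))‖
      ≤ 2 * s * ‖∑ i, a i • tensorVec (y i) (z i)‖ := by
  have h2 : (∑ i, a i • tensorVec (y i) (z i)) - ∑ i, a i • tensorVec (A (y i)) (B (z i))
      = (∑ i, a i • tensorVec ((LinearMap.id - A : Vec n →ₗ[ℝ] Vec n) (y i)) (z i))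
      + ∑ i, a i • tensorVec (A (y i)) ((LinearMap.id - B : Vec n →ₗ[ℝ] Vec n) (z i)) := by
    rw [← Finset.sum_add_distrib, ← Finset.sum_sub_distrib]
    refine Finset.sum_congr rfl fun i _ => ?_
    ext p
    simp
    ring
  have h3 := norm_sum_tensorVec_map_le (LinearMap.id - A : Vec n →ₗ[ℝ] Vec n) hs
      (fun v hv => by rw [LinearMap.sub_apply, LinearMap.id_apply]; exact hA v hv) a z
  have h4 : ‖∑ i, a i • tensorVec (A (y i)) ((LinearMap.id - B : Vec n →ₗ[ℝ] Vec n) (z i))‖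
      ≤ s * ‖∑ i, a i • tensorVec (A (y i)) (z i)‖ := by
    rw [norm_sum_tensorVec_comm, norm_sum_tensorVec_comm a _ z]
    exact norm_sum_tensorVec_map_le (LinearMap.id - B : Vec n →ₗ[ℝ] Vec n) hs
      (fun v hv => by rw [LinearMap.sub_apply, LinearMap.id_apply]; exact hB v hv) a _
  have h5 := norm_sum_tensorVec_map_le (y := y) A zero_le_one
      (fun v _ => by rw [one_mul]; exact hA1 v) a z
  rw [one_mul] at h5
  rw [h2]
  calc _ ≤ _ := norm_add_le _ _
    _ ≤ _ := add_le_add h3 (h4.trans (mul_le_mul_of_nonneg_left h5 hs))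
    _ = _ := by ring

theorem norm_sub_starProjection_le_of_mem {E : Type*} [NormedAddCommGroup E]
    [InnerProductSpace ℝ E] {K : Submodule ℝ E} [K.HasOrthogonalProjection] (v : E) {w : E}
    (hw : w ∈ K) : ‖v - K.starProjection v‖ ≤ ‖v - w‖ := by
  rw [Submodule.starProjection_minimal]
  exact ciInf_le ⟨0, by rintro _ ⟨x, rfl⟩; exact norm_nonneg _⟩ (⟨w, hw⟩ : K)

/-- Angles between the factors control the angle between the tensor products. -/
theorem norm_sub_starProjection_tensorSpace_le {n r : ℕ} {y z : Fin r → Vec n} {V W : Subsp n}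
    {s : ℝ} (hs : 0 ≤ s) (hV : sinAngle (factorSpan y) V ≤ s) (hW : sinAngle (factorSpan z) W ≤ s)
    (a : Fin r → ℝ) :
    ‖(∑ i, a i • tensorVec (y i) (z i))
        - (tensorSpace V W).starProjection (∑ i, a i • tensorVec (y i) (z i))‖
      ≤ 2 * s * ‖∑ i, a i • tensorVec (y i) (z i)‖ :=
  (norm_sub_starProjection_le_of_mem _ (Submodule.sum_mem _ fun i _ => Submodule.smul_mem _ _
    (tensorVec_mem (Submodule.starProjection_apply_mem V (y i))
      (Submodule.starProjection_apply_mem W (z i))))).trans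
  (norm_sum_tensorVec_sub_map_le V.starProjection.toLinearMap W.starProjection.toLinearMap hs
    (fun _ hv => norm_sub_starProjection_le hV hv)
    (fun v => Submodule.norm_starProjection_apply_le V v)
    (fun _ hv => norm_sub_starProjection_le hW hv) a)

/-! ### Spans of parts of an orthonormal basis -/

theorem mem_span_image_iff {n : ℕ} (b : OrthonormalBasis (Fin n) ℝ (Vec n)) (s : Set (Fin n))
    (v : Vec n) : v ∈ Submodule.span ℝ (b '' s) ↔ ∀ i, i ∉ s → ⟪b i, v⟫_ℝ = 0 := by
  constructor
  · intro hv i hi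
    induction hv using Submodule.span_induction with
    | mem x hx =>
      obtain ⟨k, hk, rfl⟩ := hx
      rw [orthonormal_iff_ite.mp b.orthonormal, if_neg]
      rintro rfl
      exact hi hk
    | zero => simp
    | add x y _ _ hx hy => rw [inner_add_right, hx, hy, add_zero]
    | smul a x _ hx => rw [real_inner_smul_right, hx, mul_zero]
  · intro h
    rw [← b.sum_repr' v]
    refine Submodule.sum_mem _ fun i _ => ?_
    by_cases hi : i ∈ s
    · exact Submodule.smul_mem _ _ (Submodule.subset_span ⟨i, hi, rfl⟩)
    · rw [h i hi, zero_smul]; exact Submodule.zero_mem _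

theorem finrank_span_image {n : ℕ} (b : OrthonormalBasis (Fin n) ℝ (Vec n)) (s : Finset (Fin n)) :
    Module.finrank ℝ (Submodule.span ℝ (b '' (s : Set (Fin n)))) = s.card := by
  have h1 : LinearIndependent ℝ (fun i : s => b i) :=
    b.orthonormal.linearIndependent.comp _ Subtype.val_injective
  have h2 := finrank_span_eq_card h1
  rw [Fintype.card_coe] at h2
  rw [← h2, Set.image_eq_range]
  rfl

theorem exists_ne_zero_mem_inf {n : ℕ} {A B : Subsp n}
    (h : n < Module.finrank ℝ A + Module.finrank ℝ B) : ∃ v ∈ A, v ∈ B ∧ v ≠ 0 := by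
  have h1 := Submodule.finrank_sup_add_finrank_inf_eq A B
  have h2 : Module.finrank ℝ (A ⊔ B : Subsp n) ≤ n := by
    simpa using Submodule.finrank_le (A ⊔ B)
  have h3 : 0 < Module.finrank ℝ (A ⊓ B : Subsp n) := by omega
  have h4 : (A ⊓ B : Subsp n) ≠ ⊥ := by
    intro h5; rw [h5] at h3; simp at h3
  obtain ⟨v, hv, hv0⟩ := Submodule.exists_mem_ne_zero_of_ne_bot h4
  exact ⟨v, hv.1, hv.2, hv0⟩

/-! ### Top singular spaces -/

/-- `b` diagonalizes `Φᵀ Φ` with decreasing eigenvalues `ev`. -/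
structure Diagonalizes {n : ℕ} {F : Type*} [NormedAddCommGroup F] [InnerProductSpace ℝ F]
    (Φ : Vec n →ₗ[ℝ] F) (b : OrthonormalBasis (Fin n) ℝ (Vec n)) (ev : Fin n → ℝ) : Prop where
  antitone : Antitone ev
  inner_eq : ∀ i v, ⟪Φ (b i), Φ v⟫_ℝ = ev i * ⟪b i, v⟫_ℝ

/-- `V` is spanned by `r` top right singular vectors of `Φ`. -/
def IsTopSpace {n : ℕ} {F : Type*} [NormedAddCommGroup F] [InnerProductSpace ℝ F]
    (r : ℕ) (Φ : Vec n →ₗ[ℝ] F) (V : Subsp n) : Prop :=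
  r ≤ n ∧ ∃ b ev, Diagonalizes Φ b ev ∧ V = Submodule.span ℝ (b '' {i | (i : ℕ) < r})

section

variable {n : ℕ} {F : Type*} [NormedAddCommGroup F] [InnerProductSpace ℝ F]
  {Φ : Vec n →ₗ[ℝ] F} {b : OrthonormalBasis (Fin n) ℝ (Vec n)} {ev : Fin n → ℝ}

theorem sq_norm_eq_sum_inner (b : OrthonormalBasis (Fin n) ℝ (Vec n)) (v : Vec n) :
    ‖v‖ ^ 2 = ∑ i, ⟪b i, v⟫_ℝ ^ 2 := by
  rw [← b.sum_sq_norm_inner_right v]; simp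

theorem Diagonalizes.sq_norm_eq (h : Diagonalizes Φ b ev) (v : Vec n) :
    ‖Φ v‖ ^ 2 = ∑ i, ev i * ⟪b i, v⟫_ℝ ^ 2 := by
  rw [← real_inner_self_eq_norm_sq]
  have h1 : Φ v = ∑ i, ⟪b i, v⟫_ℝ • Φ (b i) := by
    conv_lhs => rw [← b.sum_repr' v]
    simp
  nth_rewrite 1 [h1]
  rw [sum_inner]
  refine Finset.sum_congr rfl fun i _ => ?_
  rw [real_inner_smul_left, h.inner_eq]; ring

/-- Courant-Fischer: `X` has dimension `r`, so it meets the span of the `b k` with `k ≥ r - 1`, of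
dimension `n - r + 1`, in a nonzero vector. On that span `‖Φ v‖²` is at most `ev i * ‖v‖²`. -/
theorem Diagonalizes.le_eigenvalue (h : Diagonalizes Φ b ev) {r : ℕ} (hrn : r ≤ n) {X : Subsp n}
    (hX : Module.finrank ℝ X = r) {α : ℝ} (hα : 0 ≤ α) (hΦ : ∀ v ∈ X, α * ‖v‖ ≤ ‖Φ v‖)
    {i : Fin n} (hi : (i : ℕ) < r) : α ^ 2 ≤ ev i := by
  let s : Finset (Fin n) := Finset.Ici ⟨r - 1, by omega⟩
  have hs : s.card = n - (r - 1) := by simp [s]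
  obtain ⟨v, hv1, hv2, hv0⟩ := exists_ne_zero_mem_inf
    (A := X) (B := Submodule.span ℝ (b '' (s : Set (Fin n))))
    (by rw [finrank_span_image, hX, hs]; omega)
  rw [mem_span_image_iff] at hv2
  have h1 : ‖Φ v‖ ^ 2 ≤ ev i * ‖v‖ ^ 2 := by
    rw [h.sq_norm_eq, sq_norm_eq_sum_inner b, Finset.mul_sum]
    refine Finset.sum_le_sum fun k _ => ?_
    by_cases hk : k ∈ s
    · have : i ≤ k := by
        have := Finset.mem_Ici.mp hk
        rw [Fin.le_def] at this ⊢
        simp only at this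
        omega
      exact mul_le_mul_of_nonneg_right (h.antitone this) (sq_nonneg _)
    · rw [hv2 k (by simpa using hk)]; simp
  have h2 : (α * ‖v‖) ^ 2 ≤ ‖Φ v‖ ^ 2 := pow_le_pow_left₀ (by positivity) (hΦ v hv1) 2
  have h3 : 0 < ‖v‖ ^ 2 := by positivity
  rw [mul_pow] at h2
  exact le_of_mul_le_mul_right (h2.trans h1) h3

/-- The dual half of Courant-Fischer: `Xᗮ` has dimension `n - r` and meets the span of `b 0, …, b
i`, of dimension `i + 1 > r`. -/
theorem Diagonalizes.eigenvalue_le (h : Diagonalizes Φ b ev) {r : ℕ} (hrn : r ≤ n) {X : Subsp n}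
    (hX : Module.finrank ℝ X = r) {β : ℝ} (hΦ : ∀ v ∈ Xᗮ, ‖Φ v‖ ≤ β * ‖v‖)
    {i : Fin n} (hi : r ≤ (i : ℕ)) : ev i ≤ β ^ 2 := by
  let s : Finset (Fin n) := Finset.Iic i
  have hs : s.card = i + 1 := by simp [s]
  have hX' : Module.finrank ℝ (Xᗮ : Subsp n) = n - r := by
    have := Submodule.finrank_add_finrank_orthogonal X
    rw [hX] at this
    simp at this
    omega
  obtain ⟨v, hv1, hv2, hv0⟩ := exists_ne_zero_mem_inf
    (A := Xᗮ) (B := Submodule.span ℝ (b '' (s : Set (Fin n))))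
    (by rw [finrank_span_image, hX', hs]; omega)
  rw [mem_span_image_iff] at hv2
  have h1 : ev i * ‖v‖ ^ 2 ≤ ‖Φ v‖ ^ 2 := by
    rw [h.sq_norm_eq, sq_norm_eq_sum_inner b, Finset.mul_sum]
    refine Finset.sum_le_sum fun k _ => ?_
    by_cases hk : k ∈ s
    · exact mul_le_mul_of_nonneg_right (h.antitone (Finset.mem_Iic.mp hk)) (sq_nonneg _)
    · rw [hv2 k (by simpa using hk)]; simp
  have h2 : ‖Φ v‖ ^ 2 ≤ (β * ‖v‖) ^ 2 := pow_le_pow_left₀ (norm_nonneg _) (hΦ v hv1) 2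
  have h3 : 0 < ‖v‖ ^ 2 := by positivity
  rw [mul_pow] at h2
  exact le_of_mul_le_mul_right (h1.trans h2) h3

theorem IsTopSpace.finrank_eq {r : ℕ} {V : Subsp n} (h : IsTopSpace r Φ V) :
    Module.finrank ℝ V = r := by
  obtain ⟨hr, b, ev, -, rfl⟩ := h
  have h1 : {i : Fin n | (i : ℕ) < r} = ((Finset.univ.filter fun i : Fin n => (i : ℕ) < r) :
      Finset (Fin n)) := by ext; simp
  rw [h1, finrank_span_image, Fin.card_filter_val_lt]
  omega

/-- A vector orthogonal to `V` only has components along eigenvectors of index at least `r`, whose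
eigenvalues are at most `β²` by the min-max bound. Smallness of `Φ` thus passes from the complement
of the true space to that of the computed one, without any gap. -/
theorem IsTopSpace.norm_le_of_mem_orthogonal {r : ℕ} {V X : Subsp n} (h : IsTopSpace r Φ V)
    (hX : Module.finrank ℝ X = r) {β : ℝ} (hβ : 0 ≤ β) (hΦ : ∀ v ∈ Xᗮ, ‖Φ v‖ ≤ β * ‖v‖)
    {v : Vec n} (hv : v ∈ Vᗮ) : ‖Φ v‖ ≤ β * ‖v‖ := by
  obtain ⟨hr, b, ev, hd, rfl⟩ := h
  refine le_of_sq_le_sq ?_ (by positivity)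
  rw [mul_pow, hd.sq_norm_eq, sq_norm_eq_sum_inner b, Finset.mul_sum]
  refine Finset.sum_le_sum fun k _ => ?_
  by_cases hk : (k : ℕ) < r
  · have : ⟪b k, v⟫_ℝ = 0 := hv (b k) (Submodule.subset_span ⟨k, hk, rfl⟩)
    rw [this]; simp
  · exact mul_le_mul_of_nonneg_right (hd.eigenvalue_le hr hX hΦ (not_lt.mp hk)) (sq_nonneg _)

/-- The source of uniqueness of the update. Top eigenvectors of one diagonalization have eigenvalue
at least `α²`, the remaining ones of the other at most `β²`; eigenvectors of the symmetric operator
`Φᵀ Φ` with different eigenvalues are orthogonal. -/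
theorem IsTopSpace.le_of_gap {r : ℕ} {V V' X : Subsp n} (h : IsTopSpace r Φ V)
    (h' : IsTopSpace r Φ V') (hX : Module.finrank ℝ X = r) {α β : ℝ} (hβ : 0 ≤ β) (hαβ : β < α)
    (hα : ∀ v ∈ X, α * ‖v‖ ≤ ‖Φ v‖) (hΦ : ∀ v ∈ Xᗮ, ‖Φ v‖ ≤ β * ‖v‖) : V ≤ V' := by
  obtain ⟨hr, b, ev, hd, rfl⟩ := h
  obtain ⟨-, b', ev', hd', rfl⟩ := h'
  rw [Submodule.span_le]
  rintro _ ⟨i, hi, rfl⟩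
  rw [SetLike.mem_coe, mem_span_image_iff]
  intro k hk
  have h1 := hd.le_eigenvalue hr hX (hβ.trans hαβ.le) hα hi
  have h2 := hd'.eigenvalue_le hr hX hΦ (not_lt.mp hk)
  have h3 := hd.inner_eq i (b' k)
  rw [real_inner_comm, hd'.inner_eq, real_inner_comm] at h3
  have h4 : β ^ 2 < α ^ 2 := by gcongr
  rw [real_inner_comm]
  have h5 : (ev' k - ev i) * ⟪b i, b' k⟫_ℝ = 0 := by linarith
  rcases mul_eq_zero.mp h5 with h6 | h6
  · linarith
  · exact h6

theorem IsTopSpace.eq_of_gap {r : ℕ} {V V' X : Subsp n} (h : IsTopSpace r Φ V)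
    (h' : IsTopSpace r Φ V') (hX : Module.finrank ℝ X = r) {α β : ℝ} (hβ : 0 ≤ β) (hαβ : β < α)
    (hα : ∀ v ∈ X, α * ‖v‖ ≤ ‖Φ v‖) (hΦ : ∀ v ∈ Xᗮ, ‖Φ v‖ ≤ β * ‖v‖) : V = V' :=
  le_antisymm (h.le_of_gap h' hX hβ hαβ hα hΦ) (h'.le_of_gap h hX hβ hαβ hα hΦ)

/-- Entries of vectors in the top space are controlled by the columns of `Φ`. -/
theorem IsTopSpace.abs_apply_le {r : ℕ} {V X : Subsp n} (h : IsTopSpace r Φ V)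
    (hX : Module.finrank ℝ X = r) {α : ℝ} (hα0 : 0 < α) (hα : ∀ v ∈ X, α * ‖v‖ ≤ ‖Φ v‖)
    {v : Vec n} (hv : v ∈ V) (j : Fin n) :
    |v j| ≤ ‖Φ (EuclideanSpace.single j 1)‖ / α * ‖v‖ := by
  obtain ⟨hr, b, ev, hd, rfl⟩ := h
  rw [mem_span_image_iff] at hv
  have hev : ∀ i : Fin n, (i : ℕ) < r → α ^ 2 ≤ ev i := fun i hi =>
    hd.le_eigenvalue hr hX hα0.le hα hi
  -- This is `v` with `Φᵀ Φ` inverted on the top space, so `v j` becomes an inner product of `Φ w`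
  -- with the `j`-th column of `Φ`. For indices outside the top space the numerator is `0`, so a
  -- vanishing `ev i` does no harm.
  set w : Vec n := ∑ i, (⟪b i, v⟫_ℝ / ev i) • b i with hw
  have hbw : ∀ i, ⟪b i, w⟫_ℝ = ⟪b i, v⟫_ℝ / ev i := by
    intro i
    rw [hw, inner_sum]
    simp [real_inner_smul_right, orthonormal_iff_ite.mp b.orthonormal]
  have h1 : ∀ u, ⟪Φ w, Φ u⟫_ℝ = ⟪v, u⟫_ℝ := by
    intro u
    conv_rhs => rw [← b.sum_repr' v]
    rw [hw, map_sum, sum_inner, sum_inner]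
    refine Finset.sum_congr rfl fun i _ => ?_
    rw [map_smul, real_inner_smul_left, real_inner_smul_left, hd.inner_eq]
    by_cases hi : (i : ℕ) < r
    · have : ev i ≠ 0 := by have := hev i hi; have : 0 < α ^ 2 := by positivity
                            linarith
      field_simp
    · rw [hv i hi]; simp
  have h2 : ‖Φ w‖ ^ 2 ≤ (‖v‖ / α) ^ 2 := by
    rw [hd.sq_norm_eq, div_pow, sq_norm_eq_sum_inner b v, Finset.sum_div]
    refine Finset.sum_le_sum fun i _ => ?_
    rw [hbw]
    by_cases hi : (i : ℕ) < r
    · have h3 := hev i hi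
      have h4 : 0 < α ^ 2 := by positivity
      have h5 : ev i * (⟪b i, v⟫_ℝ / ev i) ^ 2 = ⟪b i, v⟫_ℝ ^ 2 / ev i := by
        have : ev i ≠ 0 := by linarith
        field_simp
      rw [h5]
      exact div_le_div_of_nonneg_left (sq_nonneg _) h4 h3
    · rw [hv i hi]; simp
  have h3 : ‖Φ w‖ ≤ ‖v‖ / α := le_of_sq_le_sq h2 (by positivity)
  have h4 : v j = ⟪Φ w, Φ (EuclideanSpace.single j 1)⟫_ℝ := by
    rw [h1, real_inner_comm, inner_single_one]
  rw [h4]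
  calc _ ≤ ‖Φ w‖ * ‖Φ (EuclideanSpace.single j 1)‖ := abs_real_inner_le_norm _ _
    _ ≤ ‖v‖ / α * ‖Φ (EuclideanSpace.single j 1)‖ := by gcongr
    _ = _ := by ring

end

/-! ### Least squares -/

/-- The observed positions in row `j`. -/
def rowSample {n : ℕ} (O : Finset (Fin n × (Fin n × Fin n))) (j : Fin n) :
    Finset (Fin n × Fin n) :=
  Finset.univ.filter fun p => (j, p) ∈ O

/-- The linear combination of the rows `f j` with given coefficients. -/
def rowCombination {n : ℕ} (f : Fin n → Vec₂ n) : Vec n →ₗ[ℝ] Vec₂ n :=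
  ∑ j, (LinearMap.toSpanSingleton ℝ (Vec₂ n) (f j)) ∘ₗ
    (EuclideanSpace.proj j : Vec n →L[ℝ] ℝ).toLinearMap

theorem rowCombination_apply {n : ℕ} (f : Fin n → Vec₂ n) (v : Vec n) :
    rowCombination f v = ∑ j, v j • f j := by
  simp [rowCombination]

theorem rowCombination_single {n : ℕ} (f : Fin n → Vec₂ n) (j : Fin n) :
    rowCombination f (EuclideanSpace.single j 1) = f j := by
  simp [rowCombination_apply]

/-- `f` is a row by row least squares fit to `u` from `Z` on the observed positions `O`. -/
structure IsFit {n : ℕ} (Z : Submodule ℝ (Vec₂ n)) (u : Fin n → Vec₂ n)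
    (O : Finset (Fin n × (Fin n × Fin n))) (f : Fin n → Vec₂ n) : Prop where
  mem : ∀ j, f j ∈ Z
  normal : ∀ j, ∀ w ∈ Z, ∑ p ∈ rowSample O j, (u j p - f j p) * w p = 0

theorem sum_ite_row {n : ℕ} (O : Finset (Fin n × (Fin n × Fin n))) (j : Fin n)
    (g : Fin n × (Fin n × Fin n) → ℝ) :
    ∑ q ∈ O, (if q.1 = j then g q else 0) = ∑ p ∈ rowSample O j, g (j, p) := by
  rw [← Finset.sum_filter]
  refine (Finset.sum_bij (fun p _ => (j, p)) ?_ ?_ ?_ ?_).symm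
  · intro p hp; simpa [rowSample] using hp
  · intro p _ p' _ h; simpa using h
  · rintro ⟨i, p⟩ hq
    simp only [Finset.mem_filter] at hq
    obtain ⟨h1, rfl⟩ := hq
    exact ⟨p, by simpa [rowSample] using h1, rfl⟩
  · intro p _; rfl

/-- First order condition at the minimum `t = 0`. The choice `t = a / (|b| + 1)` makes the quadratic
negative unless `a = 0`. -/
theorem eq_zero_of_forall_quadratic {a b : ℝ} (h : ∀ t : ℝ, 0 ≤ t ^ 2 * b - 2 * t * a) :
    a = 0 := by
  have h1 := h (a / (|b| + 1))
  have h2 : 0 < |b| + 1 := by positivity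
  have h3 := le_abs_self b
  have h4 : (a / (|b| + 1)) ^ 2 * b - 2 * (a / (|b| + 1)) * a
      = a ^ 2 * (b - 2 * (|b| + 1)) / (|b| + 1) ^ 2 := by
    field_simp
  rw [h4] at h1
  by_contra ha
  have h5 : 0 < a ^ 2 := by positivity
  have h6 : a ^ 2 * (b - 2 * (|b| + 1)) / (|b| + 1) ^ 2 < 0 :=
    div_neg_of_neg_of_pos (mul_neg_of_pos_of_neg h5 (by linarith [abs_nonneg b])) (by positivity)
  linarith

/-- The normal equations, obtained by perturbing the single entry `(j, a)` of `H`; this only changes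
row `j` of the residual. -/
theorem residual_normal {n r : ℕ} {U : Matrix (Fin n) (Fin n × Fin n) ℝ}
    {O : Finset (Fin n × (Fin n × Fin n))} {B : Matrix (Fin r × Fin r) (Fin n × Fin n) ℝ}
    {H : Matrix (Fin n) (Fin r × Fin r) ℝ} (hH : ∀ H', residual U O B H ≤ residual U O B H')
    (j : Fin n) (a : Fin r × Fin r) :
    ∑ p ∈ rowSample O j, (U j p - (H * B) j p) * B a p = 0 := by
  refine eq_zero_of_forall_quadratic (b := ∑ p ∈ rowSample O j, B a p ^ 2) fun t => ?_
  have h1 := hH (H + t • Matrix.single j a 1)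
  have h2 : ∀ q : Fin n × (Fin n × Fin n),
      ((H + t • Matrix.single j a (1 : ℝ) : Matrix (Fin n) (Fin r × Fin r) ℝ) * B) q.1 q.2
      = (H * B) q.1 q.2 + t * (if q.1 = j then B a q.2 else 0) := by
    intro q
    rw [Matrix.add_mul, Matrix.add_apply, Matrix.smul_mul, Matrix.smul_apply, smul_eq_mul]
    congr 2
    split_ifs with h
    · rw [h, Matrix.single_mul_apply_same, one_mul]
    · rw [Matrix.single_mul_apply_of_ne _ _ _ _ _ h]
  have h3 : residual U O B (H + t • Matrix.single j a 1) = residual U O B H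
      - 2 * t * (∑ p ∈ rowSample O j, (U j p - (H * B) j p) * B a p)
      + t ^ 2 * ∑ p ∈ rowSample O j, B a p ^ 2 := by
    rw [← sum_ite_row O j (fun q => (U q.1 q.2 - (H * B) q.1 q.2) * B a q.2),
      ← sum_ite_row O j (fun q => B a q.2 ^ 2), residual, residual, Finset.mul_sum,
      Finset.mul_sum, ← Finset.sum_sub_distrib, ← Finset.sum_add_distrib]
    refine Finset.sum_congr rfl fun q _ => ?_
    rw [h2]
    split_ifs <;> ring
  linarith

/-- The rows of the unfolding of a tensor. -/
def unfoldingRow {n : ℕ} (m : Entry n ≃ Fin n × (Fin n × Fin n)) (T : Tensor n) (j : Fin n) :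
    Vec₂ n :=
  WithLp.toLp 2 (unfolding m T j)

/-- An update is the top singular space of a least squares fit. -/
theorem IsModeUpdate.exists_isFit {n r : ℕ} {m : Entry n ≃ Fin n × (Fin n × Fin n)}
    {T : Tensor n} {S : Finset (Entry n)} {V W V' : Subsp n} (h : IsModeUpdate r m T S V W V') :
    ∃ f, IsFit (tensorSpace V W) (unfoldingRow m T) (S.map m.toEmbedding) f ∧
      IsTopSpace r (rowCombination f) V' := by
  obtain ⟨B, H, ⟨hB, hBZ⟩, hH, hr, b, ev, hev, hb, hV'⟩ := h
  have hrow : ∀ j, (WithLp.toLp 2 ((H * B) j) : Vec₂ n)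
      = ∑ a, H j a • (WithLp.toLp 2 (B a) : Vec₂ n) := by
    intro j; ext p
    simp [Matrix.mul_apply]
  refine ⟨fun j => WithLp.toLp 2 ((H * B) j), ⟨fun j => ?_, fun j w hw => ?_⟩, hr, b, ev,
    ⟨hev, fun i v => ?_⟩, hV'⟩
  · rw [hrow, ← hBZ]
    exact Submodule.sum_mem _ fun a _ => Submodule.smul_mem _ _ (Submodule.subset_span ⟨a, rfl⟩)
  · rw [← hBZ] at hw
    induction hw using Submodule.span_induction with
    | mem x hx =>
      obtain ⟨a, rfl⟩ := hx
      exact residual_normal hH j a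
    | zero => simp
    | add x y _ _ hx hy =>
      simp only [WithLp.ofLp_add, Pi.add_apply, mul_add, Finset.sum_add_distrib] at hx hy ⊢
      rw [hx, hy, add_zero]
    | smul a x _ hx =>
      simp only [WithLp.ofLp_smul, Pi.smul_apply, smul_eq_mul, mul_left_comm _ a] at hx ⊢
      rw [← Finset.mul_sum, hx, mul_zero]
  -- The rows of `B` are orthonormal, so the Gram matrix of the rows of `H * B` is `H Hᵀ`. Left
  -- singular vectors of `H` can therefore be read off from the fitted rows, without reference to
  -- `B`.
  · have h1 : ∀ j j', ⟪(WithLp.toLp 2 ((H * B) j) : Vec₂ n),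
        (WithLp.toLp 2 ((H * B) j') : Vec₂ n)⟫_ℝ = (H * H.transpose) j j' := by
      intro j j'
      rw [hrow, hrow, sum_inner, Matrix.mul_apply]
      refine Finset.sum_congr rfl fun a _ => ?_
      rw [real_inner_smul_left, inner_sum]
      simp [real_inner_smul_right, orthonormal_iff_ite.mp hB]
    have h2 := congrArg (fun w : Vec n => ⟪w, v⟫_ℝ) (hb i)
    simp only [real_inner_smul_left] at h2
    rw [← h2, rowCombination_apply, rowCombination_apply, sum_inner, inner_eq_sum]
    simp only [inner_sum, real_inner_smul_left, real_inner_smul_right, h1,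
      Matrix.toLpLin_apply, Matrix.mulVec, dotProduct]
    rw [Finset.sum_comm]
    refine Finset.sum_congr rfl fun k _ => ?_
    rw [Finset.sum_mul]
    refine Finset.sum_congr rfl fun j _ => ?_
    have h3 : (H * H.transpose) j k = (H * H.transpose) k j := by
      rw [Matrix.mul_apply, Matrix.mul_apply]
      exact Finset.sum_congr rfl fun a _ => by
        rw [Matrix.transpose_apply, Matrix.transpose_apply, mul_comm]
    rw [h3]; ring

/-! ### Existence of updates -/

/-- The residual is a squared distance to the range of a linear map into a finite-dimensional space,
and the orthogonal projection to that range attains it. -/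
theorem exists_residual_minimizer {n r : ℕ} (U : Matrix (Fin n) (Fin n × Fin n) ℝ)
    (O : Finset (Fin n × (Fin n × Fin n))) (B : Matrix (Fin r × Fin r) (Fin n × Fin n) ℝ) :
    ∃ H, ∀ H' : Matrix (Fin n) (Fin r × Fin r) ℝ, residual U O B H ≤ residual U O B H' := by
  let A : Matrix (Fin n) (Fin r × Fin r) ℝ →ₗ[ℝ] EuclideanSpace ℝ O :=
    { toFun := fun H => WithLp.toLp 2 fun q => (H * B) q.1.1 q.1.2
      map_add' := fun H H' => by ext q; simp [Matrix.add_mul]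
      map_smul' := fun t H => by ext q; simp }
  let u : EuclideanSpace ℝ O := WithLp.toLp 2 fun q => U q.1.1 q.1.2
  have hres : ∀ H, residual U O B H = ‖u - A H‖ ^ 2 := by
    intro H
    rw [sq_norm_eq_sum, residual, ← Finset.sum_coe_sort]
    rfl
  obtain ⟨H, hH⟩ : A.range.starProjection u ∈ A.range := Submodule.starProjection_apply_mem _ _
  refine ⟨H, fun H' => ?_⟩
  rw [hres, hres, hH]
  exact pow_le_pow_left₀ (norm_nonneg _)
    (norm_sub_starProjection_le_of_mem u (LinearMap.mem_range_self A H')) 2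

theorem exists_isTopLeftSingularSpace {n r : ℕ} (hr : r ≤ n) {β : Type*} [Fintype β]
    (H : Matrix (Fin n) β ℝ) : ∃ V, IsTopLeftSingularSpace r H V := by
  have hS : (Matrix.toEuclideanLin (H * H.transpose)).IsSymmetric := by
    rw [Matrix.isSymmetric_toEuclideanLin_iff]
    have := Matrix.isHermitian_mul_conjTranspose_self H
    rwa [Matrix.conjTranspose_eq_transpose_of_trivial] at this
  have hn : Module.finrank ℝ (Vec n) = n := by simp
  refine ⟨_, hr, hS.eigenvectorBasis hn, hS.eigenvalues hn, hS.eigenvalues_antitone hn,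
    fun i => ?_, rfl⟩
  rw [hS.apply_eigenvectorBasis]; rfl

theorem exists_rowsOrthonormalBasis {n r : ℕ} {V W : Subsp n}
    (hV : Module.finrank ℝ V = r) (hW : Module.finrank ℝ W = r) :
    ∃ B : Matrix (Fin r × Fin r) (Fin n × Fin n) ℝ,
      RowsOrthonormalBasis B (tensorSpace V W) := by
  obtain ⟨b, -⟩ := exists_orthonormalBasis_tensorSpace hV hW
  refine ⟨fun a => ((b a : Vec₂ n)).ofLp, ?_, ?_⟩
  · exact b.orthonormal.comp_linearIsometry (tensorSpace V W).subtypeₗᵢ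
  · have h1 : Set.range (fun a => (b a : Vec₂ n)) = (tensorSpace V W).subtype '' Set.range b := by
      rw [← Set.range_comp]; rfl
    have h2 : Submodule.span ℝ (Set.range b) = ⊤ := by
      rw [← OrthonormalBasis.coe_toBasis, Module.Basis.span_eq]
    change Submodule.span ℝ (Set.range (fun a => (b a : Vec₂ n))) = _
    rw [h1, Submodule.span_image, h2, Submodule.map_top, Submodule.range_subtype]

theorem exists_isModeUpdate {n r : ℕ} (hr : r ≤ n) (m : Entry n ≃ Fin n × (Fin n × Fin n))
    (T : Tensor n) (S : Finset (Entry n)) {V W : Subsp n}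
    (hV : Module.finrank ℝ V = r) (hW : Module.finrank ℝ W = r) :
    ∃ V', IsModeUpdate r m T S V W V' := by
  obtain ⟨B, hB⟩ := exists_rowsOrthonormalBasis hV hW
  obtain ⟨H, hH⟩ := exists_residual_minimizer (unfolding m T) (S.map m.toEmbedding) B
  obtain ⟨V', hV'⟩ := exists_isTopLeftSingularSpace hr H
  exact ⟨V', B, H, hB, hH, hV'⟩

theorem IsModeUpdate.finrank_eq {n r : ℕ} {m : Entry n ≃ Fin n × (Fin n × Fin n)}
    {T : Tensor n} {S : Finset (Entry n)} {V W V' : Subsp n} (h : IsModeUpdate r m T S V W V') :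
    Module.finrank ℝ V' = r := by
  obtain ⟨f, -, hf⟩ := h.exists_isFit
  exact hf.finrank_eq

/-! ### Unfoldings of low rank tensors -/

/-- Row `j` of the unfolding of `∑ l, σ l • (a l ⊗ b l ⊗ d l)` along its first mode. -/
def cpRow {n r : ℕ} (σ : Fin r → ℝ) (a b d : Fin r → Vec n) (j : Fin n) : Vec₂ n :=
  ∑ l, (σ l * a l j) • tensorVec (b l) (d l)

theorem unfoldingRow_modeX {n r : ℕ} (σ : Fin r → ℝ) (x y z : Fin r → Vec n) :
    unfoldingRow (modeX n) (cpTensor σ x y z) = cpRow σ x y z := by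
  funext j; ext p
  simp only [unfoldingRow, unfolding, cpTensor, modeX, cpRow, Matrix.of_apply,
    Equiv.coe_fn_symm_mk, WithLp.ofLp_sum, WithLp.ofLp_smul, Finset.sum_apply, Pi.smul_apply,
    smul_eq_mul, tensorVec_apply]
  exact Finset.sum_congr rfl fun i _ => by ring

theorem unfoldingRow_modeY {n r : ℕ} (σ : Fin r → ℝ) (x y z : Fin r → Vec n) :
    unfoldingRow (modeY n) (cpTensor σ x y z) = cpRow σ y x z := by
  funext j; ext p
  simp only [unfoldingRow, unfolding, cpTensor, modeY, cpRow, Matrix.of_apply,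
    Equiv.coe_fn_symm_mk, WithLp.ofLp_sum, WithLp.ofLp_smul, Finset.sum_apply, Pi.smul_apply,
    smul_eq_mul, tensorVec_apply]
  exact Finset.sum_congr rfl fun i _ => by ring

theorem unfoldingRow_modeZ {n r : ℕ} (σ : Fin r → ℝ) (x y z : Fin r → Vec n) :
    unfoldingRow (modeZ n) (cpTensor σ x y z) = cpRow σ z x y := by
  funext j; ext p
  simp only [unfoldingRow, unfolding, cpTensor, modeZ, cpRow, Matrix.of_apply,
    Equiv.coe_fn_symm_mk, WithLp.ofLp_sum, WithLp.ofLp_smul, Finset.sum_apply, Pi.smul_apply,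
    smul_eq_mul, tensorVec_apply]
  exact Finset.sum_congr rfl fun i _ => by ring

/-- Quantitative assumptions on the three factor families, in the order in which a mode uses
them. -/
structure ModeFactors {n r : ℕ} (σ : Fin r → ℝ) (a b d : Fin r → Vec n)
    (c μ σ₁ σᵣ : ℝ) : Prop where
  c_pos : 0 < c
  rank_pos : 0 < r
  low_pos : 0 < σᵣ
  low_le : ∀ l, σᵣ ≤ σ l
  le_high : ∀ l, σ l ≤ σ₁
  unit_fst : ∀ l, ‖a l‖ = 1
  unit_snd : ∀ l, ‖b l‖ = 1
  unit_trd : ∀ l, ‖d l‖ = 1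
  indep_fst : RobustlyIndependent c a
  indep_snd : RobustlyIndependent c b
  indep_trd : RobustlyIndependent c d
  incoh_fst : IsIncoherent μ (factorSpan a)
  incoh_snd : IsIncoherent μ (factorSpan b)
  incoh_trd : IsIncoherent μ (factorSpan d)

theorem rowCombination_cpRow {n r : ℕ} (σ : Fin r → ℝ) (a b d : Fin r → Vec n) (v : Vec n) :
    rowCombination (cpRow σ a b d) v = ∑ l, (σ l * ⟪a l, v⟫_ℝ) • tensorVec (b l) (d l) := by
  simp only [rowCombination_apply, cpRow, Finset.smul_sum, smul_smul]
  rw [Finset.sum_comm]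
  refine Finset.sum_congr rfl fun l _ => ?_
  rw [← Finset.sum_smul, inner_eq_sum, Finset.mul_sum]
  congr 1
  exact Finset.sum_congr rfl fun j _ => by ring

theorem cpRow_mem {n r : ℕ} (σ : Fin r → ℝ) (a b d : Fin r → Vec n) (j : Fin n) :
    cpRow σ a b d j ∈ tensorSpace (factorSpan b) (factorSpan d) :=
  Submodule.sum_mem _ fun l _ => Submodule.smul_mem _ _
    (tensorVec_mem (mem_factorSpan b l) (mem_factorSpan d l))

section

variable {n r : ℕ} {σ : Fin r → ℝ} {a b d : Fin r → Vec n} {c μ σ₁ σᵣ : ℝ}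

theorem ModeFactors.high_pos (h : ModeFactors σ a b d c μ σ₁ σᵣ) : 0 < σ₁ :=
  h.low_pos.trans_le ((h.low_le ⟨0, h.rank_pos⟩).trans (h.le_high _))

theorem ModeFactors.one_le_incoh (h : ModeFactors σ a b d c μ σ₁ σᵣ) : 1 ≤ μ :=
  h.incoh_fst.one_le h.rank_pos (h.indep_fst.finrank_factorSpan h.c_pos)

theorem ModeFactors.norm_cpRow_le_sum (h : ModeFactors σ a b d c μ σ₁ σᵣ) (j : Fin n) :
    ‖cpRow σ a b d j‖ ≤ σ₁ * ∑ l, |a l j| := by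
  rw [Finset.mul_sum]
  refine (norm_sum_le _ _).trans (Finset.sum_le_sum fun l _ => ?_)
  rw [norm_smul, norm_tensorVec, h.unit_snd, h.unit_trd, Real.norm_eq_abs, abs_mul,
    abs_of_pos (h.low_pos.trans_le (h.low_le l))]
  simpa using mul_le_mul_of_nonneg_right (h.le_high l) (abs_nonneg (a l j))

theorem ModeFactors.norm_cpRow_le (h : ModeFactors σ a b d c μ σ₁ σᵣ) (j : Fin n) :
    ‖cpRow σ a b d j‖ ≤ r * σ₁ * √(μ * r / n) := by
  refine (h.norm_cpRow_le_sum j).trans ?_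
  have h1 : ∀ l, |a l j| ≤ √(μ * r / n) := by
    intro l
    have := h.incoh_fst.abs_apply_le (mem_factorSpan a l) j
    rwa [h.indep_fst.finrank_factorSpan h.c_pos, h.unit_fst, mul_one] at this
  have h2 : ∑ l, |a l j| ≤ r * √(μ * r / n) := by
    refine (Finset.sum_le_sum fun l _ => h1 l).trans (le_of_eq ?_)
    rw [Finset.sum_const, Finset.card_univ, Fintype.card_fin, nsmul_eq_mul]
  calc _ ≤ σ₁ * (r * √(μ * r / n)) := mul_le_mul_of_nonneg_left h2 h.high_pos.le
    _ = _ := by ring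

theorem ModeFactors.sum_sq_norm_cpRow_le (h : ModeFactors σ a b d c μ σ₁ σᵣ) :
    ∑ j, ‖cpRow σ a b d j‖ ^ 2 ≤ (r * σ₁) ^ 2 := by
  have h1 : ∀ j, ‖cpRow σ a b d j‖ ^ 2 ≤ σ₁ ^ 2 * (r * ∑ l, a l j ^ 2) := by
    intro j
    refine (pow_le_pow_left₀ (norm_nonneg _) (h.norm_cpRow_le_sum j) 2).trans ?_
    rw [mul_pow]
    refine mul_le_mul_of_nonneg_left ?_ (sq_nonneg _)
    have := sq_sum_le_card_mul_sum_sq (s := (Finset.univ : Finset (Fin r)))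
      (f := fun l => |a l j|)
    simpa using this
  refine (Finset.sum_le_sum fun j _ => h1 j).trans (le_of_eq ?_)
  rw [← Finset.mul_sum, ← Finset.mul_sum, Finset.sum_comm]
  simp_rw [← sq_norm_eq_sum, h.unit_fst]
  simp
  ring

/-- The row lies in the tensor product of two incoherent spans, which bounds its entries by `μ r /
n` times its norm. -/
theorem ModeFactors.abs_cpRow_apply_le (h : ModeFactors σ a b d c μ σ₁ σᵣ) (j : Fin n)
    (p : Fin n × Fin n) : |cpRow σ a b d j p| ≤ μ * r / n * (r * σ₁ * √(μ * r / n)) := by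
  have hμ : 0 ≤ μ := zero_le_one.trans h.one_le_incoh
  obtain ⟨e, he⟩ := exists_basis_tensorSpace_of_isIncoherent hμ
    (h.indep_snd.finrank_factorSpan h.c_pos) (h.indep_trd.finrank_factorSpan h.c_pos)
    h.incoh_snd h.incoh_trd
  exact (abs_apply_le_of_basis e (by positivity) (he p) (cpRow_mem σ a b d j)).trans
    (mul_le_mul_of_nonneg_left (h.norm_cpRow_le j) (by positivity))

/-- One factor `c` comes from testing `v` against the `a l`, the other from the robust independence
of the products `b l ⊗ d l`; `σᵣ` bounds the weights from below. -/
theorem ModeFactors.mul_norm_le_rowCombination (h : ModeFactors σ a b d c μ σ₁ σᵣ) {v : Vec n}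
    (hv : v ∈ factorSpan a) :
    c ^ 2 * σᵣ * ‖v‖ ≤ ‖rowCombination (cpRow σ a b d) v‖ := by
  rw [rowCombination_cpRow]
  have h1 := h.indep_snd.mul_norm_le_sum_tensorVec h.c_pos.le h.unit_trd
    (WithLp.toLp 2 fun l => σ l * ⟪a l, v⟫_ℝ)
  have h2 := h.indep_fst.mul_norm_le_norm_inner h.c_pos hv
  have h3 : σᵣ * ‖(WithLp.toLp 2 fun l => ⟪a l, v⟫_ℝ : Vec r)‖
      ≤ ‖(WithLp.toLp 2 fun l => σ l * ⟪a l, v⟫_ℝ : Vec r)‖ := by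
    refine le_of_sq_le_sq ?_ (norm_nonneg _)
    rw [mul_pow, sq_norm_eq_sum, sq_norm_eq_sum, Finset.mul_sum]
    refine Finset.sum_le_sum fun l _ => ?_
    simp only [mul_pow]
    exact mul_le_mul_of_nonneg_right (pow_le_pow_left₀ h.low_pos.le (h.low_le l) 2) (sq_nonneg _)
  refine le_trans ?_ h1
  calc c ^ 2 * σᵣ * ‖v‖ = c * (σᵣ * (c * ‖v‖)) := by ring
    _ ≤ c * (σᵣ * ‖(WithLp.toLp 2 fun l => ⟪a l, v⟫_ℝ : Vec r)‖) := by
      have := h.c_pos; have := h.low_pos; gcongr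
    _ ≤ _ := mul_le_mul_of_nonneg_left h3 h.c_pos.le

theorem rowCombination_cpRow_of_mem_orthogonal {v : Vec n} (hv : v ∈ (factorSpan a)ᗮ) :
    rowCombination (cpRow σ a b d) v = 0 := by
  rw [rowCombination_cpRow]
  refine Finset.sum_eq_zero fun l _ => ?_
  rw [hv (a l) (mem_factorSpan a l), mul_zero, zero_smul]

end

/-! ### Favourable samples -/

/-- The part of the rows `u` that `Z` does not capture. -/
def defect {n : ℕ} (Z : Submodule ℝ (Vec₂ n)) (u : Fin n → Vec₂ n) (j : Fin n) : Vec₂ n :=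
  u j - Z.starProjection (u j)

/-- A sample on which least squares fits from `Z` to the rows `u` are well conditioned and
accurate. -/
structure GoodSample {n : ℕ} (Z : Submodule ℝ (Vec₂ n)) (u : Fin n → Vec₂ n)
    (O : Finset (Fin n × (Fin n × Fin n))) (p R τ : ℝ) : Prop where
  -- `lower` makes fits unique; `upper` then bounds the error in each single row, which serves
  -- incoherence; `cross` bounds the error summed over all rows, which serves the angle.
  lower : ∀ j, ∀ w ∈ Z, p / 2 * ‖w‖ ^ 2 ≤ ∑ q ∈ rowSample O j, w q ^ 2
  upper : ∀ j, ∑ q ∈ rowSample O j, defect Z u j q ^ 2 ≤ 2 * p * R ^ 2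
  cross : ∃ g : Fin n → ℝ, (∀ j, 0 ≤ g j) ∧ ∑ j, g j ^ 2 ≤ τ ∧
    ∀ j, ∀ w ∈ Z, ∑ q ∈ rowSample O j, defect Z u j q * w q ≤ g j * ‖w‖

section

variable {n : ℕ} {Z : Submodule ℝ (Vec₂ n)} {u : Fin n → Vec₂ n}
  {O : Finset (Fin n × (Fin n × Fin n))} {p R τ : ℝ} {f : Fin n → Vec₂ n}

/-- The sampling error of a fit. -/
def fitError (Z : Submodule ℝ (Vec₂ n)) (u f : Fin n → Vec₂ n) (j : Fin n) : Vec₂ n :=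
  f j - Z.starProjection (u j)

theorem IsFit.fitError_mem (hf : IsFit Z u O f) (j : Fin n) : fitError Z u f j ∈ Z :=
  Submodule.sub_mem _ (hf.mem j) (Submodule.starProjection_apply_mem _ _)

/-- Since `u j - f j` is the defect minus the error, and the error lies in `Z`, this is the normal
equation tested against the error itself. -/
theorem IsFit.sum_sq_fitError (hf : IsFit Z u O f) (j : Fin n) :
    ∑ q ∈ rowSample O j, fitError Z u f j q ^ 2
      = ∑ q ∈ rowSample O j, defect Z u j q * fitError Z u f j q := by
  have h1 := hf.normal j _ (hf.fitError_mem j)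
  rw [← sub_eq_zero, ← neg_eq_zero, ← h1, ← Finset.sum_sub_distrib, ← Finset.sum_neg_distrib]
  refine Finset.sum_congr rfl fun q _ => ?_
  simp only [defect, fitError, WithLp.ofLp_sub, Pi.sub_apply]
  ring

/-- Cauchy-Schwarz on the sample bounds the sampled mass of the error by that of the defect, at most
`2 p R²`; `lower` converts this into a norm bound. -/
theorem IsFit.norm_fitError_le (hf : IsFit Z u O f) (hp : 0 < p) (hR : 0 ≤ R)
    (hO : GoodSample Z u O p R τ) (j : Fin n) : ‖fitError Z u f j‖ ≤ 2 * R := by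
  set e := fitError Z u f j with he
  have h1 := hf.sum_sq_fitError j
  have h2 := hO.lower j _ (hf.fitError_mem j)
  have h3 := hO.upper j
  have h4 := Finset.sum_mul_sq_le_sq_mul_sq (rowSample O j) (fun q => defect Z u j q)
    (fun q => e q)
  rw [← he] at h1 h2
  rw [← h1] at h4
  set A := ∑ q ∈ rowSample O j, e q ^ 2 with hA
  have hA0 : 0 ≤ A := Finset.sum_nonneg fun _ _ => sq_nonneg _
  have h5 : A ≤ 2 * p * R ^ 2 := by
    rcases hA0.eq_or_lt with h0 | h0
    · rw [← h0]; positivity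
    · have : A * A ≤ (2 * p * R ^ 2) * A := by
        rw [← pow_two]
        exact h4.trans (mul_le_mul_of_nonneg_right h3 hA0)
      exact le_of_mul_le_mul_right this h0
  have h6 : p / 2 * ‖e‖ ^ 2 ≤ p / 2 * (2 * R) ^ 2 := by
    refine (h2.trans h5).trans (le_of_eq (by ring))
  exact le_of_sq_le_sq (le_of_mul_le_mul_left h6 (by positivity)) (by positivity)

/-- The sharper estimate: `lower` and `cross` give `p / 2 * ‖e‖² ≤ g j * ‖e‖` for the error `e` of
row `j`, so only the sampled correlation of the defect with `Z` enters. -/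
theorem IsFit.sum_sq_norm_fitError_le (hf : IsFit Z u O f) (hp : 0 < p)
    (hO : GoodSample Z u O p R τ) : ∑ j, ‖fitError Z u f j‖ ^ 2 ≤ 4 * τ / p ^ 2 := by
  obtain ⟨g, hg0, hg, hgw⟩ := hO.cross
  have h1 : ∀ j, ‖fitError Z u f j‖ ≤ 2 * g j / p := by
    intro j
    have h2 := hO.lower j _ (hf.fitError_mem j)
    rw [hf.sum_sq_fitError j] at h2
    have h3 := h2.trans (hgw j _ (hf.fitError_mem j))
    rcases (norm_nonneg (fitError Z u f j)).eq_or_lt with h0 | h0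
    · rw [← h0]; have := hg0 j; positivity
    · rw [le_div_iff₀ hp]
      nlinarith
  calc ∑ j, ‖fitError Z u f j‖ ^ 2 ≤ ∑ j, (2 * g j / p) ^ 2 :=
        Finset.sum_le_sum fun j _ => pow_le_pow_left₀ (norm_nonneg _) (h1 j) 2
    _ = 4 / p ^ 2 * ∑ j, g j ^ 2 := by
      rw [Finset.mul_sum]
      exact Finset.sum_congr rfl fun j _ => by field_simp; ring
    _ ≤ 4 / p ^ 2 * τ := by gcongr
    _ = _ := by ring

theorem IsFit.unique {f' : Fin n → Vec₂ n} (hf : IsFit Z u O f) (hf' : IsFit Z u O f')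
    (hp : 0 < p) (hO : GoodSample Z u O p R τ) : f = f' := by
  funext j
  have hd : f j - f' j ∈ Z := Submodule.sub_mem _ (hf.mem j) (hf'.mem j)
  have h1 := hO.lower j _ hd
  have h2 : ∑ q ∈ rowSample O j, (f j - f' j) q ^ 2 = 0 := by
    have h3 := hf.normal j _ hd
    have h4 := hf'.normal j _ hd
    rw [← sub_eq_zero.mpr (h4.trans h3.symm), ← Finset.sum_sub_distrib]
    refine Finset.sum_congr rfl fun q _ => ?_
    simp only [WithLp.ofLp_sub, Pi.sub_apply]
    ring
  rw [h2] at h1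
  have h5 : ‖f j - f' j‖ = 0 := by
    have h6 : ‖f j - f' j‖ ^ 2 ≤ 0 := by
      by_contra h7
      push Not at h7
      have : 0 < p / 2 * ‖f j - f' j‖ ^ 2 := by positivity
      linarith
    have := sq_nonneg ‖f j - f' j‖
    exact pow_eq_zero_iff (two_ne_zero) |>.mp (le_antisymm h6 this)
  exact sub_eq_zero.mp (norm_eq_zero.mp h5)

theorem norm_rowCombination_le (e : Fin n → Vec₂ n) {ε : ℝ} (hε : 0 ≤ ε)
    (he : ∑ j, ‖e j‖ ^ 2 ≤ ε ^ 2) (v : Vec n) : ‖rowCombination e v‖ ≤ ε * ‖v‖ := by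
  rw [rowCombination_apply]
  refine (norm_sum_le _ _).trans (le_of_sq_le_sq ?_ (by positivity))
  simp_rw [norm_smul]
  refine (Finset.sum_mul_sq_le_sq_mul_sq _ _ _).trans ?_
  have h1 : ∑ j, ‖v j‖ ^ 2 = ‖v‖ ^ 2 := by rw [EuclideanSpace.norm_sq_eq]
  rw [h1, mul_pow, mul_comm]
  exact mul_le_mul_of_nonneg_right he (sq_nonneg _)

/-- Signal plus noise: for `u = cpRow σ a b d` the first summand vanishes on the complement of
`factorSpan a`, and the second is controlled by the fit error. -/
theorem rowCombination_eq_add (Z : Submodule ℝ (Vec₂ n)) (u f : Fin n → Vec₂ n) (v : Vec n) :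
    rowCombination f v
      = Z.starProjection (rowCombination u v) + rowCombination (fitError Z u f) v := by
  simp only [rowCombination_apply, map_sum, map_smul, ← Finset.sum_add_distrib, ← smul_add,
    fitError]
  refine Finset.sum_congr rfl fun j _ => ?_
  congr 1
  abel

end

/-! ### One update on a favourable sample -/

section

variable {n r : ℕ} {σ : Fin r → ℝ} {a b d : Fin r → Vec n} {c μ σ₁ σᵣ : ℝ}

/-- Projecting to `V ⊗ W` loses at most the fraction `2 s ≤ 0.2` of the signal. -/
theorem ModeFactors.mul_norm_le_starProjection (h : ModeFactors σ a b d c μ σ₁ σᵣ)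
    {V W : Subsp n} {s : ℝ} (hs0 : 0 ≤ s) (hs : s ≤ 0.1)
    (hV : sinAngle (factorSpan b) V ≤ s) (hW : sinAngle (factorSpan d) W ≤ s)
    {v : Vec n} (hv : v ∈ factorSpan a) :
    0.8 * (c ^ 2 * σᵣ) * ‖v‖
      ≤ ‖(tensorSpace V W).starProjection (rowCombination (cpRow σ a b d) v)‖ := by
  have h1 := h.mul_norm_le_rowCombination hv
  have h2 := norm_sub_starProjection_tensorSpace_le hs0 hV hW (fun l => σ l * ⟪a l, v⟫_ℝ)
  rw [← rowCombination_cpRow] at h2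
  set w := rowCombination (cpRow σ a b d) v
  have h3 := norm_sub_norm_le w ((tensorSpace V W).starProjection w)
  have h4 : 2 * s * ‖w‖ ≤ 0.2 * ‖w‖ := by gcongr; linarith
  calc 0.8 * (c ^ 2 * σᵣ) * ‖v‖ = 0.8 * (c ^ 2 * σᵣ * ‖v‖) := by ring
    _ ≤ 0.8 * ‖w‖ := by gcongr
    _ ≤ _ := by linarith

/-- On a favourable sample, an update of a mode improves the angle by a factor `10`, preserves
incoherence and does not depend on any choices. -/
theorem ModeFactors.update (h : ModeFactors σ a b d c μ σ₁ σᵣ)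
    {V W : Subsp n} {s p τ μ' : ℝ} (hs0 : 0 ≤ s) (hs : s ≤ 0.1) (hp : 0 < p)
    (hV : sinAngle (factorSpan b) V ≤ s) (hW : sinAngle (factorSpan d) W ≤ s)
    (hμ' : 36 * r ^ 2 * (σ₁ / σᵣ) ^ 2 * μ / c ^ 4 ≤ μ')
    (hτ : 4 * τ / p ^ 2 ≤ (s * (c ^ 2 * σᵣ) / 25) ^ 2)
    {m : Entry n ≃ Fin n × (Fin n × Fin n)} {T : Tensor n}
    (hT : unfoldingRow m T = cpRow σ a b d) {S : Finset (Entry n)}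
    (hS : GoodSample (tensorSpace V W) (cpRow σ a b d) (S.map m.toEmbedding) p
      (r * σ₁ * √(μ * r / n)) τ)
    {V' : Subsp n} (hV' : IsModeUpdate r m T S V W V') :
    sinAngle (factorSpan a) V' ≤ s / 10 ∧ IsIncoherent μ' V' ∧
      ∀ V'', IsModeUpdate r m T S V W V'' → V'' = V' := by
  obtain ⟨f, hf, hfV⟩ := hV'.exists_isFit
  rw [hT] at hf
  have hfin := hfV.finrank_eq
  set Z := tensorSpace V W
  set u := cpRow σ a b d with hu
  set R := r * σ₁ * √(μ * r / n) with hR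
  have hc := h.c_pos
  have hσ := h.low_pos
  have hσ₁ := h.high_pos
  have hμ : 0 ≤ μ := zero_le_one.trans h.one_le_incoh
  have hR0 : 0 ≤ R := by positivity
  set κ := c ^ 2 * σᵣ with hκ
  have hκ0 : 0 < κ := by positivity
  set ε := s * κ / 25 with hε
  have hε0 : 0 ≤ ε := by positivity
  have hεκ : ε ≤ 0.3 * κ := by rw [hε]; nlinarith
  have hX := h.indep_fst.finrank_factorSpan hc
  have he := norm_rowCombination_le (fitError Z u f) hε0
    ((hf.sum_sq_norm_fitError_le hp hS).trans hτ)
  have hα : ∀ v ∈ factorSpan a, 0.5 * κ * ‖v‖ ≤ ‖rowCombination f v‖ := by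
    intro v hv
    have h1 := h.mul_norm_le_starProjection hs0 hs hV hW hv
    rw [rowCombination_eq_add Z u f]
    have h2 := norm_sub_le_norm_add (Z.starProjection (rowCombination u v))
      (rowCombination (fitError Z u f) v)
    have h3 : ε * ‖v‖ ≤ 0.3 * κ * ‖v‖ := by gcongr
    have h4 := he v
    linarith
  have hβ : ∀ v ∈ (factorSpan a)ᗮ, ‖rowCombination f v‖ ≤ ε * ‖v‖ := by
    intro v hv
    rw [rowCombination_eq_add Z u f, hu, rowCombination_cpRow_of_mem_orthogonal hv, map_zero,
      zero_add]
    exact he v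
  have hgap : ε < 0.5 * κ := by linarith
  refine ⟨sinAngle_le_of_orthogonal (by positivity) fun v hv => ?_, fun j => ?_, ?_⟩
  · set g := (factorSpan a).starProjection v with hg
    have hga : g ∈ factorSpan a := Submodule.starProjection_apply_mem _ _
    have h1 := h.mul_norm_le_starProjection hs0 hs hV hW hga
    have h2 : rowCombination u g = rowCombination u v := by
      have h3 : v - g ∈ (factorSpan a)ᗮ := Submodule.sub_starProjection_mem_orthogonal v
      have h4 := rowCombination_cpRow_of_mem_orthogonal (σ := σ) (b := b) (d := d) h3
      rw [map_sub, sub_eq_zero] at h4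
      exact h4.symm
    rw [← hu, h2] at h1
    have h3 := hfV.norm_le_of_mem_orthogonal hX hε0 hβ hv
    have h4 := norm_sub_le (rowCombination f v) (rowCombination (fitError Z u f) v)
    have h5 : rowCombination f v - rowCombination (fitError Z u f) v
        = Z.starProjection (rowCombination u v) := by
      rw [rowCombination_eq_add Z u f]; abel
    rw [h5] at h4
    have h6 := he v
    -- For `v` orthogonal to `V'` the fit and the noise are each at most `ε ‖v‖`, so the signal is
    -- at most `2 ε ‖v‖ = 0.08 s κ ‖v‖`. The signal only sees the component `g` of `v`, on which it
    -- is at least `0.8 κ ‖g‖`; the divisor `25` in `ε` is chosen to produce `s / 10`.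
    have h7 : 0.8 * κ * ‖g‖ ≤ 0.8 * κ * (s / 10 * ‖v‖) := by
      have : 2 * (ε * ‖v‖) = 0.8 * κ * (s / 10 * ‖v‖) := by rw [hε]; ring
      linarith
    exact le_of_mul_le_mul_left h7 (by positivity)
  · have hn : 0 < n := j.pos
    have hr := h.rank_pos
    -- At most `2 R` from the error and `R` from the projected true row. Dividing by the lower bound
    -- `0.5 κ` of the fit and squaring yields the constant `36`.
    have h1 : ‖f j‖ ≤ 3 * R := by
      have h2 := hf.norm_fitError_le hp hR0 hS j
      have h3 := h.norm_cpRow_le j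
      have h4 : f j = fitError Z u f j + Z.starProjection (u j) := by
        simp [fitError]
      have h5 := Submodule.norm_starProjection_apply_le Z (u j)
      rw [h4]
      exact (norm_add_le _ _).trans (by linarith)
    refine (norm_starProjection_single_le (B := 3 * R / (0.5 * κ)) (fun v hv => ?_)
      (by positivity)).trans ?_
    · refine (hfV.abs_apply_le hX (by positivity) hα hv j).trans ?_
      rw [rowCombination_single]
      gcongr
    · rw [hfin]
      refine Real.le_sqrt_of_sq_le ?_
      have h6 : (3 * R / (0.5 * κ)) ^ 2 = 36 * r ^ 2 * (σ₁ / σᵣ) ^ 2 * μ / c ^ 4 * r / n := by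
        have h7 : √(μ * r / n) ^ 2 = μ * r / n := Real.sq_sqrt (by positivity)
        rw [hR, hκ, div_pow, mul_pow, mul_pow, h7]
        field_simp
        ring
      rw [h6]
      gcongr
  · intro V'' hV''
    obtain ⟨f', hf', hfV'⟩ := hV''.exists_isFit
    rw [hT] at hf'
    have h1 := hf'.unique hf hp hS
    rw [h1] at hfV'
    exact hfV'.eq_of_gap hfV hX hε0 hgap hα hβ

end

/-! ### Bernoulli weights on finite sets -/

section

variable {α : Type*} [Fintype α] [DecidableEq α]

/-- The probability that a random set containing every element independently with probability
`p` equals `S`. -/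
def bernoulliWeight (p : ℝ) (S : Finset α) : ℝ :=
  ∏ e, if e ∈ S then p else 1 - p

open Classical in
/-- The probability that such a random set satisfies `A`. -/
def bernoulliProb (p : ℝ) (A : Finset α → Prop) : ℝ :=
  ∑ S, if A S then bernoulliWeight p S else 0

theorem sum_prod_ite_mem (g h : α → ℝ) :
    ∑ S : Finset α, ∏ e, (if e ∈ S then g e else h e) = ∏ e, (g e + h e) := by
  rw [Finset.prod_add, Finset.powerset_univ]
  refine Finset.sum_congr rfl fun S _ => ?_
  rw [Finset.prod_ite]
  congr 1
  · exact Finset.prod_congr (by ext; simp) fun _ _ => rfl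
  · exact Finset.prod_congr (by ext; simp) fun _ _ => rfl

/-- Independence in the finite model: the expectation of a product of factors, one per element, is
the product of the expectations. -/
theorem sum_bernoulliWeight_mul_prod (p : ℝ) (g h : α → ℝ) :
    ∑ S : Finset α, bernoulliWeight p S * ∏ e, (if e ∈ S then g e else h e)
      = ∏ e, (p * g e + (1 - p) * h e) := by
  rw [← sum_prod_ite_mem]
  refine Finset.sum_congr rfl fun S _ => ?_
  rw [bernoulliWeight, ← Finset.prod_mul_distrib]
  exact Finset.prod_congr rfl fun e _ => by split_ifs <;> rfl

theorem sum_bernoulliWeight (p : ℝ) : ∑ S : Finset α, bernoulliWeight p S = 1 := by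
  have := sum_bernoulliWeight_mul_prod (α := α) p 1 1
  simpa using this

theorem bernoulliWeight_nonneg {p : ℝ} (h0 : 0 ≤ p) (h1 : p ≤ 1) (S : Finset α) :
    0 ≤ bernoulliWeight p S :=
  Finset.prod_nonneg fun e _ => by split_ifs <;> linarith

theorem bernoulliProb_mono {p : ℝ} (h0 : 0 ≤ p) (h1 : p ≤ 1) {A B : Finset α → Prop}
    (h : ∀ S, A S → B S) : bernoulliProb p A ≤ bernoulliProb p B := by
  refine Finset.sum_le_sum fun S _ => ?_
  have := bernoulliWeight_nonneg h0 h1 S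
  by_cases hA : A S
  · rw [if_pos hA, if_pos (h S hA)]
  · rw [if_neg hA]; split_ifs <;> linarith

theorem bernoulliProb_or_le {p : ℝ} (h0 : 0 ≤ p) (h1 : p ≤ 1) (A B : Finset α → Prop) :
    bernoulliProb p (fun S => A S ∨ B S) ≤ bernoulliProb p A + bernoulliProb p B := by
  rw [bernoulliProb, bernoulliProb, bernoulliProb, ← Finset.sum_add_distrib]
  refine Finset.sum_le_sum fun S _ => ?_
  have := bernoulliWeight_nonneg h0 h1 S
  by_cases hA : A S <;> by_cases hB : B S <;> simp [hA, hB, this]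

theorem bernoulliProb_exists_le {p : ℝ} (h0 : 0 ≤ p) (h1 : p ≤ 1) {ι : Type*} [Fintype ι]
    (A : ι → Finset α → Prop) :
    bernoulliProb p (fun S => ∃ i, A i S) ≤ ∑ i, bernoulliProb p (A i) := by
  simp only [bernoulliProb]
  rw [Finset.sum_comm]
  refine Finset.sum_le_sum fun S _ => ?_
  have hw := bernoulliWeight_nonneg h0 h1 S
  have hterm : ∀ i, 0 ≤ (open Classical in if A i S then bernoulliWeight p S else 0) := by
    intro i; split_ifs <;> linarith
  split_ifs with h
  · obtain ⟨i, hi⟩ := h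
    refine le_trans (le_of_eq ?_)
      (Finset.single_le_sum (fun i _ => hterm i) (Finset.mem_univ i))
    rw [if_pos hi]
  · exact Finset.sum_nonneg fun i _ => hterm i

theorem bernoulliProb_le_sum {p : ℝ} (h0 : 0 ≤ p) (h1 : p ≤ 1) {A : Finset α → Prop}
    {X : Finset α → ℝ} (hX : ∀ S, 0 ≤ X S) (hA : ∀ S, A S → 1 ≤ X S) :
    bernoulliProb p A ≤ ∑ S, bernoulliWeight p S * X S := by
  refine Finset.sum_le_sum fun S _ => ?_
  have hw := bernoulliWeight_nonneg h0 h1 S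
  split_ifs with h
  · exact le_mul_of_one_le_right hw (hA S h)
  · exact mul_nonneg hw (hX S)

/-- Markov's inequality. -/
theorem bernoulliProb_lt_le_div {p : ℝ} (h0 : 0 ≤ p) (h1 : p ≤ 1)
    {X : Finset α → ℝ} (hX : ∀ S, 0 ≤ X S) {t : ℝ} (ht : 0 < t) :
    bernoulliProb p (fun S => t < X S) ≤ (∑ S, bernoulliWeight p S * X S) / t := by
  refine (bernoulliProb_le_sum h0 h1 (X := fun S => X S / t)
    (fun S => div_nonneg (hX S) ht.le) (fun S hS => ?_)).trans (le_of_eq ?_)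
  · rw [one_le_div ht]; exact hS.le
  · rw [Finset.sum_div]
    exact Finset.sum_congr rfl fun S _ => by ring

/-- A Bernstein type tail bound. -/
theorem bernoulliProb_tail_le {p : ℝ} (h0 : 0 ≤ p) (h1 : p ≤ 1) (a : α → ℝ) {s : ℝ}
    (hs : 0 ≤ s) (ha : ∀ e, |s * a e| ≤ 1) (t : ℝ) :
    bernoulliProb p (fun S => t ≤ ∑ e ∈ S, a e - p * ∑ e, a e)
      ≤ Real.exp (-(s * t) + p * s ^ 2 * ∑ e, a e ^ 2) := by
  -- The moment generating function of one element: `exp x ≤ 1 + x + x²` for `|x| ≤ 1`, followed by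
  -- `1 + y ≤ exp y`.
  have hstep : ∀ e, p * Real.exp (s * a e) + (1 - p) * 1
      ≤ Real.exp (p * (s * a e) + p * (s * a e) ^ 2) := by
    intro e
    have h2 := Real.abs_exp_sub_one_sub_id_le (ha e)
    have h3 := Real.add_one_le_exp (p * (Real.exp (s * a e) - 1))
    have h4 : p * (Real.exp (s * a e) - 1) ≤ p * (s * a e) + p * (s * a e) ^ 2 := by
      rw [← mul_add]
      refine mul_le_mul_of_nonneg_left ?_ h0
      have := (abs_le.mp h2).2
      linarith
    calc _ = p * (Real.exp (s * a e) - 1) + 1 := by ring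
      _ ≤ _ := h3.trans (Real.exp_le_exp.mpr h4)
  refine (bernoulliProb_le_sum h0 h1
    (X := fun S => Real.exp (s * (∑ e ∈ S, a e - p * ∑ e, a e - t)))
    (fun S => (Real.exp_pos _).le) (fun S hS => ?_)).trans ?_
  · exact Real.one_le_exp (mul_nonneg hs (by linarith))
  · have h2 : ∀ S : Finset α, Real.exp (s * (∑ e ∈ S, a e - p * ∑ e, a e - t))
        = Real.exp (-(s * (p * ∑ e, a e)) - s * t)
          * ∏ e, (if e ∈ S then Real.exp (s * a e) else 1) := by
      intro S
      have h3 : ∏ e, (if e ∈ S then Real.exp (s * a e) else 1)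
          = Real.exp (s * ∑ e ∈ S, a e) := by
        rw [Finset.prod_ite_mem, Finset.univ_inter, ← Real.exp_sum, Finset.mul_sum]
      rw [h3, ← Real.exp_add]
      congr 1; ring
    simp_rw [h2, mul_left_comm _ (Real.exp (-(s * (p * ∑ e, a e)) - s * t))]
    rw [← Finset.mul_sum, sum_bernoulliWeight_mul_prod]
    have h4 : ∏ e, (p * Real.exp (s * a e) + (1 - p) * 1)
        ≤ Real.exp (∑ e, (p * (s * a e) + p * (s * a e) ^ 2)) := by
      rw [Real.exp_sum]
      refine Finset.prod_le_prod (fun e _ => ?_) fun e _ => hstep e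
      have := Real.exp_pos (s * a e)
      have : 0 ≤ p * Real.exp (s * a e) := by positivity
      linarith
    refine (mul_le_mul_of_nonneg_left h4 (Real.exp_pos _).le).trans (le_of_eq ?_)
    rw [← Real.exp_add]
    congr 1
    rw [Finset.sum_add_distrib, ← Finset.mul_sum, ← Finset.mul_sum]
    simp_rw [mul_pow]
    rw [← Finset.mul_sum, ← Finset.mul_sum]
    ring

/-- The centered indicator of `e`, written as a product over all elements. -/
theorem centered_eq_prod (p : ℝ) (e : α) (S : Finset α) :
    (if e ∈ S then 1 - p else -p)
      = ∏ k, (if k ∈ S then (if k = e then 1 - p else 1) else (if k = e then -p else 1)) := by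
  rw [Finset.prod_eq_single e]
  · simp
  · intro k _ hk; simp [hk]
  · intro h; exact absurd (Finset.mem_univ e) h

theorem sum_bernoulliWeight_mul_centered (p : ℝ) (e f : α) :
    ∑ S : Finset α, bernoulliWeight p S *
      ((if e ∈ S then 1 - p else -p) * (if f ∈ S then 1 - p else -p))
      = if e = f then p * (1 - p) else 0 := by
  have h1 : ∀ S : Finset α, ((if e ∈ S then 1 - p else -p) * (if f ∈ S then 1 - p else -p))
      = ∏ k, (if k ∈ S then ((if k = e then 1 - p else 1) * (if k = f then 1 - p else 1))
        else ((if k = e then -p else 1) * (if k = f then -p else 1))) := by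
    intro S
    rw [centered_eq_prod p e S, centered_eq_prod p f S, ← Finset.prod_mul_distrib]
    exact Finset.prod_congr rfl fun k _ => by split_ifs <;> rfl
  simp_rw [h1]
  rw [sum_bernoulliWeight_mul_prod]
  split_ifs with h
  · subst h
    rw [Finset.prod_eq_single e]
    · simp; ring
    · intro k _ hk; simp [hk]
    · intro h; exact absurd (Finset.mem_univ e) h
  -- For `e ≠ f` the factor at `e` is the mean `p (1 - p) + (1 - p) (-p) = 0` of a centered
  -- indicator.
  · refine Finset.prod_eq_zero (Finset.mem_univ e) ?_
    simp [h]; ring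

/-- The variance of a Bernoulli sum. -/
theorem sum_bernoulliWeight_mul_sq (p : ℝ) (a : α → ℝ) :
    ∑ S : Finset α, bernoulliWeight p S * (∑ e ∈ S, a e - p * ∑ e, a e) ^ 2
      = p * (1 - p) * ∑ e, a e ^ 2 := by
  have h1 : ∀ S : Finset α, ∑ e ∈ S, a e - p * ∑ e, a e
      = ∑ e, a e * (if e ∈ S then 1 - p else -p) := by
    intro S
    have : ∑ e ∈ S, a e = ∑ e, if e ∈ S then a e else 0 := by
      rw [Finset.sum_ite_mem, Finset.univ_inter]
    rw [this, Finset.mul_sum, ← Finset.sum_sub_distrib]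
    exact Finset.sum_congr rfl fun e _ => by split_ifs <;> ring
  calc _ = ∑ S : Finset α, ∑ e, ∑ f, a e * a f * (bernoulliWeight p S *
      ((if e ∈ S then 1 - p else -p) * (if f ∈ S then 1 - p else -p))) := by
        refine Finset.sum_congr rfl fun S _ => ?_
        rw [h1, pow_two, Finset.sum_mul_sum, Finset.mul_sum]
        refine Finset.sum_congr rfl fun e _ => ?_
        rw [Finset.mul_sum]
        exact Finset.sum_congr rfl fun f _ => by ring
    _ = ∑ e, ∑ f, a e * a f * (if e = f then p * (1 - p) else 0) := by
        rw [Finset.sum_comm]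
        refine Finset.sum_congr rfl fun e _ => ?_
        rw [Finset.sum_comm]
        refine Finset.sum_congr rfl fun f _ => ?_
        rw [← Finset.mul_sum, sum_bernoulliWeight_mul_centered]
    _ = _ := by
        rw [Finset.mul_sum]
        refine Finset.sum_congr rfl fun e _ => ?_
        simp; ring

end

/-! ### Sampled rows -/

section

variable {n : ℕ} (m : Entry n ≃ Fin n × (Fin n × Fin n))

theorem sum_rowSample_map (S : Finset (Entry n)) (j : Fin n) (g : Fin n × Fin n → ℝ) :
    ∑ q ∈ rowSample (S.map m.toEmbedding) j, g q
      = ∑ e ∈ S, if (m e).1 = j then g (m e).2 else 0 := by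
  rw [← sum_ite_row (S.map m.toEmbedding) j (fun q => g q.2), Finset.sum_map]
  rfl

theorem sum_ite_mode (j : Fin n) (g : Fin n × Fin n → ℝ) :
    ∑ e, (if (m e).1 = j then g (m e).2 else 0) = ∑ q, g q := by
  rw [Equiv.sum_comp m (fun q => if q.1 = j then g q.2 else 0), Fintype.sum_prod_type]
  rw [Finset.sum_eq_single j]
  · simp
  · intro k _ hk; simp [hk]
  · intro h; exact absurd (Finset.mem_univ j) h

theorem bernoulliProb_row_tail_le {p : ℝ} (h0 : 0 ≤ p) (h1 : p ≤ 1) (j : Fin n)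
    (g : Fin n × Fin n → ℝ) {s : ℝ} (hs : 0 ≤ s) (hg : ∀ q, |s * g q| ≤ 1) (t : ℝ) :
    bernoulliProb p (fun S : Finset (Entry n) =>
        t ≤ ∑ q ∈ rowSample (S.map m.toEmbedding) j, g q - p * ∑ q, g q)
      ≤ Real.exp (-(s * t) + p * s ^ 2 * ∑ q, g q ^ 2) := by
  have h2 := bernoulliProb_tail_le h0 h1 (fun e => if (m e).1 = j then g (m e).2 else 0) hs
    (fun e => by split_ifs; exacts [hg _, by simp]) t
  rw [sum_ite_mode m j g] at h2
  have h3 : ∑ e, (if (m e).1 = j then g (m e).2 else 0) ^ 2 = ∑ q, g q ^ 2 := by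
    rw [← sum_ite_mode m j (fun q => g q ^ 2)]
    exact Finset.sum_congr rfl fun e _ => by split_ifs <;> simp
  rw [h3] at h2
  simp_rw [sum_rowSample_map]
  exact h2

theorem sum_bernoulliWeight_row_sq_le {p : ℝ} (h0 : 0 ≤ p) (j : Fin n)
    (g : Fin n × Fin n → ℝ) :
    ∑ S : Finset (Entry n), bernoulliWeight p S *
        (∑ q ∈ rowSample (S.map m.toEmbedding) j, g q - p * ∑ q, g q) ^ 2
      ≤ p * ∑ q, g q ^ 2 := by
  have h2 := sum_bernoulliWeight_mul_sq p (fun e => if (m e).1 = j then g (m e).2 else 0)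
  rw [sum_ite_mode m j g] at h2
  have h3 : ∑ e, (if (m e).1 = j then g (m e).2 else 0) ^ 2 = ∑ q, g q ^ 2 := by
    rw [← sum_ite_mode m j (fun q => g q ^ 2)]
    exact Finset.sum_congr rfl fun e _ => by split_ifs <;> simp
  rw [h3] at h2
  simp_rw [sum_rowSample_map]
  rw [h2]
  have h4 : 0 ≤ ∑ q, g q ^ 2 := Finset.sum_nonneg fun _ _ => sq_nonneg _
  refine mul_le_mul_of_nonneg_right ?_ h4
  nlinarith

end

/-! ### Samples are favourable with high probability -/

section

variable {n r : ℕ} {Z : Submodule ℝ (Vec₂ n)} {u : Fin n → Vec₂ n}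
  (b : OrthonormalBasis (Fin r × Fin r) ℝ Z)

/-- This makes the sampled correlations of the defect with `Z` centered, so that their second moment
is a variance. -/
theorem inner_defect_eq_zero (j : Fin n) {w : Vec₂ n} (hw : w ∈ Z) :
    ∑ q, defect Z u j q * w q = 0 := by
  rw [← inner_eq_sum]
  exact Submodule.starProjection_inner_eq_zero _ w hw

theorem norm_defect_le (Z : Submodule ℝ (Vec₂ n)) (u : Fin n → Vec₂ n) (j : Fin n) :
    ‖defect Z u j‖ ≤ ‖u j‖ := by
  have h := norm_sub_starProjection_le_of_mem (u j) (Submodule.zero_mem Z)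
  rwa [sub_zero] at h

theorem sum_basis_mul_basis (a a' : Fin r × Fin r) :
    ∑ q, (b a : Vec₂ n) q * (b a' : Vec₂ n) q = if a = a' then 1 else 0 := by
  rw [← inner_eq_sum, ← Submodule.coe_inner, orthonormal_iff_ite.mp b.orthonormal]

/-- If the sampled Gram matrix of the basis is close to its expectation, then the sample
determines the vectors of `Z` robustly. -/
theorem lower_of_gram {Q : Finset (Fin n × Fin n)} {p : ℝ} (hp : 0 < p) (hr : 0 < r)
    (h : ∀ a a', |∑ q ∈ Q, (b a : Vec₂ n) q * (b a' : Vec₂ n) q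
      - p * (if a = a' then 1 else 0)| ≤ p / (2 * r ^ 2)) {w : Vec₂ n} (hw : w ∈ Z) :
    p / 2 * ‖w‖ ^ 2 ≤ ∑ q ∈ Q, w q ^ 2 := by
  set x : Fin r × Fin r → ℝ := fun a => b.repr ⟨w, hw⟩ a with hx
  have hwq : ∀ q, w q = ∑ a, x a * (b a : Vec₂ n) q := by
    intro q
    have h1 := congrArg (fun t : Z => (t : Vec₂ n) q) (b.sum_repr ⟨w, hw⟩)
    simp only [Submodule.coe_sum, Submodule.coe_smul, WithLp.ofLp_sum, WithLp.ofLp_smul,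
      Finset.sum_apply, Pi.smul_apply, smul_eq_mul] at h1
    exact h1.symm
  have hnorm : ∑ a, x a ^ 2 = ‖w‖ ^ 2 := by
    rw [hx, ← sq_norm_eq_sum, LinearIsometryEquiv.norm_map]; rfl
  have hr' : (0 : ℝ) < r := by exact_mod_cast hr
  have h1 : ∑ q ∈ Q, w q ^ 2
      = ∑ a, ∑ a', x a * x a' * ∑ q ∈ Q, (b a : Vec₂ n) q * (b a' : Vec₂ n) q := by
    simp_rw [hwq, pow_two, Finset.sum_mul_sum]
    rw [Finset.sum_comm]
    refine Finset.sum_congr rfl fun a _ => ?_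
    rw [Finset.sum_comm]
    refine Finset.sum_congr rfl fun a' _ => ?_
    rw [Finset.mul_sum]
    exact Finset.sum_congr rfl fun q _ => by ring
  have h2 : ∀ a a', x a * x a' * (p * (if a = a' then 1 else 0))
      - |x a| * |x a'| * (p / (2 * r ^ 2))
      ≤ x a * x a' * ∑ q ∈ Q, (b a : Vec₂ n) q * (b a' : Vec₂ n) q := by
    intro a a'
    have h3 := mul_le_mul_of_nonneg_left (h a a') (abs_nonneg (x a * x a'))
    rw [← abs_mul, abs_mul (x a)] at h3
    have h4 := (abs_le.mp h3).1
    linarith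
  have h3 : ∑ a, ∑ a', (x a * x a' * (p * (if a = a' then 1 else 0))
      - |x a| * |x a'| * (p / (2 * r ^ 2)))
      = p * ‖w‖ ^ 2 - (∑ a, |x a|) ^ 2 * (p / (2 * r ^ 2)) := by
    simp_rw [Finset.sum_sub_distrib]
    congr 1
    · rw [← hnorm, Finset.mul_sum]
      refine Finset.sum_congr rfl fun a _ => ?_
      simp; ring
    · simp_rw [← Finset.sum_mul]
      rw [pow_two (∑ a, |x a|), Finset.sum_mul_sum]
  have h4 : (∑ a, |x a|) ^ 2 ≤ r ^ 2 * ‖w‖ ^ 2 := by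
    have := sq_sum_le_card_mul_sum_sq (s := (Finset.univ : Finset (Fin r × Fin r)))
      (f := fun a => |x a|)
    simp only [sq_abs, hnorm, Finset.card_univ, Fintype.card_prod, Fintype.card_fin] at this
    push_cast at this
    rwa [← pow_two] at this
  -- There are `r²` coordinates, so Cauchy-Schwarz costs `r²`, exactly offset by the entrywise
  -- tolerance `p / (2 r²)`.
  have h5 : (∑ a, |x a|) ^ 2 * (p / (2 * r ^ 2)) ≤ p / 2 * ‖w‖ ^ 2 := by
    refine (mul_le_mul_of_nonneg_right h4 (by positivity)).trans (le_of_eq ?_)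
    field_simp
  rw [h1]
  refine le_trans ?_ (Finset.sum_le_sum fun a _ => Finset.sum_le_sum fun a' _ => h2 a a')
  rw [h3]
  linarith

variable (m : Entry n ≃ Fin n × (Fin n × Fin n))

/-- The sign `ς` allows the one-sided tail bound to be used for deviations in both directions. -/
theorem bernoulliProb_gram_le {p B : ℝ} (h0 : 0 ≤ p) (h1 : p ≤ 1) (hB : 0 < B) (hr : 0 < r)
    (hb : ∀ q, ∑ a, ((b a : Vec₂ n) q) ^ 2 ≤ B ^ 2) (j : Fin n) (a a' : Fin r × Fin r) {ς : ℝ}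
    (hς : |ς| = 1) :
    bernoulliProb p (fun S : Finset (Entry n) =>
      p / (2 * r ^ 2) ≤ ∑ q ∈ rowSample (S.map m.toEmbedding) j,
          (ς * ((b a : Vec₂ n) q * (b a' : Vec₂ n) q))
        - p * ∑ q, (ς * ((b a : Vec₂ n) q * (b a' : Vec₂ n) q)))
      ≤ Real.exp (-(p / (16 * r ^ 4 * B ^ 2))) := by
  have hr' : (1 : ℝ) ≤ r := by exact_mod_cast hr
  have hbq : ∀ a q, |(b a : Vec₂ n) q| ≤ B := by
    intro a q
    refine abs_le_of_sq_le_sq ((Finset.single_le_sum (f := fun a => ((b a : Vec₂ n) q) ^ 2)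
      (fun _ _ => sq_nonneg _) (Finset.mem_univ a)).trans (hb q)) hB.le
  have hg : ∀ q, |ς * ((b a : Vec₂ n) q * (b a' : Vec₂ n) q)| ≤ B ^ 2 := by
    intro q
    rw [abs_mul, hς, one_mul, abs_mul, pow_two]
    exact mul_le_mul (hbq a q) (hbq a' q) (abs_nonneg _) hB.le
  have hsum : ∑ q, (ς * ((b a : Vec₂ n) q * (b a' : Vec₂ n) q)) ^ 2 ≤ B ^ 2 := by
    calc _ ≤ ∑ q, B ^ 2 * ((b a' : Vec₂ n) q) ^ 2 := by
          refine Finset.sum_le_sum fun q _ => ?_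
          rw [mul_pow, ← sq_abs ς, hς, one_pow, one_mul, mul_pow]
          refine mul_le_mul_of_nonneg_right ?_ (sq_nonneg _)
          rw [← sq_abs]
          exact pow_le_pow_left₀ (abs_nonneg _) (hbq a q) 2
      _ = B ^ 2 := by
          rw [← Finset.mul_sum]
          have := sum_basis_mul_basis b a' a'
          simp only [← pow_two, if_true] at this
          rw [this, mul_one]
  -- The minimizer of the exponent `-s t + p s² B²` at `t = p / (2 r²)`.
  have hs : (0 : ℝ) ≤ 1 / (4 * r ^ 2 * B ^ 2) := by positivity
  refine (bernoulliProb_row_tail_le m h0 h1 j _ hs (fun q => ?_) _).trans ?_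
  · rw [abs_mul, abs_of_nonneg hs]
    calc _ ≤ 1 / (4 * r ^ 2 * B ^ 2) * B ^ 2 := by gcongr; exact hg q
      _ = 1 / (4 * r ^ 2) := by field_simp
      _ ≤ 1 := by
        rw [div_le_one (by positivity)]
        nlinarith
  · refine Real.exp_le_exp.mpr ?_
    calc _ ≤ -(1 / (4 * r ^ 2 * B ^ 2) * (p / (2 * r ^ 2)))
          + p * (1 / (4 * r ^ 2 * B ^ 2)) ^ 2 * B ^ 2 := by gcongr
      _ = _ := by field_simp; ring

/-- Entries of the defect are at most `2 B R`: the row contributes `B R` by hypothesis, and its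
projection another `B R` because it lies in the space `Z` with small basis entries. -/
theorem bernoulliProb_upper_le {p B R : ℝ} (h0 : 0 ≤ p) (h1 : p ≤ 1) (hB : 0 < B) (hR : 0 < R)
    (hb : ∀ q, ∑ a, ((b a : Vec₂ n) q) ^ 2 ≤ B ^ 2) (j : Fin n) (huj : ‖u j‖ ≤ R)
    (hu : ∀ q, |u j q| ≤ B * R) :
    bernoulliProb p (fun S : Finset (Entry n) =>
      p * R ^ 2 ≤ ∑ q ∈ rowSample (S.map m.toEmbedding) j, defect Z u j q ^ 2
        - p * ∑ q, defect Z u j q ^ 2)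
      ≤ Real.exp (-(p / (16 * B ^ 2))) := by
  have hd : ∀ q, defect Z u j q ^ 2 ≤ 4 * R ^ 2 * B ^ 2 := by
    intro q
    have h2 := abs_apply_le_of_basis b hB.le (hb q)
      (Submodule.starProjection_apply_mem Z (u j))
    have h3 := Submodule.norm_starProjection_apply_le Z (u j)
    have h4 : |defect Z u j q| ≤ 2 * (B * R) := by
      simp only [defect, WithLp.ofLp_sub, Pi.sub_apply]
      refine (abs_sub _ _).trans ?_
      have : B * ‖Z.starProjection (u j)‖ ≤ B * R := by gcongr; exact h3.trans huj
      linarith [hu q]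
    rw [← sq_abs]
    refine (pow_le_pow_left₀ (abs_nonneg _) h4 2).trans (le_of_eq (by ring))
  have hnorm : ∑ q, defect Z u j q ^ 2 ≤ R ^ 2 := by
    rw [← sq_norm_eq_sum]
    exact pow_le_pow_left₀ (norm_nonneg _) ((norm_defect_le Z u j).trans huj) 2
  have hsum : ∑ q, (defect Z u j q ^ 2) ^ 2 ≤ 4 * R ^ 2 * B ^ 2 * R ^ 2 := by
    calc _ ≤ ∑ q, 4 * R ^ 2 * B ^ 2 * defect Z u j q ^ 2 := by
          refine Finset.sum_le_sum fun q _ => ?_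
          rw [pow_two (defect Z u j q ^ 2)]
          exact mul_le_mul_of_nonneg_right (hd q) (sq_nonneg _)
      _ ≤ _ := by rw [← Finset.mul_sum]; gcongr
  -- The minimizer of `-s t + p s² (4 R⁴ B²)` at `t = p R²`.
  have hs : (0 : ℝ) ≤ 1 / (8 * R ^ 2 * B ^ 2) := by positivity
  refine (bernoulliProb_row_tail_le m h0 h1 j _ hs (fun q => ?_) _).trans ?_
  · rw [abs_of_nonneg (by positivity)]
    calc _ ≤ 1 / (8 * R ^ 2 * B ^ 2) * (4 * R ^ 2 * B ^ 2) := by gcongr; exact hd q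
      _ = 1 / 2 := by field_simp; norm_num
      _ ≤ 1 := by norm_num
  · refine Real.exp_le_exp.mpr ?_
    calc _ ≤ -(1 / (8 * R ^ 2 * B ^ 2) * (p * R ^ 2))
          + p * (1 / (8 * R ^ 2 * B ^ 2)) ^ 2 * (4 * R ^ 2 * B ^ 2 * R ^ 2) := by gcongr
      _ = _ := by field_simp; ring

/-- The expected size of the sampled correlations between the defects and the basis. -/
theorem sum_bernoulliWeight_cross_le {p B D : ℝ} (h0 : 0 ≤ p)
    (hb : ∀ q, ∑ a, ((b a : Vec₂ n) q) ^ 2 ≤ B ^ 2) (hD : ∑ j, ‖defect Z u j‖ ^ 2 ≤ D) :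
    ∑ S : Finset (Entry n), bernoulliWeight p S * ∑ j, ∑ a,
        (∑ q ∈ rowSample (S.map m.toEmbedding) j, defect Z u j q * (b a : Vec₂ n) q) ^ 2
      ≤ p * B ^ 2 * D := by
  have h2 : ∀ j a, ∑ S : Finset (Entry n), bernoulliWeight p S *
        (∑ q ∈ rowSample (S.map m.toEmbedding) j, defect Z u j q * (b a : Vec₂ n) q) ^ 2
      ≤ p * ∑ q, (defect Z u j q * (b a : Vec₂ n) q) ^ 2 := by
    intro j a
    have h3 := sum_bernoulliWeight_row_sq_le m h0 j
      (fun q => defect Z u j q * (b a : Vec₂ n) q)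
    simp only [inner_defect_eq_zero j (b a).2, mul_zero, sub_zero] at h3
    exact h3
  simp_rw [Finset.mul_sum]
  rw [Finset.sum_comm]
  simp_rw [Finset.sum_comm (s := (Finset.univ : Finset (Finset (Entry n))))]
  calc _ ≤ ∑ j, ∑ a, p * ∑ q, (defect Z u j q * (b a : Vec₂ n) q) ^ 2 :=
        Finset.sum_le_sum fun j _ => Finset.sum_le_sum fun a _ => h2 j a
    _ ≤ ∑ j, p * B ^ 2 * ‖defect Z u j‖ ^ 2 := by
        refine Finset.sum_le_sum fun j _ => ?_
        rw [← Finset.mul_sum, mul_assoc, Finset.sum_comm, sq_norm_eq_sum]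
        refine mul_le_mul_of_nonneg_left ?_ h0
        rw [Finset.mul_sum]
        refine Finset.sum_le_sum fun q _ => ?_
        simp_rw [mul_pow]
        rw [← Finset.mul_sum, mul_comm]
        exact mul_le_mul_of_nonneg_right (hb q) (sq_nonneg _)
    _ ≤ _ := by
        rw [← Finset.mul_sum]
        exact mul_le_mul_of_nonneg_left hD (by positivity)

/-- A Bernoulli sample is favourable with high probability. -/
theorem bernoulliProb_not_goodSample_le {p B R D τ : ℝ} (h0 : 0 < p) (h1 : p ≤ 1) (hB : 0 < B)
    (hR : 0 < R) (hτ : 0 < τ) (hr : 0 < r)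
    (hb : ∀ q, ∑ a, ((b a : Vec₂ n) q) ^ 2 ≤ B ^ 2) (huR : ∀ j, ‖u j‖ ≤ R)
    (hu : ∀ j q, |u j q| ≤ B * R) (hD : ∑ j, ‖defect Z u j‖ ^ 2 ≤ D) :
    bernoulliProb p (fun S : Finset (Entry n) => ¬ GoodSample Z u (S.map m.toEmbedding) p R τ)
      ≤ 3 * n * r ^ 4 * Real.exp (-(p / (16 * r ^ 4 * B ^ 2))) + p * B ^ 2 * D / τ := by
  have hr' : (1 : ℝ) ≤ r := by exact_mod_cast hr
  let gram : ℝ → Fin n × (Fin r × Fin r) × (Fin r × Fin r) → Finset (Entry n) → Prop :=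
    fun ς i S => p / (2 * r ^ 2) ≤ ∑ q ∈ rowSample (S.map m.toEmbedding) i.1,
          (ς * ((b i.2.1 : Vec₂ n) q * (b i.2.2 : Vec₂ n) q))
        - p * ∑ q, (ς * ((b i.2.1 : Vec₂ n) q * (b i.2.2 : Vec₂ n) q))
  let upper : Fin n → Finset (Entry n) → Prop := fun j S =>
    p * R ^ 2 ≤ ∑ q ∈ rowSample (S.map m.toEmbedding) j, defect Z u j q ^ 2
        - p * ∑ q, defect Z u j q ^ 2
  let X : Finset (Entry n) → ℝ := fun S => ∑ j, ∑ a,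
        (∑ q ∈ rowSample (S.map m.toEmbedding) j, defect Z u j q * (b a : Vec₂ n) q) ^ 2
  -- Outside these failure events the witness for `cross` in row `j` is the Euclidean norm of the
  -- vector of sampled correlations with the basis, by Cauchy-Schwarz; `X` is the sum of its squares
  -- over the rows.
  have hbad : ∀ S, ¬ GoodSample Z u (S.map m.toEmbedding) p R τ →
      (((∃ i, gram 1 i S) ∨ (∃ i, gram (-1) i S)) ∨ (∃ j, upper j S)) ∨ τ < X S := by
    intro S hS
    by_contra hcon
    push Not at hcon
    obtain ⟨⟨⟨hg1, hg2⟩, hup⟩, hX⟩ := hcon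
    refine hS ⟨fun j w hw => lower_of_gram b h0 hr (fun a a' => ?_) hw, fun j => ?_,
      fun j => √(∑ a, (∑ q ∈ rowSample (S.map m.toEmbedding) j,
        defect Z u j q * (b a : Vec₂ n) q) ^ 2), fun j => Real.sqrt_nonneg _, ?_, fun j w hw => ?_⟩
    · have h2 := hg1 (j, a, a')
      have h3 := hg2 (j, a, a')
      simp only [gram, not_le, one_mul, neg_one_mul, Finset.sum_neg_distrib,
        sum_basis_mul_basis] at h2 h3
      rw [abs_le]
      constructor <;> linarith
    · have h2 := hup j
      simp only [upper, not_le] at h2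
      have h3 : ∑ q, defect Z u j q ^ 2 ≤ R ^ 2 := by
        rw [← sq_norm_eq_sum]
        exact pow_le_pow_left₀ (norm_nonneg _) ((norm_defect_le Z u j).trans (huR j)) 2
      have h4 := mul_le_mul_of_nonneg_left h3 h0.le
      linarith
    · simp_rw [Real.sq_sqrt (Finset.sum_nonneg fun _ _ => sq_nonneg _)]
      exact hX
    · set x : Fin r × Fin r → ℝ := fun a => b.repr ⟨w, hw⟩ a with hx
      have hwq : ∀ q, w q = ∑ a, x a * (b a : Vec₂ n) q := by
        intro q
        have h1 := congrArg (fun t : Z => (t : Vec₂ n) q) (b.sum_repr ⟨w, hw⟩)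
        simp only [Submodule.coe_sum, Submodule.coe_smul, WithLp.ofLp_sum, WithLp.ofLp_smul,
          Finset.sum_apply, Pi.smul_apply, smul_eq_mul] at h1
        exact h1.symm
      have hnorm : ∑ a, x a ^ 2 = ‖w‖ ^ 2 := by
        rw [hx, ← sq_norm_eq_sum, LinearIsometryEquiv.norm_map]; rfl
      have h2 : ∑ q ∈ rowSample (S.map m.toEmbedding) j, defect Z u j q * w q
          = ∑ a, (∑ q ∈ rowSample (S.map m.toEmbedding) j,
            defect Z u j q * (b a : Vec₂ n) q) * x a := by
        simp_rw [hwq, Finset.mul_sum, Finset.sum_mul]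
        rw [Finset.sum_comm]
        exact Finset.sum_congr rfl fun a _ => Finset.sum_congr rfl fun q _ => by ring
      rw [h2]
      refine le_of_sq_le_sq ?_ (by positivity)
      rw [mul_pow, Real.sq_sqrt (Finset.sum_nonneg fun _ _ => sq_nonneg _), ← hnorm]
      exact Finset.sum_mul_sq_le_sq_mul_sq _ _ _
  have hgram : ∀ ς : ℝ, |ς| = 1 → bernoulliProb p (fun S => ∃ i, gram ς i S)
      ≤ n * r ^ 4 * Real.exp (-(p / (16 * r ^ 4 * B ^ 2))) := by
    intro ς hς
    refine (bernoulliProb_exists_le h0.le h1 _).trans ((Finset.sum_le_sum fun i _ =>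
      bernoulliProb_gram_le b m h0.le h1 hB hr hb i.1 i.2.1 i.2.2 hς).trans (le_of_eq ?_))
    rw [Finset.sum_const, Finset.card_univ, nsmul_eq_mul]
    simp only [Fintype.card_prod, Fintype.card_fin]
    push_cast
    ring
  have hupper : bernoulliProb p (fun S => ∃ j, upper j S)
      ≤ n * r ^ 4 * Real.exp (-(p / (16 * r ^ 4 * B ^ 2))) := by
    refine (bernoulliProb_exists_le h0.le h1 _).trans ((Finset.sum_le_sum fun j _ =>
      bernoulliProb_upper_le b m h0.le h1 hB hR hb j (huR j) (hu j)).trans ?_)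
    rw [Finset.sum_const, Finset.card_univ, nsmul_eq_mul, Fintype.card_fin, mul_assoc]
    refine mul_le_mul_of_nonneg_left ?_ (Nat.cast_nonneg n)
    have hr4 : (1 : ℝ) ≤ (r : ℝ) ^ 4 := one_le_pow₀ hr'
    have h2 : p / (16 * r ^ 4 * B ^ 2) ≤ p / (16 * B ^ 2) := by
      refine div_le_div_of_nonneg_left h0.le (by positivity) ?_
      have : 0 < 16 * B ^ 2 := by positivity
      nlinarith
    calc _ ≤ Real.exp (-(p / (16 * r ^ 4 * B ^ 2))) := Real.exp_le_exp.mpr (by linarith)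
      _ ≤ _ := le_mul_of_one_le_left (Real.exp_pos _).le hr4
  have hX : bernoulliProb p (fun S => τ < X S) ≤ p * B ^ 2 * D / τ := by
    refine (bernoulliProb_lt_le_div h0.le h1 (fun S => Finset.sum_nonneg fun _ _ =>
      Finset.sum_nonneg fun _ _ => sq_nonneg _) hτ).trans ?_
    exact div_le_div_of_nonneg_right (sum_bernoulliWeight_cross_le b m h0.le hb hD) hτ.le
  have h2 := bernoulliProb_mono h0.le h1 hbad
  have h3 := bernoulliProb_or_le h0.le h1
    (fun S => ((∃ i, gram 1 i S) ∨ (∃ i, gram (-1) i S)) ∨ (∃ j, upper j S)) (fun S => τ < X S)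
  have h4 := bernoulliProb_or_le h0.le h1
    (fun S => (∃ i, gram 1 i S) ∨ (∃ i, gram (-1) i S)) (fun S => ∃ j, upper j S)
  have h5 := bernoulliProb_or_le h0.le h1 (fun S => ∃ i, gram 1 i S) (fun S => ∃ i, gram (-1) i S)
  have h6 := hgram 1 (by simp)
  have h7 := hgram (-1) (by simp)
  linarith

end

/-! ### Independent rounds -/

section

variable {α : Type*} [Fintype α] [DecidableEq α]

/-- The probability of a sequence of independent samples. -/
def roundsWeight (p : ℝ) {k : ℕ} (s : Fin k → Finset α) : ℝ :=
  ∏ t, bernoulliWeight p (s t)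

open Classical in
/-- The probability that a sequence of independent samples satisfies `A`. -/
def roundsProb (p : ℝ) {k : ℕ} (A : (Fin k → Finset α) → Prop) : ℝ :=
  ∑ s, if A s then roundsWeight p s else 0

theorem roundsWeight_nonneg {p : ℝ} (h0 : 0 ≤ p) (h1 : p ≤ 1) {k : ℕ} (s : Fin k → Finset α) :
    0 ≤ roundsWeight p s :=
  Finset.prod_nonneg fun t _ => bernoulliWeight_nonneg h0 h1 (s t)

theorem sum_fin_succ {β : Type*} [Fintype β] {k : ℕ} (F : (Fin (k + 1) → β) → ℝ) :
    ∑ s, F s = ∑ S, ∑ s : Fin k → β, F (Fin.cons S s) := by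
  rw [← Equiv.sum_comp (Fin.consEquiv fun _ : Fin (k + 1) => β) F, Fintype.sum_prod_type]
  rfl

theorem roundsWeight_cons (p : ℝ) {k : ℕ} (S : Finset α) (s : Fin k → Finset α) :
    roundsWeight p (Fin.cons S s : Fin (k + 1) → Finset α)
      = bernoulliWeight p S * roundsWeight p s := by
  simp [roundsWeight, Fin.prod_univ_succ]

theorem sum_roundsWeight (p : ℝ) (k : ℕ) :
    ∑ s : Fin k → Finset α, roundsWeight p s = 1 := by
  induction k with
  | zero => simp [roundsWeight]
  | succ k ih =>
    rw [sum_fin_succ]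
    simp_rw [roundsWeight_cons, ← Finset.mul_sum, ih, mul_one]
    exact sum_bernoulliWeight p

theorem roundsProb_le_one {p : ℝ} (h0 : 0 ≤ p) (h1 : p ≤ 1) {k : ℕ}
    (A : (Fin k → Finset α) → Prop) : roundsProb p A ≤ 1 := by
  rw [← sum_roundsWeight (α := α) p k]
  refine Finset.sum_le_sum fun s _ => ?_
  split_ifs
  · exact le_rfl
  · exact roundsWeight_nonneg h0 h1 s

theorem roundsProb_mono {p : ℝ} (h0 : 0 ≤ p) (h1 : p ≤ 1) {k : ℕ}
    {A B : (Fin k → Finset α) → Prop} (h : ∀ s, A s → B s) :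
    roundsProb p A ≤ roundsProb p B := by
  refine Finset.sum_le_sum fun s _ => ?_
  have := roundsWeight_nonneg h0 h1 s
  by_cases hA : A s
  · rw [if_pos hA, if_pos (h s hA)]
  · rw [if_neg hA]; split_ifs <;> linarith

theorem roundsProb_not (p : ℝ) {k : ℕ} (A : (Fin k → Finset α) → Prop) :
    roundsProb p A = 1 - roundsProb p (fun s => ¬ A s) := by
  rw [← sum_roundsWeight (α := α) p k, roundsProb, roundsProb, ← Finset.sum_sub_distrib]
  refine Finset.sum_congr rfl fun s _ => ?_
  by_cases h : A s <;> simp [h]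

theorem roundsProb_succ (p : ℝ) {k : ℕ} (A : (Fin (k + 1) → Finset α) → Prop) :
    roundsProb p A
      = ∑ S, bernoulliWeight p S * roundsProb p (fun s : Fin k → Finset α => A (Fin.cons S s)) := by
  simp only [roundsProb]
  rw [sum_fin_succ]
  refine Finset.sum_congr rfl fun S _ => ?_
  rw [Finset.mul_sum]
  refine Finset.sum_congr rfl fun s _ => ?_
  rw [roundsWeight_cons]
  split_ifs <;> simp

/-- `V` starts in `v` and takes one step for every sample. -/
structure IsPath {X : Type*} (step : X → Finset α → X → Prop) (v : X) {k : ℕ}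
    (s : Fin k → Finset α) (V : Fin (k + 1) → X) : Prop where
  init : V 0 = v
  step : ∀ t : Fin k, step (V t.castSucc) (s t) (V t.succ)

/-- The sample `S` makes the step from `v` unique and moves it to a state with property `G`. -/
def IsSafeStep {X : Type*} (step : X → Finset α → X → Prop) (G : X → Prop) (v : X)
    (S : Finset α) : Prop :=
  ∃ v', G v' ∧ ∀ v'', step v S v'' → v'' = v'

/-- If in every round a step from a good state is, up to probability `ε`, uniquely determined and
leads to a good state, then up to probability `k ε` all paths of length `k` end in a good state.
Uniqueness makes the state before each round independent of the sample of that round. -/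
theorem roundsProb_exists_bad_path_le {X : Type*} {step : X → Finset α → X → Prop}
    {G : ℕ → X → Prop} {p ε : ℝ} (h0 : 0 ≤ p) (h1 : p ≤ 1) (hε : 0 ≤ ε)
    (h : ∀ i v, G i v → bernoulliProb p (fun S => ¬ IsSafeStep step (G (i + 1)) v S) ≤ ε) (k : ℕ) :
    ∀ i v, G i v → roundsProb p (fun s : Fin k → Finset α =>
      ∃ V, IsPath step v s V ∧ ¬ G (i + k) (V (Fin.last k))) ≤ k * ε := by
  induction k with
  | zero =>
    intro i v hv
    refine le_of_eq ?_
    rw [Nat.cast_zero, zero_mul]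
    refine Finset.sum_eq_zero fun s _ => if_neg ?_
    rintro ⟨V, hV, hG⟩
    refine hG ?_
    have : V (Fin.last 0) = v := hV.init
    rw [this]; exact hv
  | succ k ih =>
    intro i v hv
    classical
    rw [roundsProb_succ]
    have hS : ∀ S : Finset α, bernoulliWeight p S * roundsProb p (fun s : Fin k → Finset α =>
          ∃ V, IsPath step v (Fin.cons S s : Fin (k + 1) → Finset α) V ∧
            ¬ G (i + (k + 1)) (V (Fin.last (k + 1))))
        -- An unsafe first sample pays its full weight. After a safe one every path continues from
        -- the same good state, so the induction hypothesis applies to the remaining samples.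
        ≤ (if ¬ IsSafeStep step (G (i + 1)) v S then bernoulliWeight p S else 0)
          + bernoulliWeight p S * (k * ε) := by
      intro S
      have hw := bernoulliWeight_nonneg h0 h1 S
      by_cases hsafe : IsSafeStep step (G (i + 1)) v S
      · rw [if_neg (not_not.mpr hsafe), zero_add]
        refine mul_le_mul_of_nonneg_left ?_ hw
        obtain ⟨v', hG', huniq⟩ := hsafe
        refine (roundsProb_mono h0 h1 ?_).trans (ih (i + 1) v' hG')
        rintro s ⟨V, hV, hbad⟩
        refine ⟨fun t => V t.succ, ⟨?_, fun t => ?_⟩, ?_⟩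
        · have h2 := hV.step 0
          rw [Fin.castSucc_zero, hV.init, Fin.cons_zero] at h2
          exact huniq _ h2
        · have h2 := hV.step t.succ
          rw [Fin.cons_succ] at h2
          rw [Fin.succ_castSucc]
          exact h2
        · rw [add_right_comm, add_assoc]
          exact hbad
      · rw [if_pos hsafe]
        have h2 : bernoulliWeight p S * roundsProb p (fun s : Fin k → Finset α =>
          ∃ V, IsPath step v (Fin.cons S s : Fin (k + 1) → Finset α) V ∧
            ¬ G (i + (k + 1)) (V (Fin.last (k + 1)))) ≤ bernoulliWeight p S * 1 :=
          mul_le_mul_of_nonneg_left (roundsProb_le_one h0 h1 _) hw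
        have h3 : 0 ≤ bernoulliWeight p S * (k * ε) := by positivity
        linarith
    refine (Finset.sum_le_sum fun S _ => hS S).trans ?_
    rw [Finset.sum_add_distrib, ← Finset.sum_mul, sum_bernoulliWeight, one_mul]
    have h2 := h i v hv
    rw [bernoulliProb] at h2
    have h3 : ∑ S, (if ¬ IsSafeStep step (G (i + 1)) v S then bernoulliWeight p S else 0) ≤ ε := by
      convert h2
    push_cast
    linarith

end

/-- Paths exist if every step can be taken from every admissible state. -/
theorem exists_isPath {α X : Type*} {step : X → Finset α → X → Prop} {Q : X → Prop}
    (h : ∀ v S, Q v → ∃ v', step v S v' ∧ Q v') (k : ℕ) :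
    ∀ v (s : Fin k → Finset α), Q v → ∃ V, IsPath step v s V := by
  induction k with
  | zero => exact fun v s _ => ⟨fun _ => v, rfl, fun t => t.elim0⟩
  | succ k ih =>
    intro v s hv
    obtain ⟨v', hstep, hQ⟩ := h v (s 0) hv
    obtain ⟨V, hV⟩ := ih v' (fun t => s t.succ) hQ
    refine ⟨Fin.cons v V, Fin.cons_zero _ _, fun t => ?_⟩
    refine Fin.cases ?_ (fun t => ?_) t
    · rw [Fin.castSucc_zero, Fin.cons_zero, Fin.cons_succ, hV.init]
      exact hstep
    · rw [← Fin.succ_castSucc, Fin.cons_succ, Fin.cons_succ]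
      exact hV.step t

/-! ### Samples on a probability space -/

/-- An intersection over all pairs of round and element, the form in which joint independence over
these pairs applies. -/
theorem setOf_samples_eq {Ω α : Type*} [DecidableEq α] {k : ℕ} (S' : Fin k → Ω → Finset α)
    (s : Fin k → Finset α) :
    {ω | (fun t => S' t ω) = s}
      = ⋂ q : Fin k × α, if q.2 ∈ s q.1 then {ω | q.2 ∈ S' q.1 ω} else {ω | q.2 ∈ S' q.1 ω}ᶜ := by
  ext ω
  simp only [Set.mem_ofPred_eq, Set.mem_iInter, funext_iff, Finset.ext_iff, Prod.forall]
  refine forall_congr' fun t => forall_congr' fun e => ?_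
  by_cases h : e ∈ s t <;> simp [h]

section

variable {Ω : Type*} [MeasurableSpace Ω] {P : Measure Ω}
  {α : Type*} [Fintype α] [DecidableEq α] {k : ℕ} {p : ℝ} {S : Ω → Finset α}
  {S' : Fin k → Ω → Finset α}

theorem IsSampleSplitting.measurableSet_eq (h : IsSampleSplitting P p S S')
    (s : Fin k → Finset α) : MeasurableSet {ω | (fun t => S' t ω) = s} := by
  rw [setOf_samples_eq]
  refine MeasurableSet.iInter fun q => ?_
  split_ifs
  · exact h.measurable _ _
  · exact (h.measurable _ _).compl

variable [IsProbabilityMeasure P]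

theorem IsSampleSplitting.prob_eq (h : IsSampleSplitting P p S S') (s : Fin k → Finset α) :
    P.real {ω | (fun t => S' t ω) = s} = roundsWeight p s := by
  rw [setOf_samples_eq, measureReal_def]
  have h1 := h.indep
  rw [iIndepSet_iff_iIndep] at h1
  rw [h1.meas_iInter, ENNReal.toReal_prod, Fintype.prod_prod_type, roundsWeight]
  · refine Finset.prod_congr rfl fun t _ => ?_
    rw [bernoulliWeight]
    refine Finset.prod_congr rfl fun e _ => ?_
    rw [← measureReal_def]
    split_ifs
    · exact h.prob t e
    · rw [probReal_compl_eq_one_sub (h.measurable t e), h.prob t e]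
  · intro q
    have h2 : MeasurableSet[MeasurableSpace.generateFrom {{ω | q.2 ∈ S' q.1 ω}}]
        {ω | q.2 ∈ S' q.1 ω} := MeasurableSpace.measurableSet_generateFrom rfl
    split_ifs
    · exact h2
    · exact h2.compl

/-- Only finitely many sequences of samples exist, so an arbitrary property of them is a finite
disjoint union of measurable events; this reduces the theorem to the finite model. -/
theorem IsSampleSplitting.prob_setOf (h : IsSampleSplitting P p S S')
    (A : (Fin k → Finset α) → Prop) :
    P.real {ω | A fun t => S' t ω} = roundsProb p A := by
  classical
  have h1 : {ω | A fun t => S' t ω}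
      = ⋃ s ∈ Finset.univ.filter A, {ω | (fun t => S' t ω) = s} := by
    ext ω; simp
  rw [h1, measureReal_biUnion_finset]
  · rw [Finset.sum_filter, roundsProb]
    refine Finset.sum_congr rfl fun s _ => ?_
    split_ifs
    · exact h.prob_eq s
    · rfl
  · intro s _ s' _ hne
    refine Set.disjoint_left.mpr fun ω h2 h3 => hne ?_
    exact h2.symm.trans h3
  · exact fun s _ => h.measurableSet_eq s

end

/-! ### One iteration -/

/-- `V` is an incoherent `r`-dimensional estimate of `U` with error at most `s`. -/
structure IsGoodEstimate {n : ℕ} (r : ℕ) (μ s : ℝ) (U V : Subsp n) : Prop where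
  finrank_eq : Module.finrank ℝ V = r
  incoherent : IsIncoherent μ V
  angle : sinAngle U V ≤ s

/-- The failure probability of one update of one mode. -/
def modeFailure (n r : ℕ) (c μ' K p : ℝ) : ℝ :=
  3 * n * r ^ 4 * Real.exp (-(p * n ^ 2 / (16 * r ^ 6 * μ' ^ 2)))
    + 10 ^ 4 * μ' ^ 2 * r ^ 4 * K ^ 2 / (n ^ 2 * p * c ^ 4)

/-- Combines the probability bound for favourable samples with the deterministic analysis of the
update on them. -/
theorem ModeFactors.bernoulliProb_not_safe_le {n r : ℕ} {σ : Fin r → ℝ} {a b d : Fin r → Vec n}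
    {c μ σ₁ σᵣ : ℝ} (h : ModeFactors σ a b d c μ σ₁ σᵣ) {μ' s p : ℝ} (hn : 0 < n)
    (h0 : 0 < p) (h1 : p ≤ 1) (hs0 : 0 < s) (hs : s ≤ 0.1)
    (hμμ' : μ ≤ μ') (hμ' : 36 * r ^ 2 * (σ₁ / σᵣ) ^ 2 * μ / c ^ 4 ≤ μ') {V W : Subsp n}
    (hV : IsGoodEstimate r μ' s (factorSpan b) V) (hW : IsGoodEstimate r μ' s (factorSpan d) W)
    {m : Entry n ≃ Fin n × (Fin n × Fin n)} {T : Tensor n}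
    (hT : unfoldingRow m T = cpRow σ a b d) :
    bernoulliProb p (fun S => ¬ ∃ V', IsGoodEstimate r μ' (s / 10) (factorSpan a) V' ∧
        ∀ V'', IsModeUpdate r m T S V W V'' → V'' = V')
      ≤ modeFailure n r c μ' (σ₁ / σᵣ) p := by
  have hμ : 1 ≤ μ := h.one_le_incoh
  have hμ'0 : 0 < μ' := by linarith
  have hn' : (0 : ℝ) < n := by exact_mod_cast hn
  have hr' : (0 : ℝ) < r := by exact_mod_cast h.rank_pos
  have hc := h.c_pos
  have hσr := h.low_pos
  have hσ := h.high_pos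
  have hX := h.indep_fst.finrank_factorSpan hc
  have hrn : r ≤ n := by
    have := Submodule.finrank_le (factorSpan a)
    rw [hX] at this
    simpa using this
  obtain ⟨e, he⟩ := exists_basis_tensorSpace_of_isIncoherent hμ'0.le hV.finrank_eq hW.finrank_eq
    hV.incoherent hW.incoherent
  set R := r * σ₁ * √(μ * r / n) with hR
  set B := μ' * r / n with hB
  set D := (2 * s) ^ 2 * (r * σ₁) ^ 2 with hD
  -- The largest value that `ModeFactors.update` tolerates. Like `D` it is proportional to `s²`, so
  -- `s` cancels in `p B² D / τ`, leaving the constant `4 · 4 · 25² = 10⁴`.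
  set τ := p ^ 2 * (s * (c ^ 2 * σᵣ) / 25) ^ 2 / 4 with hτ
  have hB0 : 0 < B := by positivity
  have hR0 : 0 < R := by positivity
  have hτ0 : 0 < τ := by positivity
  have hdef : ∑ j, ‖defect (tensorSpace V W) (cpRow σ a b d) j‖ ^ 2 ≤ D := by
    calc _ ≤ ∑ j, (2 * s) ^ 2 * ‖cpRow σ a b d j‖ ^ 2 := by
          refine Finset.sum_le_sum fun j _ => ?_
          rw [← mul_pow]
          exact pow_le_pow_left₀ (norm_nonneg _)
            (norm_sub_starProjection_tensorSpace_le hs0.le hV.angle hW.angle _) 2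
      _ ≤ _ := by
          rw [← Finset.mul_sum]
          exact mul_le_mul_of_nonneg_left h.sum_sq_norm_cpRow_le (sq_nonneg _)
  have hentry : ∀ j q, |cpRow σ a b d j q| ≤ B * R := by
    intro j q
    refine (h.abs_cpRow_apply_le j q).trans ?_
    rw [hB]
    gcongr
  have hprob := bernoulliProb_not_goodSample_le e m h0 h1 hB0 hR0 hτ0 h.rank_pos he
    h.norm_cpRow_le hentry hdef
  have hτ' : 4 * τ / p ^ 2 ≤ (s * (c ^ 2 * σᵣ) / 25) ^ 2 := by
    refine le_of_eq ?_
    rw [hτ]; field_simp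
  refine le_trans (bernoulliProb_mono h0.le h1 ?_) (hprob.trans (le_of_eq ?_))
  · intro S hS hgood
    obtain ⟨V', hV'⟩ := exists_isModeUpdate hrn m T S hV.finrank_eq hW.finrank_eq
    obtain ⟨hang, hinc, huniq⟩ := h.update hs0.le hs h0 hV.angle hW.angle hμ' hτ' hT hgood hV'
    exact hS ⟨V', ⟨hV'.finrank_eq, hinc, hang⟩, huniq⟩
  · rw [modeFailure, hB, hD, hτ]
    congr 1
    · congr 3
      field_simp
    · field_simp
      norm_num

/-- All three estimates are good. -/
structure AreGoodEstimates {n r : ℕ} (x y z : Fin r → Vec n) (μ' s : ℝ) (v : Estimates n) :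
    Prop where
  good_x : IsGoodEstimate r μ' s (factorSpan x) v.x
  good_y : IsGoodEstimate r μ' s (factorSpan y) v.y
  good_z : IsGoodEstimate r μ' s (factorSpan z) v.z

section

variable {n r : ℕ} {σ : Fin r → ℝ} {x y z : Fin r → Vec n} {c μ : ℝ}

theorem FactorAssumptions.modeFactors (h : FactorAssumptions σ x y z c μ) (hr : 0 < r) :
    ModeFactors σ x y z c μ (σ ⟨0, hr⟩) (σ ⟨r - 1, Nat.sub_lt hr Nat.one_pos⟩) where
  c_pos := h.c_pos
  rank_pos := hr
  low_pos := h.pos _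
  low_le l := h.antitone (by rw [Fin.le_def]; have := l.2; simp only; omega)
  le_high l := h.antitone (by rw [Fin.le_def]; simp)
  unit_fst := h.unit_x
  unit_snd := h.unit_y
  unit_trd := h.unit_z
  indep_fst := robustlyIndependent_of_le_smallestSingularValue hr h.c_pos.le h.independent_x
  indep_snd := robustlyIndependent_of_le_smallestSingularValue hr h.c_pos.le h.independent_y
  indep_trd := robustlyIndependent_of_le_smallestSingularValue hr h.c_pos.le h.independent_z
  incoh_fst := h.incoherent_x
  incoh_snd := h.incoherent_y
  incoh_trd := h.incoherent_z

variable {σ₁ σᵣ : ℝ}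

theorem ModeFactors.swap_fst_snd (h : ModeFactors σ x y z c μ σ₁ σᵣ) :
    ModeFactors σ y x z c μ σ₁ σᵣ :=
  ⟨h.c_pos, h.rank_pos, h.low_pos, h.low_le, h.le_high, h.unit_snd, h.unit_fst, h.unit_trd,
    h.indep_snd, h.indep_fst, h.indep_trd, h.incoh_snd, h.incoh_fst, h.incoh_trd⟩

theorem ModeFactors.rotate (h : ModeFactors σ x y z c μ σ₁ σᵣ) :
    ModeFactors σ z x y c μ σ₁ σᵣ :=
  ⟨h.c_pos, h.rank_pos, h.low_pos, h.low_le, h.le_high, h.unit_trd, h.unit_fst, h.unit_snd,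
    h.indep_trd, h.indep_fst, h.indep_snd, h.incoh_trd, h.incoh_fst, h.incoh_snd⟩

/-- A union bound over the three modes. It requires no independence between them, so they may share
one sample. -/
theorem ModeFactors.bernoulliProb_not_isSafeStep_le (h : ModeFactors σ x y z c μ σ₁ σᵣ)
    {μ' s p : ℝ} (hn : 0 < n) (h0 : 0 < p) (h1 : p ≤ 1) (hs0 : 0 < s) (hs : s ≤ 0.1)
    (hμμ' : μ ≤ μ') (hμ' : 36 * r ^ 2 * (σ₁ / σᵣ) ^ 2 * μ / c ^ 4 ≤ μ') {v : Estimates n}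
    (hv : AreGoodEstimates x y z μ' s v) :
    bernoulliProb p (fun S => ¬ IsSafeStep (fun v S v' => IsIteration r (cpTensor σ x y z) S v v')
        (AreGoodEstimates x y z μ' (s / 10)) v S)
      ≤ 3 * modeFailure n r c μ' (σ₁ / σᵣ) p := by
  have hx := h.bernoulliProb_not_safe_le hn h0 h1 hs0 hs hμμ' hμ' hv.good_y hv.good_z
    (unfoldingRow_modeX σ x y z)
  have hy := h.swap_fst_snd.bernoulliProb_not_safe_le hn h0 h1 hs0 hs hμμ' hμ' hv.good_x hv.good_z
    (unfoldingRow_modeY σ x y z)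
  have hz := h.rotate.bernoulliProb_not_safe_le hn h0 h1 hs0 hs hμμ' hμ' hv.good_x hv.good_y
    (unfoldingRow_modeZ σ x y z)
  set A := fun S => ∃ V', IsGoodEstimate r μ' (s / 10) (factorSpan x) V' ∧
    ∀ V'', IsModeUpdate r (modeX n) (cpTensor σ x y z) S v.y v.z V'' → V'' = V'
  set B := fun S => ∃ V', IsGoodEstimate r μ' (s / 10) (factorSpan y) V' ∧
    ∀ V'', IsModeUpdate r (modeY n) (cpTensor σ x y z) S v.x v.z V'' → V'' = V'
  set C := fun S => ∃ V', IsGoodEstimate r μ' (s / 10) (factorSpan z) V' ∧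
    ∀ V'', IsModeUpdate r (modeZ n) (cpTensor σ x y z) S v.x v.y V'' → V'' = V'
  have hsub : ∀ S, ¬ IsSafeStep (fun v S v' => IsIteration r (cpTensor σ x y z) S v v')
      (AreGoodEstimates x y z μ' (s / 10)) v S → ((¬ A S ∨ ¬ B S) ∨ ¬ C S) := by
    intro S hS
    by_contra hcon
    simp only [not_or, not_not] at hcon
    obtain ⟨⟨⟨Vx, hVx, hux⟩, ⟨Vy, hVy, huy⟩⟩, ⟨Vz, hVz, huz⟩⟩ := hcon
    refine hS ⟨⟨Vx, Vy, Vz⟩, ⟨hVx, hVy, hVz⟩, fun v'' hv'' => ?_⟩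
    have h2 := hux _ hv''.update_x
    have h3 := huy _ hv''.update_y
    have h4 := huz _ hv''.update_z
    cases v''
    simp only at h2 h3 h4
    rw [h2, h3, h4]
  have h2 := bernoulliProb_mono h0.le h1 hsub
  have h3 := bernoulliProb_or_le h0.le h1 (fun S => ¬ A S ∨ ¬ B S) (fun S => ¬ C S)
  have h4 := bernoulliProb_or_le h0.le h1 (fun S => ¬ A S) (fun S => ¬ B S)
  linarith

/-- The algorithm contracts the error by a factor `10` per round, up to the total failure
probability of the rounds. -/
theorem ModeFactors.roundsProb_exists_bad_run_le (h : ModeFactors σ x y z c μ σ₁ σᵣ)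
    {μ' p : ℝ} (hn : 0 < n) (h0 : 0 < p) (h1 : p ≤ 1)
    (hμμ' : μ ≤ μ') (hμ' : 36 * r ^ 2 * (σ₁ / σᵣ) ^ 2 * μ / c ^ 4 ≤ μ') {v : Estimates n}
    (hv : AreGoodEstimates x y z μ' 0.1 v) (k : ℕ) :
    roundsProb p (fun s : Fin k → Finset (Entry n) =>
        ∃ V, IsRun r (cpTensor σ x y z) s v V ∧
          ¬ AreGoodEstimates x y z μ' (0.1 / 10 ^ k) (V (Fin.last k)))
      ≤ k * (3 * modeFailure n r c μ' (σ₁ / σᵣ) p) := by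
  have hε : 0 ≤ 3 * modeFailure n r c μ' (σ₁ / σᵣ) p := by
    have := h.c_pos
    unfold modeFailure
    positivity
  have h2 := roundsProb_exists_bad_path_le
    (step := fun v S v' => IsIteration r (cpTensor σ x y z) S v v')
    (G := fun i => AreGoodEstimates x y z μ' (0.1 / 10 ^ i)) h0.le h1 hε (fun i v hv => ?_) k 0 v
    (by simpa using hv)
  · refine (roundsProb_mono h0.le h1 ?_).trans h2
    rintro s ⟨V, hV, hbad⟩
    exact ⟨V, ⟨hV.init, hV.step⟩, by rwa [zero_add]⟩
  · have h3 : (0.1 : ℝ) / 10 ^ (i + 1) = 0.1 / 10 ^ i / 10 := by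
      rw [pow_succ, div_div]
    rw [h3]
    refine h.bernoulliProb_not_isSafeStep_le hn h0 h1 (by positivity) ?_ hμμ' hμ' hv
    exact div_le_self (by norm_num) (one_le_pow₀ (by norm_num))

theorem exists_isRun (hrn : r ≤ n) (T : Tensor n) {v : Estimates n}
    (hx : Module.finrank ℝ v.x = r) (hy : Module.finrank ℝ v.y = r)
    (hz : Module.finrank ℝ v.z = r) {k : ℕ} (s : Fin k → Finset (Entry n)) :
    ∃ V, IsRun r T s v V := by
  obtain ⟨V, hV⟩ := exists_isPath (step := fun v S v' => IsIteration r T S v v')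
    (Q := fun v => Module.finrank ℝ v.x = r ∧ Module.finrank ℝ v.y = r ∧
      Module.finrank ℝ v.z = r)
    (fun v S hv => by
      obtain ⟨hx, hy, hz⟩ := hv
      obtain ⟨Vx, hVx⟩ := exists_isModeUpdate hrn (modeX n) T S hy hz
      obtain ⟨Vy, hVy⟩ := exists_isModeUpdate hrn (modeY n) T S hx hz
      obtain ⟨Vz, hVz⟩ := exists_isModeUpdate hrn (modeZ n) T S hx hy
      exact ⟨⟨Vx, Vy, Vz⟩, ⟨hVx, hVy, hVz⟩, hVx.finrank_eq, hVy.finrank_eq, hVz.finrank_eq⟩)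
    k v s ⟨hx, hy, hz⟩
  exact ⟨V, hV.init, hV.step⟩

end

/-! ### Parameters -/

/-- The tenth power in `p n²` dominates every polynomial factor in `modeFailure` with `10¹⁰` to
spare. The factor `L²` leaves an exponent of at least `10⁸ L`, which beats `n r⁴ ≤ exp (5 L)`. A
bound of order `1 / L` suffices because the number of rounds is of order `L`. -/
theorem modeFailure_le {n r : ℕ} {c μ' K p L : ℝ} (hr : 0 < r) (hrn : r ≤ n) (hc : 0 < c)
    (hc1 : c ≤ 1) (hK : 1 ≤ K) (hμ' : 1 ≤ μ') (hL : 1 ≤ L) (hnL : Real.log n ≤ L)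
    (hp : p = L ^ 2 / (n : ℝ) ^ 2 * (10 * r * μ' / c * K) ^ 10) :
    modeFailure n r c μ' K p ≤ 2 / (10 ^ 6 * L) := by
  have hr1 : (1 : ℝ) ≤ r := by exact_mod_cast hr
  have hn0 : (0 : ℝ) < n := by exact_mod_cast hr.trans_le hrn
  have hrn' : (r : ℝ) ≤ n := by exact_mod_cast hrn
  have hpn : p * n ^ 2 = L ^ 2 * (10 * r * μ' / c * K) ^ 10 := by
    rw [hp]; field_simp
  have hr4 : (1 : ℝ) ≤ (r : ℝ) ^ 4 := one_le_pow₀ hr1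
  have hr6 : (1 : ℝ) ≤ (r : ℝ) ^ 6 := one_le_pow₀ hr1
  have hμ8 : (1 : ℝ) ≤ μ' ^ 8 := one_le_pow₀ hμ'
  have hK8 : (1 : ℝ) ≤ K ^ 8 := one_le_pow₀ hK
  have hK2 : (1 : ℝ) ≤ K ^ 2 := one_le_pow₀ hK
  have hC : 1 ≤ 1 / c := by rw [le_div_iff₀ hc]; linarith
  have hC6 : 1 ≤ (1 / c) ^ 6 := one_le_pow₀ hC
  have hC4 : 1 ≤ (1 / c) ^ 4 := one_le_pow₀ hC
  have hX : (10 * r * μ' / c * K) ^ 10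
      = 10 ^ 10 * (r ^ 6 * μ' ^ 2 * (K ^ 2 * (1 / c) ^ 4)) * (r ^ 4 * μ' ^ 8 * K ^ 8 * (1 / c) ^ 6)
      := by
    field_simp
  have hrest : 1 ≤ (r : ℝ) ^ 4 * μ' ^ 8 * K ^ 8 * (1 / c) ^ 6 :=
    one_le_mul_of_one_le_of_one_le (one_le_mul_of_one_le_of_one_le
      (one_le_mul_of_one_le_of_one_le hr4 hμ8) hK8) hC6
  have hX1 : 10 ^ 10 * (r ^ 6 * μ' ^ 2 * (K ^ 2 * (1 / c) ^ 4)) ≤ (10 * r * μ' / c * K) ^ 10 := by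
    rw [hX]
    exact le_mul_of_one_le_right (by positivity) hrest
  have hX2 : 10 ^ 10 * (r ^ 6 * μ' ^ 2) ≤ (10 * r * μ' / c * K) ^ 10 := by
    refine le_trans ?_ hX1
    exact mul_le_mul_of_nonneg_left (le_mul_of_one_le_right (by positivity)
      (one_le_mul_of_one_le_of_one_le hK2 hC4)) (by norm_num)
  have hX3 : 10 ^ 10 * (r ^ 4 * μ' ^ 2 * K ^ 2 / c ^ 4) ≤ (10 * r * μ' / c * K) ^ 10 := by
    refine le_trans ?_ hX1
    have h1 : (r : ℝ) ^ 4 ≤ r ^ 6 := pow_le_pow_right₀ hr1 (by norm_num)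
    calc 10 ^ 10 * (r ^ 4 * μ' ^ 2 * K ^ 2 / c ^ 4)
        = 10 ^ 10 * (r ^ 4 * μ' ^ 2 * (K ^ 2 * (1 / c) ^ 4)) := by field_simp
      _ ≤ _ := by gcongr
  have hL0 : 0 < L := by linarith
  have hLL : L ≤ L ^ 2 := by nlinarith
  have hterm1 : 3 * n * r ^ 4 * Real.exp (-(p * n ^ 2 / (16 * r ^ 6 * μ' ^ 2)))
      ≤ 1 / (10 ^ 6 * L) := by
    have h1 : 10 ^ 8 * L ≤ p * n ^ 2 / (16 * r ^ 6 * μ' ^ 2) := by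
      rw [le_div_iff₀ (by positivity), hpn]
      calc 10 ^ 8 * L * (16 * r ^ 6 * μ' ^ 2) = L * (16 * 10 ^ 8 * (r ^ 6 * μ' ^ 2)) := by ring
        _ ≤ L ^ 2 * (10 ^ 10 * (r ^ 6 * μ' ^ 2)) := by gcongr; norm_num
        _ ≤ _ := by gcongr
    have h2 : (n : ℝ) * r ^ 4 ≤ Real.exp (5 * L) := by
      calc (n : ℝ) * r ^ 4 ≤ n * n ^ 4 := by gcongr
        _ = Real.exp (5 * Real.log n) := by
          rw [mul_comm (5 : ℝ), Real.exp_mul, Real.exp_log hn0]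
          norm_cast; ring
        _ ≤ _ := Real.exp_le_exp.mpr (by linarith)
    have h3 : Real.exp (5 * L) * Real.exp (-(p * n ^ 2 / (16 * r ^ 6 * μ' ^ 2)))
        ≤ (Real.exp (10 ^ 7 * L))⁻¹ := by
      rw [← Real.exp_add, ← Real.exp_neg]
      exact Real.exp_le_exp.mpr (by linarith)
    have h4 : 10 ^ 7 * L ≤ Real.exp (10 ^ 7 * L) := by
      have := Real.add_one_le_exp (10 ^ 7 * L)
      linarith
    have h5 : (Real.exp (10 ^ 7 * L))⁻¹ ≤ (10 ^ 7 * L)⁻¹ := inv_anti₀ (by positivity) h4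
    calc _ = 3 * (n * r ^ 4 * Real.exp (-(p * n ^ 2 / (16 * r ^ 6 * μ' ^ 2)))) := by ring
      _ ≤ 3 * (Real.exp (5 * L) * Real.exp (-(p * n ^ 2 / (16 * r ^ 6 * μ' ^ 2)))) := by gcongr
      _ ≤ 3 * (10 ^ 7 * L)⁻¹ := by gcongr; exact h3.trans h5
      _ ≤ _ := by
        rw [← div_eq_mul_inv, div_le_div_iff₀ (by positivity) (by positivity)]
        nlinarith
  have hterm2 : 10 ^ 4 * μ' ^ 2 * r ^ 4 * K ^ 2 / (n ^ 2 * p * c ^ 4) ≤ 1 / (10 ^ 6 * L) := by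
    rw [mul_comm _ p, hpn]
    have h1 : 10 ^ 4 * μ' ^ 2 * r ^ 4 * K ^ 2
        / (L ^ 2 * (10 * r * μ' / c * K) ^ 10 * c ^ 4)
        = 10 ^ 4 * (r ^ 4 * μ' ^ 2 * K ^ 2 / c ^ 4) / (L ^ 2 * (10 * r * μ' / c * K) ^ 10) := by
      field_simp
    rw [h1, div_le_div_iff₀ (by positivity) (by positivity)]
    calc 10 ^ 4 * (r ^ 4 * μ' ^ 2 * K ^ 2 / c ^ 4) * (10 ^ 6 * L)
        = L * (10 ^ 10 * (r ^ 4 * μ' ^ 2 * K ^ 2 / c ^ 4)) := by ring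
      _ ≤ L ^ 2 * (10 * r * μ' / c * K) ^ 10 := by gcongr
      _ = _ := by ring
  rw [modeFailure]
  refine (add_le_add hterm1 hterm2).trans (le_of_eq ?_)
  ring

/-- As `10 ≥ e²`, the power `10 ^ (k + 1)` is at least `Q ^ 200`, and `Q ≥ 10` gives `Q ^ 200 ≥ (10
Q) ^ 100`. The initial error `0.1` supplies the extra power of ten that makes up for rounding `k`
down. -/
theorem one_div_ten_pow_le {Q : ℝ} (hQ : 10 ≤ Q) {k : ℕ} (hk : 100 * Real.log Q ≤ k + 1) :
    0.1 / 10 ^ k ≤ (1 / (10 * Q)) ^ 100 := by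
  have hQ0 : 0 < Q := by linarith
  have h1 : Q ^ 200 ≤ 10 ^ (k + 1) := by
    have h2 : Real.exp 2 ≤ 10 := by
      have h3 := Real.exp_one_lt_d9
      have h4 : Real.exp 2 = Real.exp 1 * Real.exp 1 := by rw [← Real.exp_add]; norm_num
      rw [h4]
      nlinarith [Real.exp_pos 1]
    calc Q ^ 200 = Real.exp (200 * Real.log Q) := by
          rw [mul_comm, Real.exp_mul, Real.exp_log hQ0]; norm_cast
      _ ≤ Real.exp ((k + 1 : ℕ) * 2) := Real.exp_le_exp.mpr (by push_cast; linarith)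
      _ = Real.exp 2 ^ (k + 1) := Real.exp_nat_mul 2 (k + 1)
      _ ≤ _ := pow_le_pow_left₀ (Real.exp_pos _).le h2 _
  have h5 : (10 * Q) ^ 100 ≤ Q ^ 200 := by
    calc (10 * Q) ^ 100 ≤ (Q * Q) ^ 100 := by gcongr
      _ = _ := by ring
  have h6 : (0.1 : ℝ) / 10 ^ k = 1 / 10 ^ (k + 1) := by
    rw [pow_succ]; field_simp; norm_num
  rw [h6, one_div_pow]
  exact one_div_le_one_div_of_le (by positivity) (h5.trans h1)

/-- The sampling rates are admissible when all parameters are bounded by a small power `N` of the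
dimension. -/
theorem rates_admissible {n r k : ℕ} {C K μ N M ℓ L : ℝ} (hN : 10 ^ 4 ≤ N) (hNM : N ^ 1500 ≤ M)
    (hM0 : 0 < M) (hM : (n : ℝ) = M ^ 2) (hr : 1 ≤ (r : ℝ)) (hrN : r ≤ N) (hC : 1 ≤ C)
    (hCN : C ≤ N) (hK : 1 ≤ K) (hKN : K ≤ N) (hμ : 1 ≤ μ) (hμN : μ ≤ N) (hℓ : 1 ≤ ℓ)
    (hℓN : ℓ ≤ N) (hL : 1 ≤ L) (hLN : L ≤ 3 * N) (hk : (k : ℝ) ≤ 101 * L) :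
    k * (L ^ 2 / (n : ℝ) ^ 2 * (10 * r * (2 * μ * r * C ^ 2 * K ^ 2) ^ 10 * C * K) ^ 10)
        ≤ (μ * r * ℓ * C * K) ^ 300 * (1 / M ^ 3) ∧
      (μ * r * ℓ * C * K) ^ 300 * (1 / M ^ 3) ≤ 1 := by
  have hN1 : 1 ≤ N := le_trans (by norm_num) hN
  have hN0 : 0 < N := by linarith
  have hM1 : 1 ≤ M := (one_le_pow₀ hN1).trans hNM
  constructor
  · have h1 : 1 ≤ (μ * r * ℓ * C * K) ^ 300 := by
      refine one_le_pow₀ ?_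
      exact one_le_mul_of_one_le_of_one_le (one_le_mul_of_one_le_of_one_le
        (one_le_mul_of_one_le_of_one_le (one_le_mul_of_one_le_of_one_le hμ hr) hℓ) hC) hK
    have h2 : 2 * μ * r * C ^ 2 * K ^ 2 ≤ N ^ 7 := by
      calc 2 * μ * r * C ^ 2 * K ^ 2 ≤ N * N * N * N ^ 2 * N ^ 2 := by
            gcongr
            linarith
        _ = N ^ 7 := by ring
    have h3 : (10 * r * (2 * μ * r * C ^ 2 * K ^ 2) ^ 10 * C * K) ^ 10 ≤ N ^ 740 := by
      calc (10 * r * (2 * μ * r * C ^ 2 * K ^ 2) ^ 10 * C * K) ^ 10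
          ≤ (N * N * (N ^ 7) ^ 10 * N * N) ^ 10 := by
            gcongr
            linarith
        _ = N ^ 740 := by ring
    have h4 : k * L ^ 2 ≤ N ^ 4 := by
      calc k * L ^ 2 ≤ 101 * L * L ^ 2 := by gcongr
        _ = 101 * L ^ 3 := by ring
        _ ≤ 101 * (3 * N) ^ 3 := by gcongr
        _ = 2727 * N ^ 3 := by ring
        _ ≤ N * N ^ 3 := by gcongr; linarith
        _ = N ^ 4 := by ring
    -- With `n = M²`, the rate `p'` carries `M⁻⁴` and `p₂` carries `M⁻³`; the spare factor `M`
    -- absorbs `N ^ 4 * N ^ 740`.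
    have h5 : N ^ 744 ≤ M := (pow_le_pow_right₀ hN1 (by norm_num)).trans hNM
    rw [hM]
    calc k * (L ^ 2 / (M ^ 2) ^ 2 * (10 * r * (2 * μ * r * C ^ 2 * K ^ 2) ^ 10 * C * K) ^ 10)
        = (k * L ^ 2) * (10 * r * (2 * μ * r * C ^ 2 * K ^ 2) ^ 10 * C * K) ^ 10 / M ^ 4 := by ring
      _ ≤ N ^ 4 * N ^ 740 / M ^ 4 := by gcongr
      _ = N ^ 744 / M ^ 4 := by ring
      _ ≤ M / M ^ 4 := by gcongr
      _ = 1 * (1 / M ^ 3) := by field_simp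
      _ ≤ _ := by gcongr
  · have h1 : (μ * r * ℓ * C * K) ^ 300 ≤ N ^ 1500 := by
      calc (μ * r * ℓ * C * K) ^ 300 ≤ (N * N * N * N * N) ^ 300 := by gcongr
        _ = N ^ 1500 := by ring
    rw [mul_one_div, div_le_one (by positivity)]
    calc _ ≤ M := h1.trans hNM
      _ ≤ M ^ 3 := le_self_pow₀ hM1 (by norm_num)

theorem exists_dimension_bound (δ : ℝ) (hδ : 0 < δ) :
    ∃ n₀ : ℕ, ∀ n : ℕ, n₀ ≤ n → 10 ≤ n ∧ Real.log n ≤ (n : ℝ) ^ δ ∧ 10 ^ 4 ≤ (n : ℝ) ^ δ := by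
  have h1 := (isLittleO_log_rpow_atTop hδ).bound zero_lt_one
  have h2 := (tendsto_rpow_atTop hδ).eventually_ge_atTop (10 ^ 4)
  have h3 := tendsto_natCast_atTop_atTop (R := ℝ) |>.eventually (h1.and h2)
  obtain ⟨n₀, hn₀⟩ := Filter.eventually_atTop.mp h3
  refine ⟨max n₀ 10, fun n hn => ⟨(le_max_right _ _).trans hn, ?_⟩⟩
  obtain ⟨h4, h5⟩ := hn₀ n ((le_max_left _ _).trans hn)
  refine ⟨?_, h5⟩
  rw [one_mul, Real.norm_eq_abs, Real.norm_eq_abs, abs_of_nonneg (by positivity :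
    (0 : ℝ) ≤ (n : ℝ) ^ δ)] at h4
  exact (le_abs_self _).trans h4

end TensorCompletion

end

/-! ### Choice of the constants and the final union bound. -/

theorem corollary5p6 :
    ∃ δ : ℝ, 0 < δ ∧ ∃ n₀ : ℕ,
    ∀ (n r : ℕ) (_hn : n₀ ≤ n) (hr : 0 < r)
      (σ : Fin r → ℝ) (x y z : Fin r → EuclideanSpace ℝ (Fin n)) (c μ : ℝ)
      (_hF : TensorCompletion.FactorAssumptions σ x y z c μ)
      (σ₁ σᵣ : ℝ) (_hσ₁ : σ₁ = σ ⟨0, hr⟩) (_hσᵣ : σᵣ = σ ⟨r - 1, Nat.sub_lt hr Nat.one_pos⟩)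
      (_hδ : max (max (r : ℝ) (σ₁ / σᵣ)) (max (1 / c) μ) ≤ (n : ℝ) ^ δ)
      (μ' : ℝ) (_hμ' : μ' = (2 * μ * r / c ^ 2 * (σ₁ ^ 2 / σᵣ ^ 2)) ^ 10)
      (V₀ : TensorCompletion.Estimates n)
      (_hdim_x : Module.finrank ℝ V₀.x = r)
      (_hdim_y : Module.finrank ℝ V₀.y = r)
      (_hdim_z : Module.finrank ℝ V₀.z = r)
      (_hangle : max (TensorCompletion.sinAngle (TensorCompletion.factorSpan x) V₀.x)
        (max (TensorCompletion.sinAngle (TensorCompletion.factorSpan y) V₀.y)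
          (TensorCompletion.sinAngle (TensorCompletion.factorSpan z) V₀.z)) ≤ 0.1)
      (_hinc_x : TensorCompletion.IsIncoherent μ' V₀.x)
      (_hinc_y : TensorCompletion.IsIncoherent μ' V₀.y)
      (_hinc_z : TensorCompletion.IsIncoherent μ' V₀.z)
      (p₂ p' : ℝ)
      (_hp₂ : p₂ = (μ * r * Real.log n / c * (σ₁ / σᵣ)) ^ 300 * (1 / (n : ℝ) ^ (3 / 2 : ℝ)))
      (_hp' : p' = Real.log (n * σ₁ / (c * σᵣ)) ^ 2 / (n : ℝ) ^ 2
        * (10 * r * μ' / c * (σ₁ / σᵣ)) ^ 10)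
      -- the number of iterations is `10² log (n σ₁ / (c σᵣ))`, rounded up or down
      (k : ℕ) (_hk : |(k : ℝ) - 10 ^ 2 * Real.log (n * σ₁ / (c * σᵣ))| < 1),
      -- the parameters are admissible for the algorithm
      (k * p' ≤ p₂ ∧ p₂ ≤ 1) ∧
      -- the guarantee, for every sample, splitting of it, and run of the algorithm
      ∀ (Ω : Type*) [MeasurableSpace Ω] (P : MeasureTheory.Measure Ω)
        [MeasureTheory.IsProbabilityMeasure P]
        (S : Ω → Finset (TensorCompletion.Entry n))
        (S' : Fin k → Ω → Finset (TensorCompletion.Entry n))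
        (_hS : TensorCompletion.IsBernoulliSample P p₂ S)
        (_hS' : TensorCompletion.IsSampleSplitting P p' S S'),
        0.99 ≤ P.real {ω |
          (∃ V : Fin (k + 1) → TensorCompletion.Estimates n,
            TensorCompletion.IsRun r (TensorCompletion.cpTensor σ x y z) (fun t => S' t ω) V₀ V) ∧
          ∀ V : Fin (k + 1) → TensorCompletion.Estimates n,
            TensorCompletion.IsRun r (TensorCompletion.cpTensor σ x y z) (fun t => S' t ω) V₀ V →
            max (TensorCompletion.sinAngle (TensorCompletion.factorSpan x) (V (Fin.last k)).x)
              (max (TensorCompletion.sinAngle (TensorCompletion.factorSpan y) (V (Fin.last k)).y)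
                (TensorCompletion.sinAngle (TensorCompletion.factorSpan z) (V (Fin.last k)).z))
              ≤ (σᵣ * c / (10 * σ₁ * n)) ^ (10 ^ 2)} := by
  -- The exponent must be small enough for `N ^ 1500 ≤ √n`, where `N = n ^ δ` bounds all parameters;
  -- `1500` is five parameters to the power `300` in `p₂`.
  obtain ⟨n₀, hn₀⟩ := TensorCompletion.exists_dimension_bound (1 / 10 ^ 6) (by norm_num)
  refine ⟨1 / 10 ^ 6, by norm_num, n₀, ?_⟩
  intro n r hn hr σ x y z c μ hF σ₁ σᵣ hσ₁ hσᵣ hδ μ' hμ' V₀ hdim_x hdim_y hdim_z hangle hinc_x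
    hinc_y hinc_z p₂ p' hp₂ hp' k hk
  obtain ⟨hn10, hlogN, hN⟩ := hn₀ n hn
  have hM := hF.modeFactors hr
  rw [← hσ₁, ← hσᵣ] at hM
  set N : ℝ := (n : ℝ) ^ (1 / 10 ^ 6 : ℝ) with hNdef
  have hn10' : (10 : ℝ) ≤ n := by exact_mod_cast hn10
  have hn0 : (0 : ℝ) < n := by linarith
  have hc := hM.c_pos
  have hc1 : c ≤ 1 := hM.indep_fst.le_one hr hM.unit_fst
  have hσr0 := hM.low_pos
  have hσ0 := hM.high_pos
  have hσσ : σᵣ ≤ σ₁ := (hM.low_le ⟨0, hr⟩).trans (hM.le_high _)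
  have hr1 : (1 : ℝ) ≤ r := by exact_mod_cast hr
  have hμ1 : 1 ≤ μ := hM.one_le_incoh
  have hfin := hM.indep_fst.finrank_factorSpan hc
  have hrn : r ≤ n := by
    have := Submodule.finrank_le (TensorCompletion.factorSpan x)
    rw [hfin] at this
    simpa using this
  set K : ℝ := σ₁ / σᵣ with hK
  set C : ℝ := 1 / c with hC
  have hK1 : 1 ≤ K := by rw [hK, le_div_iff₀ hσr0]; linarith
  have hC1 : 1 ≤ C := by rw [hC, le_div_iff₀ hc]; linarith
  simp only [max_le_iff] at hδ hangle
  obtain ⟨⟨hrN, hKN⟩, hCN, hμN⟩ := hδ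
  obtain ⟨hang_x, hang_y, hang_z⟩ := hangle
  have hN1 : 1 ≤ N := le_trans (by norm_num) hN
  -- the logarithm that governs the number of rounds
  set Q : ℝ := n * σ₁ / (c * σᵣ) with hQ
  have hQeq : Q = n * (K * C) := by rw [hQ, hK, hC]; field_simp
  have hKC : 1 ≤ K * C := one_le_mul_of_one_le_of_one_le hK1 hC1
  have hnQ : (n : ℝ) ≤ Q := by rw [hQeq]; exact le_mul_of_one_le_right hn0.le hKC
  have hQ0 : 0 < Q := by linarith
  set L : ℝ := Real.log Q with hL
  have hlogn : 1 ≤ Real.log n := by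
    rw [Real.le_log_iff_exp_le hn0]
    have := Real.exp_one_lt_d9
    linarith
  have hnL : Real.log n ≤ L := Real.log_le_log hn0 hnQ
  have hL1 : 1 ≤ L := hlogn.trans hnL
  have hNn : N ≤ n := by
    calc N ≤ (n : ℝ) ^ (1 : ℝ) := Real.rpow_le_rpow_of_exponent_le (by linarith) (by norm_num)
      _ = n := Real.rpow_one _
  have hLN : L ≤ 3 * N := by
    have h1 : Q ≤ (n : ℝ) ^ 3 := by
      calc Q = n * (K * C) := hQeq
        _ ≤ n * (n * n) := by
          gcongr
          · exact hKN.trans hNn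
          · exact hCN.trans hNn
        _ = _ := by ring
    calc L ≤ Real.log ((n : ℝ) ^ 3) := Real.log_le_log hQ0 h1
      _ = 3 * Real.log n := by rw [Real.log_pow]; norm_num
      _ ≤ 3 * N := by linarith
  obtain ⟨hk1, hk2⟩ := abs_lt.mp hk
  have hkL : (k : ℝ) ≤ 101 * L := by linarith
  have hk0 : 1 ≤ (k : ℝ) := by
    have : (0 : ℝ) < k := by linarith
    exact_mod_cast this
  -- the sampling rates
  have hμ'eq : μ' = (2 * μ * r * C ^ 2 * K ^ 2) ^ 10 := by
    rw [hμ', hC, hK]; field_simp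
  have hY : 1 ≤ μ * r * C ^ 2 * K ^ 2 :=
    one_le_mul_of_one_le_of_one_le (one_le_mul_of_one_le_of_one_le
      (one_le_mul_of_one_le_of_one_le hμ1 hr1) (one_le_pow₀ hC1)) (one_le_pow₀ hK1)
  have hμ'Y : μ' = 1024 * (μ * r * C ^ 2 * K ^ 2) ^ 10 := by rw [hμ'eq]; ring
  have hY2 : 36 * (μ * r * C ^ 2 * K ^ 2) ^ 2 ≤ μ' := by
    rw [hμ'Y]
    gcongr
    · norm_num
    · norm_num
  have hμ'1 : 1 ≤ μ' := by
    rw [hμ'Y]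
    have := one_le_pow₀ hY (n := 10)
    linarith
  have hμμ' : μ ≤ μ' := by
    have h1 : μ ≤ μ * r * C ^ 2 * K ^ 2 := by
      rw [mul_assoc, mul_assoc]
      exact le_mul_of_one_le_right (by linarith) (one_le_mul_of_one_le_of_one_le hr1
        (one_le_mul_of_one_le_of_one_le (one_le_pow₀ hC1) (one_le_pow₀ hK1)))
    have h2 : μ * r * C ^ 2 * K ^ 2 ≤ (μ * r * C ^ 2 * K ^ 2) ^ 2 :=
      le_self_pow₀ hY (by norm_num)
    have h3 : 0 ≤ (μ * r * C ^ 2 * K ^ 2) ^ 2 := sq_nonneg _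
    linarith
  have hμ'36 : 36 * r ^ 2 * (σ₁ / σᵣ) ^ 2 * μ / c ^ 4 ≤ μ' := by
    refine le_trans ?_ hY2
    have h1 : 36 * r ^ 2 * (σ₁ / σᵣ) ^ 2 * μ / c ^ 4 = 36 * (r ^ 2 * K ^ 2 * C ^ 4 * μ) := by
      rw [hK, hC]; field_simp
    have h2 : 36 * (μ * r * C ^ 2 * K ^ 2) ^ 2
        = 36 * (r ^ 2 * K ^ 2 * C ^ 4 * μ) * (μ * K ^ 2) := by ring
    rw [h1, h2]
    exact le_mul_of_one_le_right (by positivity)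
      (one_le_mul_of_one_le_of_one_le hμ1 (one_le_pow₀ hK1))
  have hsqrt : (n : ℝ) = ((n : ℝ) ^ (1 / 2 : ℝ)) ^ 2 := by
    rw [← Real.rpow_natCast, ← Real.rpow_mul hn0.le]; norm_num
  have hcube : (n : ℝ) ^ (3 / 2 : ℝ) = ((n : ℝ) ^ (1 / 2 : ℝ)) ^ 3 := by
    rw [← Real.rpow_natCast, ← Real.rpow_mul hn0.le]; norm_num
  have hNM : N ^ 1500 ≤ (n : ℝ) ^ (1 / 2 : ℝ) := by
    rw [hNdef, ← Real.rpow_natCast, ← Real.rpow_mul hn0.le]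
    exact Real.rpow_le_rpow_of_exponent_le (by linarith) (by norm_num)
  have hrates := TensorCompletion.rates_admissible (n := n) (k := k) hN hNM (by positivity) hsqrt
    hr1 hrN hC1 hCN hK1 hKN hμ1 hμN hlogn hlogN hL1 hLN hkL
  have hp₂eq : p₂ = (μ * r * Real.log n * C * K) ^ 300 * (1 / ((n : ℝ) ^ (1 / 2 : ℝ)) ^ 3) := by
    rw [hp₂, hcube, hC]
    congr 2
    field_simp
  have hp'eq : p' = L ^ 2 / (n : ℝ) ^ 2
      * (10 * r * (2 * μ * r * C ^ 2 * K ^ 2) ^ 10 * C * K) ^ 10 := by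
    rw [hp', ← hμ'eq, hC]
    congr 2
    field_simp
  rw [← hp₂eq, ← hp'eq] at hrates
  refine ⟨hrates, ?_⟩
  have hp'0 : 0 < p' := by rw [hp']; positivity
  have hp'1 : p' ≤ 1 := (le_mul_of_one_le_left hp'0.le hk0).trans (hrates.1.trans hrates.2)
  -- the run of the algorithm
  intro Ω _ P _ S S' hS hS'
  have hinit : TensorCompletion.AreGoodEstimates x y z μ' 0.1 V₀ :=
    ⟨⟨hdim_x, hinc_x, hang_x⟩, ⟨hdim_y, hinc_y, hang_y⟩, ⟨hdim_z, hinc_z, hang_z⟩⟩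
  have hbad := hM.roundsProb_exists_bad_run_le (by omega) hp'0 hp'1 hμμ' hμ'36 hinit k
  have hfail := TensorCompletion.modeFailure_le hr hrn hc hc1 hK1 hμ'1 hL1 hnL hp'
  have hacc : (0.1 : ℝ) / 10 ^ k ≤ (σᵣ * c / (10 * σ₁ * n)) ^ (10 ^ 2) := by
    -- Either rounding satisfies `100 L ≤ k + 1`.
    have h1 := TensorCompletion.one_div_ten_pow_le (hn10'.trans hnQ) (k := k) (by linarith)
    have h2 : σᵣ * c / (10 * σ₁ * n) = 1 / (10 * Q) := by rw [hQ]; field_simp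
    rw [h2]
    norm_num at h1 ⊢
    exact h1
  have hprob := hS'.prob_setOf (fun s =>
    (∃ V : Fin (k + 1) → TensorCompletion.Estimates n,
      TensorCompletion.IsRun r (TensorCompletion.cpTensor σ x y z) s V₀ V) ∧
    ∀ V : Fin (k + 1) → TensorCompletion.Estimates n,
      TensorCompletion.IsRun r (TensorCompletion.cpTensor σ x y z) s V₀ V →
      max (TensorCompletion.sinAngle (TensorCompletion.factorSpan x) (V (Fin.last k)).x)
        (max (TensorCompletion.sinAngle (TensorCompletion.factorSpan y) (V (Fin.last k)).y)
          (TensorCompletion.sinAngle (TensorCompletion.factorSpan z) (V (Fin.last k)).z))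
        ≤ (σᵣ * c / (10 * σ₁ * n)) ^ (10 ^ 2))
  rw [hprob, TensorCompletion.roundsProb_not]
  refine le_trans ?_ (sub_le_sub_left
    ((TensorCompletion.roundsProb_mono hp'0.le hp'1 fun s hs => ?_).trans hbad) 1)
  · have h1 : k * (3 * TensorCompletion.modeFailure n r c μ' K p') ≤ 0.01 := by
      calc k * (3 * TensorCompletion.modeFailure n r c μ' K p')
          ≤ k * (3 * (2 / (10 ^ 6 * L))) := by gcongr
        _ ≤ 101 * L * (3 * (2 / (10 ^ 6 * L))) := by gcongr
        -- At most `101 L` rounds, three modes each, failure probability `2 / (10⁶ L)` per mode.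
        _ = 606 / 10 ^ 6 := by field_simp; norm_num
        _ ≤ 0.01 := by norm_num
    linarith
  · by_contra hcon
    push Not at hcon
    -- A run exists for every sequence of samples; only its accuracy is a matter of probability.
    refine hs ⟨TensorCompletion.exists_isRun hrn _ hdim_x hdim_y hdim_z s, fun V hV => ?_⟩
    obtain ⟨hx, hy, hz⟩ := hcon V hV
    exact max_le (hx.angle.trans hacc) (max_le (hy.angle.trans hacc) (hz.angle.trans hacc))
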